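/- Let $n,\alpha\ge 0$ be integers. The arboricity of a graph $G=(V,E)$ is $\max_{U}\lceil |E(U)|/(|U|-1)\rceil$, the maximum over the vertex sets $U\subseteq V$ with $|U|\ge 2$, where $E(U)$ is the set of edges with both endpoints in $U$. An arboricity-$\alpha$-preserving sequence on $n$ vertices is a finite sequence of edge insertions and deletions, starting from the empty graph on the vertex set $\{0,\dots,n-1\}$, such that the arboricity of the dynamic graph is at most $\alpha$ at all times. Let $G_i$ denote the graph after $i$ updates. (1) (Centralized local algorithm.) There are a single deterministic program for the word RAM with words of $O(\log n)$ bits, in which every vertex has its own zero-initialized array of memory cells and nothing but these arrays survives from one update to the next, and absolute constants $C$ and $r$, such that for all $n$ and $\alpha$ and every arboricity-$\alpha$-preserving sequence of $t$ updates on $n$ vertices, served online: (a) after every update the memory stores a maximal matching of the current graph (each vertex stores its partner, if any); (b) (amortized update time) the total number of elementary steps is at most $C\,(\alpha+\sqrt{\alpha\log n})\cdot t$; (c) (locality) while processing an update of an edge $uv$ the program reads and writes only the memory of vertices at distance at most $r$ from $u$ or $v$; (d) (linear space) at every moment while the $i$-th update is processed the arrays occupy at most $C\,(n+|E(G_i)|)$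 cells in total. (2) (Distributed algorithm.) There are a single deterministic protocol for synchronous message passing with messages of $O(\log n)$ bits in the local wakeup model (after an update of an edge $uv$ only $u$ and $v$ wake up; any other processor wakes up only when it receives a message; messages travel along the edges of the current graph) and absolute constants $C$ and $R$, such that for all $n$ and $\alpha$ and every arboricity-$\alpha$-preserving sequence of $t$ updates on $n$ vertices: (a) after every update, the processors' outputs (each processor knows its partner, if any) form a maximal matching of the current graph; (b) (worst-case update time) every update is completely processed within $R$ communication rounds; (c) (amortized message complexity) the total number of messages sent is at most $C\,(\alpha+\sqrt{\alpha\log n})\cdot t$. -/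

import Mathlib

namespace DynMatching

/-! ### Dynamic graphs of bounded arboricity -/

/-- The arboricity `max_U ⌈|E(U)| / (|U| - 1)⌉`, over all vertex sets `U` with at least two
vertices, where `E(U)` is the set of the edges with both endpoints in `U`. -/
noncomputable def arboricity {V : Type*} [Fintype V] (G : SimpleGraph V) : ℕ :=
  (Finset.univ.filter fun U : Finset V => 2 ≤ U.card).sup fun U =>
    ⌈(({e ∈ G.edgeSet | ∀ x ∈ e, x ∈ U}.ncard : ℚ) / ((U.card : ℚ) - 1))⌉₊

/-- The two kinds of edge updates. -/
inductive Kind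
  | insert
  | delete

/-- An update of a dynamic graph on the vertex set `Fin n`: the edge `uv` is inserted or
deleted. -/
structure Update (n : ℕ) where
  kind : Kind
  u : Fin n
  v : Fin n

/-- An edge may be inserted if it joins two distinct non-adjacent vertices, and deleted if it is
present. -/
def Update.Valid {n : ℕ} (G : SimpleGraph (Fin n)) (e : Update n) : Prop :=
  match e.kind with
  | .insert => e.u ≠ e.v ∧ ¬ G.Adj e.u e.v
  | .delete => G.Adj e.u e.v

/-- The graph after the update. -/
def Update.apply {n : ℕ} (G : SimpleGraph (Fin n)) (e : Update n) : SimpleGraph (Fin n) :=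
  match e.kind with
  | .insert => G ⊔ SimpleGraph.edge e.u e.v
  | .delete => G.deleteEdges {s(e.u, e.v)}

/-- The graph after the first `i` updates of `σ`, starting from the empty graph. -/
def graphAt {n : ℕ} (σ : List (Update n)) (i : ℕ) : SimpleGraph (Fin n) :=
  (σ.take i).foldl Update.apply ⊥

/-- Starting from the empty graph, every update of `σ` is valid and the arboricity is at most `α`
at all times. -/
def ArboricityPreserving {n : ℕ} (α : ℕ) (σ : List (Update n)) : Prop :=
  ∀ i (hi : i < σ.length),
    (σ[i]).Valid (graphAt σ i) ∧ arboricity (graphAt σ (i + 1)) ≤ α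

/-- The table `mate` (`none` for a free vertex, otherwise the name of the partner) describes a
maximal matching of `G`. -/
def DescribesMaximalMatching {n : ℕ} (G : SimpleGraph (Fin n)) (mate : Fin n → Option ℕ) : Prop :=
  ∃ M : G.Subgraph, Maximal (fun M' : G.Subgraph => M'.IsMatching) M ∧
    ∀ (v : Fin n) (k : ℕ), mate v = some k ↔ ∃ w : Fin n, (w : ℕ) = k ∧ M.Adj v w

/-- A natural number that fits in `K * ⌈log₂ (n + 1)⌉` bits. -/
def IsWord (K n x : ℕ) : Prop :=
  Nat.size x ≤ K * Nat.size n

/-! ### Centralized algorithms: a word RAM whose memory is distributed over the vertices -/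

/-- A memory: every vertex `v` has an array of cells, the `i`-th of which is `m v i`. -/
abbrev Memory : Type := ℕ → ℕ → ℕ

/-- A state of the machine: the registers and the memory. -/
structure RamState where
  reg : ℕ → ℕ
  mem : Memory

/-- The elementary instructions; `x`, `y`, `z` are names of registers. -/
inductive Instr
  /-- `x := k` -/
  | const (x k : ℕ)
  /-- `x := y + z` -/
  | add (x y z : ℕ)
  /-- `x := y - z`, truncated at `0` -/
  | sub (x y z : ℕ)
  /-- `x :=` the cell with index `z` in the array of the vertex `y` -/
  | load (x y z : ℕ)
  /-- the cell with index `z` in the array of the vertex `y` `:= x` -/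
  | store (x y z : ℕ)

/-- Assign the value `a` to the register `x`. -/
def RamState.setReg (s : RamState) (x a : ℕ) : RamState :=
  { s with reg := Function.update s.reg x a }

/-- The effect of an instruction. -/
def Instr.run : Instr → RamState → RamState
  | const x k, s => s.setReg x k
  | add x y z, s => s.setReg x (s.reg y + s.reg z)
  | sub x y z, s => s.setReg x (s.reg y - s.reg z)
  | load x y z, s => s.setReg x (s.mem (s.reg y) (s.reg z))
  | store x y z, s =>
      { s with
        mem := Function.update s.mem (s.reg y)
          (Function.update (s.mem (s.reg y)) (s.reg z) (s.reg x)) }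

/-- The vertices whose memory is read or written by an instruction. -/
def Instr.touches : Instr → RamState → Set ℕ
  | load _ y _, s => {s.reg y}
  | store _ y _, s => {s.reg y}
  | _, _ => ∅

/-- The tests: `x = y` and `x < y` for registers `x` and `y`. -/
inductive Test
  | eq (x y : ℕ)
  | lt (x y : ℕ)

/-- The truth of a test. -/
def Test.Holds : Test → RamState → Prop
  | eq x y, s => s.reg x = s.reg y
  | lt x y, s => s.reg x < s.reg y

/-- Programs. -/
inductive Program
  | skip
  | instr (i : Instr)
  | seq (p q : Program)
  | ite (b : Test) (p q : Program)
  | while (b : Test) (p : Program)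

/-- `Exec A Ok p s t s'`: the program `p`, started in the state `s`, halts in the state `s'` after
`t` elementary steps (instructions and tests), on the way it reads and writes only the memory of
vertices in `A`, and every state that it passes through satisfies `Ok`. -/
inductive Exec (A : Set ℕ) (Ok : RamState → Prop) :
    Program → RamState → ℕ → RamState → Prop
  | skip (s : RamState) : Exec A Ok .skip s 1 s
  | instr (i : Instr) (s : RamState) :
      i.touches s ⊆ A → Ok (i.run s) → Exec A Ok (.instr i) s 1 (i.run s)
  | seq (p q : Program) (s₁ s₂ s₃ : RamState) (t₁ t₂ : ℕ) :
      Exec A Ok p s₁ t₁ s₂ → Exec A Ok q s₂ t₂ s₃ → Exec A Ok (.seq p q) s₁ (t₁ + t₂) s₃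
  | ite_true (b : Test) (p q : Program) (s s' : RamState) (t : ℕ) :
      b.Holds s → Exec A Ok p s t s' → Exec A Ok (.ite b p q) s (t + 1) s'
  | ite_false (b : Test) (p q : Program) (s s' : RamState) (t : ℕ) :
      ¬ b.Holds s → Exec A Ok q s t s' → Exec A Ok (.ite b p q) s (t + 1) s'
  | while_true (b : Test) (p : Program) (s₁ s₂ s₃ : RamState) (t₁ t₂ : ℕ) :
      b.Holds s₁ → Exec A Ok p s₁ t₁ s₂ → Exec A Ok (.while b p) s₂ t₂ s₃ →
      Exec A Ok (.while b p) s₁ (t₁ + t₂ + 1) s₃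
  | while_false (b : Test) (p : Program) (s : RamState) :
      ¬ b.Holds s → Exec A Ok (.while b p) s 1 s

/-- The state in which the machine starts to process an update: the memory is the one left behind
by the preceding updates, and the registers hold the update and nothing else. -/
def inputState {n : ℕ} (e : Update n) (m : Memory) : RamState where
  reg := fun x =>
    match x with
    | 0 => match e.kind with
      | .insert => 0
      | .delete => 1
    | 1 => e.u
    | 2 => e.v
    | _ => 0
  mem := m

/-- The memory occupies at most `S` cells: outside initial segments of the arrays of the `n`
vertices, of total length at most `S`, all cells are `0` (as they are at the beginning). -/
def UsesSpace (n S : ℕ) (m : Memory) : Prop :=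
  ∃ len : ℕ → ℕ, (∀ v i, m v i ≠ 0 → v < n ∧ i < len v) ∧ ∑ v ∈ Finset.range n, len v ≤ S

/-- All registers and all memory cells hold words of `K * ⌈log₂ (n + 1)⌉` bits, and the memory
occupies at most `S` cells. -/
def WithinLimits (K n S : ℕ) (s : RamState) : Prop :=
  (∀ x, IsWord K n (s.reg x)) ∧ (∀ v i, IsWord K n (s.mem v i)) ∧ UsesSpace n S s.mem

/-- The vertices at distance at most `r` from `u` or from `v`. -/
def ball {n : ℕ} (G : SimpleGraph (Fin n)) (u v : Fin n) (r : ℕ) : Set ℕ :=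
  {x | ∃ w : Fin n, (w : ℕ) = x ∧ (G.edist u w ≤ r ∨ G.edist v w ≤ r)}

/-- How a matching is read off from the memory: cell `0` of a vertex holds `0` if the vertex is
free, and `w + 1` if it is matched to `w`. -/
def mateInMemory {n : ℕ} (m : Memory) (v : Fin n) : Option ℕ :=
  if m v 0 = 0 then none else some (m v 0 - 1)

/-! ### Distributed algorithms: synchronous message passing with local wakeup -/

/-- A distributed algorithm, the same for all processors. Processors are known by their names in
`ℕ`, messages are natural numbers. A family of messages `f : ℕ → Option ℕ` contains the message
`a` from (or to) the processor `w` if `f w = some a`, and no such message if `f w = none`.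
* `start v` is the initial state of the processor `v`;
* `notify q k w` is the new state of a processor in state `q` that is told that the edge from it
  to `w` has just been inserted or deleted (according to `k`);
* `step q f` is what an awake processor in state `q` that receives the messages `f` does in a
  communication round: its new state and the messages that it sends;
* `mate q` is the output in state `q`: the partner in the matching. -/
structure Protocol where
  State : Type
  start : ℕ → State
  notify : State → Kind → ℕ → State
  step : State → (ℕ → Option ℕ) → State × (ℕ → Option ℕ)
  mate : State → Option ℕ

/-- A configuration of the network: the states of the processors, the set of the processors that
are awake, and for each processor `w` the messages `inbox w` that are about to be received. -/
structure Network (P : Protocol) (n : ℕ) where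
  state : Fin n → P.State
  awake : Set (Fin n)
  inbox : Fin n → ℕ → Option ℕ

/-- The configuration in which the processing of an update starts: exactly the two endpoints of
the updated edge are awake, they have been told about the update, and there are no messages. -/
def Network.wake {P : Protocol} {n : ℕ} (e : Update n) (q : Fin n → P.State) : Network P n where
  state := fun x =>
    if x = e.u then P.notify (q x) e.kind e.v
    else if x = e.v then P.notify (q x) e.kind e.u
    else q x
  awake := {e.u, e.v}
  inbox := fun _ _ => none

open scoped Classical in
/-- The messages delivered to `w` at the end of a round: those sent to `w` by the awake neighbors
of `w` in `G`. -/
noncomputable def Network.delivered {P : Protocol} {n : ℕ} (G : SimpleGraph (Fin n))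
    (c : Network P n) (w : Fin n) (x : ℕ) : Option ℕ :=
  if h : x < n then
    if ⟨x, h⟩ ∈ c.awake ∧ G.Adj ⟨x, h⟩ w then
      (P.step (c.state ⟨x, h⟩) (c.inbox ⟨x, h⟩)).2 w
    else none
  else none

open scoped Classical in
/-- A synchronous communication round in the network `G`: the awake processors make a step, and
the sleeping processors that receive a message wake up. -/
noncomputable def Network.round {P : Protocol} {n : ℕ} (G : SimpleGraph (Fin n))
    (c : Network P n) : Network P n where
  state := fun w => if w ∈ c.awake then (P.step (c.state w) (c.inbox w)).1 else c.state w
  awake := c.awake ∪ {w | ∃ x, c.delivered G w x ≠ none}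
  inbox := c.delivered G

/-- The number of messages in transit. -/
noncomputable def Network.messageCount {P : Protocol} {n : ℕ} (c : Network P n) : ℕ :=
  {p : Fin n × ℕ | c.inbox p.1 p.2 ≠ none}.ncard

/-- Nothing will ever happen any more (unless there is another update): no message is in
transit, and no awake processor is going to change its state or to send a message. -/
def Network.Finished {P : Protocol} {n : ℕ} (c : Network P n) : Prop :=
  (∀ w x, c.inbox w x = none) ∧
    ∀ w ∈ c.awake, P.step (c.state w) (fun _ => none) = (c.state w, fun _ => none)

/-- The states of the processors after the first `i` updates of `σ`, if `R` rounds are run after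
every update. -/
noncomputable def Protocol.statesAfter (P : Protocol) (R : ℕ) {n : ℕ} (σ : List (Update n)) :
    ℕ → Fin n → P.State
  | 0 => fun v => P.start v
  | i + 1 =>
    if h : i < σ.length then
      ((Network.round (graphAt σ (i + 1)))^[R]
        (Network.wake σ[i] (P.statesAfter R σ i))).state
    else P.statesAfter R σ i

/-- The configuration `k` rounds after the update with index `i` of `σ`, if `R` rounds are run
after every earlier update. -/
noncomputable def Protocol.config (P : Protocol) (R : ℕ) {n : ℕ} (σ : List (Update n))
    (i : ℕ) (hi : i < σ.length) (k : ℕ) : Network P n :=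
  (Network.round (graphAt σ (i + 1)))^[k] (Network.wake σ[i] (P.statesAfter R σ i))

end DynMatching

open DynMatching

/-! Both algorithms maintain an orientation of the current graph and a maximal matching, such that
between updates every vertex knows its out-neighbors and its free in-neighbors. Apart from the
updated edge itself, the orientation changes only by resets: a vertex reverses all its outgoing
arcs. A free vertex `y` that needs a partner resets itself. Afterwards all its neighbors are
in-neighbors, so its list of free in-neighbors is the list of all its free neighbors. If it picks
`w` from the list, then `w` resets itself as well, so that no list mentions `w` any more. An update
causes at most six resets, and a reset costs time and messages proportional to the number of
reversed arcs. Everything therefore rests on a bound for the total number of reversed arcs,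
`ArboricityPreserving.sum_flips_le`.

The bound comes from comparison with an offline solution: arc sets `R i` that cover the edges at
time `i`, have outdegrees at most `Δ`, and get at most `T` new arcs per update on average. The
potential is the number of maintained arcs whose reversal lies in `R`. A reset spoils at most `Δ`
arcs and repairs all the others, so it pays for itself up to `2 * Δ` (`badArcs_flipArcs_le`). An
inserted arc and a new arc of `R` each raise the potential by at most one. The sum is at most `(1 +
12 * Δ + T) * t`.

The offline solution offers a trade-off (`exists_covers`): `Δ = 4 * α * (k + 1)` and `T = g + 5`
whenever `2 ^ (g * k)` is at least the number of edges. It has two ingredients. The first is a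
reorientation lemma, `Orients.exists_reorient`. If all vertices reached from an overfull vertex had
outdegree at least `2 * α`, then sparsity would make the reached set double in every step, so a
logarithmically short path leads to a vertex that can take another arc. Reversing it removes one
unit of excess, and a careful summation of the path lengths gives `g + 1` per new edge plus a small
remainder. The second is a recursion over time scales, `Solvable.mul`. A period is divided into `2 ^
g` blocks. Edges alive at a border of a block are covered by orientations at the two borders, and
lives strictly inside a block are left to the recursion. Every level adds `4 * α` to the outdegree,
but every deletion is charged at one level only. With `g` about `α + √(α log n)` and `k` about `log
n / g`, both `Δ` and `T` are `O(α + √(α log n))`.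

The rest is implementation. The protocol performs a search in six rounds governed by timers
(`Runs.rematch`). The RAM program stores arcs in arrays with cross pointers, so that an arc is added
or removed in constant time (`Rep.push`, `Rep.pop`). -/

namespace DynMatching

/-! ### Orientations of sparse edge sets -/

section Orientation

variable {V : Type*} [DecidableEq V]

/-- The number of arcs of `Q` that leave `v`. -/
def outdeg (Q : Finset (V × V)) (v : V) : ℕ := (Q.filter fun a => a.1 = v).card

/-- `Q` contains exactly one arc for every edge in `E`, and no others. -/
def Orients (Q : Finset (V × V)) (E : Finset (Sym2 V)) : Prop :=
  Q.image (fun a => s(a.1, a.2)) = E ∧ Set.InjOn (fun a : V × V => s(a.1, a.2)) Q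

/-- Every vertex set `U` spans at most `α * |U|` edges. -/
def Sparse (α : ℕ) (E : Finset (Sym2 V)) : Prop :=
  ∀ U : Finset V, (E ∩ U.sym2).card ≤ α * U.card

/-- The set `S` with the heads of the arcs that leave it. -/
def expand (Q : Finset (V × V)) (S : Finset V) : Finset V :=
  S ∪ (Q.filter fun a => a.1 ∈ S).image Prod.snd

lemma Sparse.mono {α : ℕ} {E F : Finset (Sym2 V)} (h : Sparse α E) (hF : F ⊆ E) : Sparse α F :=
  fun U => (Finset.card_le_card (Finset.inter_subset_inter_right hF)).trans (h U)

lemma Orients.card {Q : Finset (V × V)} {E : Finset (Sym2 V)} (h : Orients Q E) :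
    Q.card = E.card := by
  rw [← h.1, Finset.card_image_of_injOn h.2]

lemma Orients.mem {Q : Finset (V × V)} {E : Finset (Sym2 V)} (h : Orients Q E) {a : V × V}
    (ha : a ∈ Q) : s(a.1, a.2) ∈ E := by
  rw [← h.1]; exact Finset.mem_image_of_mem _ ha

lemma Orients.card_inside_le {α : ℕ} {Q : Finset (V × V)} {E : Finset (Sym2 V)}
    (h : Orients Q E) (hE : Sparse α E) (U : Finset V) :
    (Q.filter fun a => a.1 ∈ U ∧ a.2 ∈ U).card ≤ α * U.card := by
  refine le_trans ?_ (hE U)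
  refine Finset.card_le_card_of_injOn (fun a => s(a.1, a.2)) ?_ ?_
  · intro a ha
    simp only [Finset.coe_filter, Set.mem_ofPred_eq] at ha
    simp [h.mem ha.1, ha.2]
  · exact h.2.mono (by intro a ha; simp at ha; exact ha.1)

lemma exists_orients (E : Finset (Sym2 V)) : ∃ Q : Finset (V × V), Orients Q E := by
  have key : ∀ e : Sym2 V, s((Quot.out e).1, (Quot.out e).2) = e := fun e => Quot.out_eq e
  refine ⟨E.image Quot.out, ?_, ?_⟩
  · ext e
    simp only [Finset.image_image, Finset.mem_image, Function.comp]
    constructor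
    · rintro ⟨e', he', rfl⟩; rwa [key]
    · exact fun he => ⟨e, he, key e⟩
  · intro a ha b hb hab
    simp only [Finset.coe_image, Set.mem_image] at ha hb
    obtain ⟨e, -, rfl⟩ := ha
    obtain ⟨f, -, rfl⟩ := hb
    simp only [key] at hab
    rw [hab]

lemma sum_outdeg (Q : Finset (V × V)) (S : Finset V) :
    ∑ v ∈ S, outdeg Q v = (Q.filter fun a => a.1 ∈ S).card := by
  rw [Finset.card_eq_sum_card_fiberwise (f := Prod.fst) (t := S)]
  · refine Finset.sum_congr rfl fun v hv => ?_
    rw [outdeg, Finset.filter_filter]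
    congr 1
    ext a
    simp only [Finset.mem_filter]
    constructor
    · rintro ⟨h, rfl⟩; exact ⟨h, hv, rfl⟩
    · rintro ⟨h, -, h'⟩; exact ⟨h, h'⟩
  · intro a ha; simp at ha; exact ha.2

lemma subset_expand (Q : Finset (V × V)) (S : Finset V) : S ⊆ expand Q S :=
  Finset.subset_union_left

lemma expand_iterate_mono (Q : Finset (V × V)) (S : Finset V) {i j : ℕ} (h : i ≤ j) :
    (expand Q)^[i] S ⊆ (expand Q)^[j] S := by
  induction h with
  | refl => exact subset_rfl
  | step _ ih => rw [Function.iterate_succ_apply']; exact ih.trans (subset_expand _ _)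

/-- Reversing the arcs of a shortest path from `S` to `v`. -/
lemma Orients.exists_reverse_path {Q : Finset (V × V)} {E : Finset (Sym2 V)} (hQ : Orients Q E)
    (S : Finset V) (j : ℕ) : ∀ v ∈ (expand Q)^[j] S, ∃ Q' : Finset (V × V), Orients Q' E ∧
      (∀ a : V × V, ¬ (a.1 ∈ (expand Q)^[j] S ∧ a.2 ∈ (expand Q)^[j] S) → (a ∈ Q' ↔ a ∈ Q)) ∧
      (Q' \ Q).card ≤ j ∧
      ∃ u ∈ S, ∀ x, outdeg Q' x + (if x = u then 1 else 0) =
        outdeg Q x + (if x = v then 1 else 0) := by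
  induction j with
  | zero => exact fun v hv => ⟨Q, hQ, fun a _ => Iff.rfl, by simp, v, hv, fun x => rfl⟩
  | succ j ih =>
    intro v hv
    have hsub : (expand Q)^[j] S ⊆ (expand Q)^[j + 1] S := expand_iterate_mono Q S (by omega)
    by_cases hvj : v ∈ (expand Q)^[j] S
    · obtain ⟨Q', h1, h2, h3, h4⟩ := ih v hvj
      exact ⟨Q', h1, fun a ha => h2 a fun h => ha ⟨hsub h.1, hsub h.2⟩, h3.trans (by omega), h4⟩
    -- Here `v` is new in layer `j + 1`, hence the head of an arc from some `w` in layer `j`. The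
    -- reversed path to `w` stays inside layer `j` and leaves this arc alone, so the arc can be
    -- reversed in addition; this hands the extra outgoing arc over from `w` to `v`.
    · have hv' := hv
      rw [Function.iterate_succ_apply', expand, Finset.mem_union] at hv'
      obtain ⟨a, ha, hav⟩ := Finset.mem_image.1 (hv'.resolve_left hvj)
      obtain ⟨w, v'⟩ := a
      simp only at hav
      subst hav
      simp only [Finset.mem_filter] at ha
      obtain ⟨hwv, hw⟩ := ha
      have hne : w ≠ v' := fun h => hvj (h ▸ hw)
      obtain ⟨Q', h1, h2, h3, u, hu, h4⟩ := ih w hw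
      have hwv' : (w, v') ∈ Q' := (h2 (w, v') fun h => hvj h.2).2 hwv
      have hvw' : (v', w) ∉ Q' := by
        intro h
        have := h1.2 h hwv' (Sym2.eq_swap)
        exact hne (by simpa using congrArg Prod.snd this)
      refine ⟨insert (v', w) (Q'.erase (w, v')), ⟨?_, ?_⟩, ?_, ?_, u, hu, ?_⟩
      · rw [← h1.1, ← Finset.insert_erase hwv', Finset.image_insert, Finset.image_insert,
          Finset.erase_insert (by simp)]
        simp only [Sym2.eq_swap]
      · rw [Finset.coe_insert]
        refine (Set.injOn_insert (by simp [hvw'])).2 ⟨h1.2.mono (by simp), ?_⟩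
        rintro ⟨b, hb, hb'⟩
        simp only [Finset.coe_erase, Set.mem_sdiff, Finset.mem_coe, Set.mem_singleton_iff] at hb
        have := h1.2 hb.1 hwv' (hb'.trans Sym2.eq_swap)
        exact hb.2 this
      · intro a ha
        have hw1 := hsub hw
        rw [Finset.mem_insert, Finset.mem_erase, h2 a fun h => ha ⟨hsub h.1, hsub h.2⟩]
        constructor
        · rintro (rfl | h)
          · exact absurd ⟨hv, hw1⟩ ha
          · exact h.2
        · refine fun h => Or.inr ⟨?_, h⟩
          rintro rfl
          exact ha ⟨hw1, hv⟩
      · calc _ ≤ (insert (v', w) (Q' \ Q)).card := by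
              refine Finset.card_le_card fun a ha => ?_
              simp only [Finset.mem_sdiff, Finset.mem_insert, Finset.mem_erase] at ha ⊢
              tauto
          _ ≤ _ := (Finset.card_insert_le _ _).trans (by omega)
      · intro x
        have e1 := h4 x
        have e2 : outdeg (insert (v', w) (Q'.erase (w, v'))) x + (if x = w then 1 else 0) =
            outdeg Q' x + (if x = v' then 1 else 0) := by
          unfold outdeg
          rw [Finset.filter_insert, Finset.filter_erase]
          by_cases h1 : x = v'
          · subst h1
            have : ¬ x = w := fun h => hne h.symm
            rw [if_pos rfl, Finset.card_insert_of_notMem, Finset.erase_eq_of_notMem]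
            · simp [this]
            · simp [hne]
            · simp [hvw']
          · by_cases h2 : x = w
            · subst h2
              rw [if_neg (fun h => h1 h.symm), if_pos rfl, if_neg h1]
              exact Finset.card_erase_add_one (by simp [hwv'])
            · rw [if_neg (fun h => h1 h.symm), if_neg h1, if_neg h2, Finset.erase_eq_of_notMem]
              simp [Ne.symm h2]
        omega

end Orientation

end DynMatching

namespace DynMatching

/-! ### Removing excess outdegree along short paths -/

section Excess

variable {V : Type*} [DecidableEq V] [Fintype V]

/-- The total amount by which the outdegrees exceed `c`. -/
def excess (c : ℕ) (Q : Finset (V × V)) : ℕ := ∑ v, (outdeg Q v - c)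

/-- Let `S_j` be the set reached in `j` steps from the overfull vertices and `s` the excess. If all
outdegrees in `S_j` were at least `2 * α`, then at least `2 * α * |S_j| + s` arcs would leave
vertices of `S_j`. They all run inside `S_{j+1}`, which spans at most `α * |S_{j+1}|` edges. Hence
`α * |S_j| + s` at least doubles in each step, and after `log (N / s) + 1` steps there would be more
than `N` arcs. -/
lemma Orients.exists_underfull {α N : ℕ} {Q : Finset (V × V)} {E : Finset (Sym2 V)}
    (hQ : Orients Q E) (hE : Sparse α E) (hN : E.card ≤ N) (hs : 0 < excess (2 * α) Q) :
    ∃ v ∈ (expand Q)^[Nat.log 2 (N / excess (2 * α) Q) + 1]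
      (Finset.univ.filter fun v => 2 * α < outdeg Q v), outdeg Q v < 2 * α := by
  set s := excess (2 * α) Q with hsdef
  set L := Nat.log 2 (N / s) + 1 with hL
  set S := Finset.univ.filter fun v => 2 * α < outdeg Q v with hS
  by_contra! hcon
  have hfull : ∀ j ≤ L, 2 * (α * ((expand Q)^[j] S).card) + s ≤
      (Q.filter fun a => a.1 ∈ (expand Q)^[j] S).card := by
    intro j hj
    have h1 : ∀ v ∈ (expand Q)^[j] S, 2 * α ≤ outdeg Q v :=
      fun v hv => hcon v (expand_iterate_mono Q S hj hv)
    -- Every layer contains all overfull vertices and thus carries the whole excess.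
    have h2 : s = ∑ v ∈ (expand Q)^[j] S, (outdeg Q v - 2 * α) := by
      rw [hsdef, excess]
      refine (Finset.sum_subset (Finset.subset_univ _) fun v _ hv => ?_).symm
      have : v ∉ S := fun h => hv (expand_iterate_mono Q S (Nat.zero_le j) h)
      simp only [hS, Finset.mem_filter, Finset.mem_univ, true_and, not_lt] at this
      omega
    rw [← sum_outdeg, h2, mul_comm α, ← mul_assoc, mul_comm 2, mul_assoc, ← smul_eq_mul,
      ← Finset.sum_const, ← Finset.sum_add_distrib]
    exact Finset.sum_le_sum fun v hv => by have := h1 v hv; omega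
  have hgrow : ∀ j ≤ L, 2 ^ j * s ≤ α * ((expand Q)^[j] S).card + s := by
    intro j
    induction j with
    | zero => intro _; simp
    | succ j ih =>
      intro hj
      have h1 := ih (by omega)
      have h2 := hfull j (by omega)
      have h3 : (Q.filter fun a => a.1 ∈ (expand Q)^[j] S).card ≤
          α * ((expand Q)^[j + 1] S).card := by
        refine le_trans (Finset.card_le_card ?_) (hQ.card_inside_le hE _)
        intro a ha
        simp only [Finset.mem_filter] at ha ⊢
        rw [Function.iterate_succ_apply', expand]
        exact ⟨ha.1, Finset.mem_union_left _ ha.2, Finset.mem_union_right _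
          (Finset.mem_image_of_mem _ (by simpa using ha))⟩
      rw [pow_succ]
      nlinarith
  have h1 := hgrow L le_rfl
  have h2 := hfull L le_rfl
  have h3 : (Q.filter fun a => a.1 ∈ (expand Q)^[L] S).card ≤ N :=
    (Finset.card_filter_le _ _).trans (hQ.card ▸ hN)
  have h4 : N < 2 ^ L * s := by
    have := Nat.lt_pow_succ_log_self (b := 2) (by norm_num) (N / s)
    rwa [Nat.succ_eq_add_one, ← hL, Nat.div_lt_iff_lt_mul hs] at this
  have h5 : 0 < α * ((expand Q)^[L] S).card ∨ α * ((expand Q)^[L] S).card = 0 := by omega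
  omega

/-- Reversing a path from an overfull to an underfull vertex lowers the outdegree at the first and
raises it at the second, which still does not exceed `2 * α`; inner vertices keep theirs. -/
lemma Orients.exists_excess_lt {α N : ℕ} {Q : Finset (V × V)} {E : Finset (Sym2 V)}
    (hQ : Orients Q E) (hE : Sparse α E) (hN : E.card ≤ N) (hs : 0 < excess (2 * α) Q) :
    ∃ Q' : Finset (V × V), Orients Q' E ∧ excess (2 * α) Q' + 1 = excess (2 * α) Q ∧
      (Q' \ Q).card ≤ Nat.log 2 (N / excess (2 * α) Q) + 1 := by
  obtain ⟨v, hv, hvlt⟩ := hQ.exists_underfull hE hN hs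
  obtain ⟨Q', h1, -, h3, u, hu, h4⟩ := hQ.exists_reverse_path _ _ v hv
  refine ⟨Q', h1, ?_, h3⟩
  simp only [Finset.mem_filter, Finset.mem_univ, true_and] at hu
  have h5 : ∑ x : V, (if x = u then 1 else 0) = 1 := by simp
  rw [excess, excess]
  nth_rewrite 1 [← h5]
  rw [← Finset.sum_add_distrib]
  refine Finset.sum_congr rfl fun x _ => ?_
  have := h4 x
  by_cases hxu : x = u
  · subst hxu
    have : x ≠ v := by rintro rfl; omega
    simp_all
    omega
  · by_cases hxv : x = v
    · subst hxv; simp_all; omega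
    · simp_all

/-- The paths get longer as the excess `r` shrinks, so the bound keeps the individual lengths for
all values `r` that the excess runs through. -/
lemma Orients.exists_excess_zero {α N : ℕ} {E : Finset (Sym2 V)} (hE : Sparse α E)
    (hN : E.card ≤ N) (s : ℕ) : ∀ {Q : Finset (V × V)}, Orients Q E → excess (2 * α) Q = s →
    ∃ Q' : Finset (V × V), Orients Q' E ∧ excess (2 * α) Q' = 0 ∧
      (Q' \ Q).card ≤ ∑ r ∈ Finset.Icc 1 s, (Nat.log 2 (N / r) + 1) := by
  induction s with
  | zero => exact fun {Q} hQ h => ⟨Q, hQ, h, by simp⟩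
  | succ s ih =>
    intro Q hQ h
    obtain ⟨Q₁, h1, h2, h3⟩ := hQ.exists_excess_lt hE hN (by omega)
    obtain ⟨Q₂, h4, h5, h6⟩ := ih h1 (by omega)
    refine ⟨Q₂, h4, h5, ?_⟩
    rw [Finset.sum_Icc_succ_top (by omega)]
    calc (Q₂ \ Q).card ≤ ((Q₂ \ Q₁) ∪ (Q₁ \ Q)).card := by
          refine Finset.card_le_card fun a ha => ?_
          simp only [Finset.mem_sdiff, Finset.mem_union] at ha ⊢
          tauto
      _ ≤ _ := (Finset.card_union_le _ _).trans (by rw [h] at h3; omega)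

end Excess

/-- Most terms are at most `g`. What exceeds `g` is counted in layers: the layer `q` consists of the
`r` with `r * 2 ^ (g + 1 + q) ≤ N`, of which there are at most `N / 2 ^ (g + 1 + q)`, and these
bounds form a geometric series. -/
lemma sum_log_div_le (N g s : ℕ) :
    ∑ r ∈ Finset.Icc 1 s, Nat.log 2 (N / r) ≤ g * s + N / 2 ^ g := by
  have h1 : ∀ r ∈ Finset.Icc 1 s, Nat.log 2 (N / r) ≤
      g + ∑ q ∈ Finset.range N, if r * 2 ^ (g + 1 + q) ≤ N then 1 else 0 := by
    intro r hr
    rw [Finset.mem_Icc] at hr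
    by_contra! hlt
    set l := Nat.log 2 (N / r) with hl
    have hpos : N / r ≠ 0 := by
      intro h; rw [h] at hl; simp at hl; omega
    have h2 : 2 ^ l * r ≤ N := by
      rw [← Nat.le_div_iff_mul_le (by omega)]
      exact Nat.pow_log_le_self 2 hpos
    have hlN : l ≤ N := by
      have : l < 2 ^ l := Nat.lt_two_pow_self
      nlinarith
    have h3 : l - g ≤ ∑ q ∈ Finset.range N, if r * 2 ^ (g + 1 + q) ≤ N then 1 else 0 := by
      calc l - g = ∑ q ∈ Finset.range (l - g), 1 := by simp
        _ = ∑ q ∈ Finset.range (l - g), if r * 2 ^ (g + 1 + q) ≤ N then 1 else 0 := by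
            refine Finset.sum_congr rfl fun q hq => ?_
            rw [Finset.mem_range] at hq
            rw [if_pos]
            refine le_trans ?_ h2
            rw [mul_comm]
            exact Nat.mul_le_mul_right _ (Nat.pow_le_pow_right (by norm_num) (by omega))
        _ ≤ _ := Finset.sum_le_sum_of_subset (by simp; omega)
    omega
  refine (Finset.sum_le_sum h1).trans ?_
  rw [Finset.sum_add_distrib, Finset.sum_comm]
  simp only [Finset.sum_const, Nat.card_Icc, smul_eq_mul]
  have h2 : ∀ q ∈ Finset.range N,
      (∑ r ∈ Finset.Icc 1 s, if r * 2 ^ (g + 1 + q) ≤ N then 1 else 0) ≤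
        N / 2 ^ (g + 1) / 2 ^ q := by
    intro q _
    rw [← Finset.sum_filter, Finset.sum_const, smul_eq_mul, mul_one, Nat.div_div_eq_div_mul,
      ← pow_add]
    calc _ ≤ (Finset.Icc 1 (N / 2 ^ (g + 1 + q))).card := by
          refine Finset.card_le_card fun r hr => ?_
          simp only [Finset.mem_filter, Finset.mem_Icc] at hr ⊢
          exact ⟨hr.1.1, (Nat.le_div_iff_mul_le (by positivity)).2 hr.2⟩
      _ = _ := by simp
  have h3 := Finset.sum_le_sum h2
  have h4 := Nat.geom_sum_le (b := 2) le_rfl (N / 2 ^ (g + 1)) N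
  have h5 : N / 2 ^ (g + 1) * 2 ≤ N / 2 ^ g := by
    rw [pow_succ, ← Nat.div_div_eq_div_mul]; omega
  simp only [Nat.add_one_sub_one] at h4 ⊢
  rw [mul_comm s g]
  omega

section Reorient

variable {V : Type*} [DecidableEq V] [Fintype V]

/-- An orientation of `E'` is turned into an orientation of `E`. -/
lemma Orients.exists_reorient {α N : ℕ} (g : ℕ) {Q : Finset (V × V)} {E E' : Finset (Sym2 V)}
    (hQ : Orients Q E') (hout : ∀ v, outdeg Q v ≤ 2 * α) (hE : Sparse α E) (hN : E.card ≤ N) :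
    ∃ Q' : Finset (V × V), Orients Q' E ∧ (∀ v, outdeg Q' v ≤ 2 * α) ∧
      (Q \ Q').card ≤ (E' \ E).card + (g + 1) * (E \ E').card + N / 2 ^ g := by
  obtain ⟨A, hA⟩ := exists_orients (E \ E')
  set K := Q.filter fun a => s(a.1, a.2) ∈ E with hK
  -- Surviving edges keep their arcs and new edges are oriented arbitrarily. Only the latter can
  -- create excess, so the excess is at most the number of new edges.
  set Q₀ := K ∪ A with hQ₀
  have hKE : ∀ a ∈ K, s(a.1, a.2) ∈ E ∧ s(a.1, a.2) ∈ E' := by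
    intro a ha
    rw [hK, Finset.mem_filter] at ha
    exact ⟨ha.2, hQ.mem ha.1⟩
  have hAE : ∀ a ∈ A, s(a.1, a.2) ∈ E ∧ s(a.1, a.2) ∉ E' :=
    fun a ha => Finset.mem_sdiff.1 (hA.mem ha)
  have h₀ : Orients Q₀ E := by
    constructor
    · rw [hQ₀, Finset.image_union, hA.1]
      ext e
      simp only [Finset.mem_union, Finset.mem_sdiff, Finset.mem_image]
      constructor
      · rintro (⟨a, ha, rfl⟩ | h)
        · exact (hKE a ha).1
        · exact h.1
      · intro he
        by_cases he' : e ∈ E'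
        · rw [← hQ.1, Finset.mem_image] at he'
          obtain ⟨a, ha, rfl⟩ := he'
          exact Or.inl ⟨a, by simp [hK, ha, he], rfl⟩
        · exact Or.inr ⟨he, he'⟩
    · rw [hQ₀, Finset.coe_union]
      rintro a (ha | ha) b (hb | hb) hab
      · exact hQ.2 (Finset.mem_filter.1 ha).1 (Finset.mem_filter.1 hb).1 hab
      · simp only at hab
        exact absurd (hab ▸ (hKE a ha).2) (hAE b hb).2
      · simp only at hab
        exact absurd (hab ▸ (hKE b hb).2) (hAE a ha).2
      · exact hA.2 ha hb hab
  have hex : excess (2 * α) Q₀ ≤ (E \ E').card := by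
    rw [← hA.card]
    calc excess (2 * α) Q₀ ≤ ∑ v, outdeg A v := by
          refine Finset.sum_le_sum fun v _ => ?_
          have h1 : outdeg Q₀ v ≤ outdeg Q v + outdeg A v := by
            rw [outdeg, outdeg, outdeg]
            refine le_trans (Finset.card_le_card ?_) (Finset.card_union_le _ _)
            intro a ha
            simp only [hQ₀, hK, Finset.mem_union, Finset.mem_filter] at ha ⊢
            tauto
          have := hout v
          omega
      _ = A.card := by rw [sum_outdeg]; simp
  obtain ⟨Q', h1, h2, h3⟩ := Orients.exists_excess_zero hE hN _ h₀ rfl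
  refine ⟨Q', h1, fun v => ?_, ?_⟩
  · have := (Finset.sum_eq_zero_iff.1 h2) v (Finset.mem_univ v)
    omega
  -- Both sets orient `E` and have the same size. So the bound on gained arcs is also one on lost
  -- arcs, which is the form needed when time runs backwards.
  have h4 : (Q₀ \ Q').card = (Q' \ Q₀).card :=
    Finset.card_sdiff_comm (by rw [h₀.card, h1.card])
  have h5 : (Q \ Q').card ≤ (E' \ E).card + (Q₀ \ Q').card := by
    have h6 : (Q.filter fun a => s(a.1, a.2) ∉ E).card ≤ (E' \ E).card := by
      refine Finset.card_le_card_of_injOn (fun a => s(a.1, a.2)) ?_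
        (hQ.2.mono (by intro a ha; simp at ha; exact ha.1))
      intro a ha
      simp only [Finset.coe_filter, Set.mem_ofPred_eq] at ha
      simp [hQ.mem ha.1, ha.2]
    refine le_trans (Finset.card_le_card ?_) ((Finset.card_union_le _ _).trans
      (Nat.add_le_add_right h6 _))
    intro a ha
    simp only [hQ₀, hK, Finset.mem_union, Finset.mem_filter, Finset.mem_sdiff] at ha ⊢
    tauto
  have h6 : ∑ r ∈ Finset.Icc 1 (excess (2 * α) Q₀), (Nat.log 2 (N / r) + 1) ≤
      (g + 1) * (E \ E').card + N / 2 ^ g := by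
    rw [Finset.sum_add_distrib]
    have := sum_log_div_le N g (excess (2 * α) Q₀)
    have h7 := Nat.mul_le_mul_left (g + 1) hex
    simp only [Finset.sum_const, Nat.card_Icc, smul_eq_mul, mul_one, add_mul, one_mul] at h7 ⊢
    omega
  omega

/-- The empty orientation of the empty edge set is adapted to `E`. -/
lemma exists_orients_le {α : ℕ} {E : Finset (Sym2 V)} (hE : Sparse α E) :
    ∃ Q : Finset (V × V), Orients Q E ∧ ∀ v, outdeg Q v ≤ 2 * α := by
  have h0 : Orients (∅ : Finset (V × V)) (∅ : Finset (Sym2 V)) := ⟨rfl, by simp⟩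
  obtain ⟨Q, h1, h2, -⟩ := h0.exists_reorient 0 (fun v => by simp [outdeg]) hE le_rfl
  exact ⟨Q, h1, h2⟩

end Reorient

end DynMatching

namespace DynMatching

/-! ### Covering a changing sparse edge set by slowly changing arc sets -/

section Sequences

variable {V : Type*} [DecidableEq V]

/-- Every edge of `E` is represented by an arc of `R`. -/
def Covers (R : Finset (V × V)) (E : Finset (Sym2 V)) : Prop :=
  ∀ e ∈ E, ∃ a ∈ R, s(a.1, a.2) = e

/-- The predecessor of `R i` in the sequence `∅, R 0, R 1, …`. -/
def prevArcs (R : ℕ → Finset (V × V)) : ℕ → Finset (V × V)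
  | 0 => ∅
  | i + 1 => R i

/-- The number of arcs that appear in the course of the sequence `∅, R 0, …, R (m - 1)`. -/
def newArcs (R : ℕ → Finset (V × V)) (m : ℕ) : ℕ :=
  ∑ i ∈ Finset.range m, (R i \ prevArcs R i).card

/-- The number of elements that disappear in the course of the sequence `X 0, …, X m`. -/
def deaths {W : Type*} [DecidableEq W] (X : ℕ → Finset W) (m : ℕ) : ℕ :=
  ∑ i ∈ Finset.range m, (X i \ X (i + 1)).card

lemma card_sdiff_le_deaths {W : Type*} [DecidableEq W] (X : ℕ → Finset W) (m : ℕ) :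
    (X 0 \ X m).card ≤ deaths X m := by
  induction m with
  | zero => simp
  | succ m ih =>
    rw [deaths, Finset.sum_range_succ]
    refine le_trans (Finset.card_le_card (t := (X 0 \ X m) ∪ (X m \ X (m + 1))) ?_)
      ((Finset.card_union_le _ _).trans (Nat.add_le_add_right ih _))
    intro a ha
    simp only [Finset.mem_sdiff, Finset.mem_union] at ha ⊢
    tauto

/-- This balance of the cardinalities makes births and deaths equal in number for sequences that
start and end with `∅`. -/
lemma sum_births {W : Type*} [DecidableEq W] (X : ℕ → Finset W) (m : ℕ) :
    ∑ i ∈ Finset.range m, (X (i + 1) \ X i).card + (X 0).card = deaths X m + (X m).card := by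
  induction m with
  | zero => simp [deaths]
  | succ m ih =>
    rw [deaths, Finset.sum_range_succ, Finset.sum_range_succ]
    rw [deaths] at ih
    have h1 := Finset.card_sdiff_add_card_inter (X (m + 1)) (X m)
    have h2 := Finset.card_sdiff_add_card_inter (X m) (X (m + 1))
    rw [Finset.inter_comm] at h1
    omega

/-- The edges of `E (a + i)` that are not present during the whole of `[a, a + i]` and not
present during the whole of `[a + i, a + l]`. -/
def internal (E : ℕ → Finset (Sym2 V)) (a l i : ℕ) : Finset (Sym2 V) :=
  (E (a + i)).filter fun e => (∃ m ≤ i, e ∉ E (a + m)) ∧ ∃ m ≤ l, i ≤ m ∧ e ∉ E (a + m)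

lemma internal_zero (E : ℕ → Finset (Sym2 V)) (a l : ℕ) : internal E a l 0 = ∅ := by
  refine Finset.filter_eq_empty_iff.2 ?_
  rintro e he ⟨⟨m, hm, h⟩, -⟩
  obtain rfl : m = 0 := by omega
  exact h he

lemma internal_last (E : ℕ → Finset (Sym2 V)) (a l : ℕ) : internal E a l l = ∅ := by
  refine Finset.filter_eq_empty_iff.2 ?_
  rintro e he ⟨-, m, hm, hm', h⟩
  obtain rfl : m = l := by omega
  exact h he

lemma mem_internal_or (E : ℕ → Finset (Sym2 V)) (a l i : ℕ) (hi : i ≤ l) {e : Sym2 V}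
    (he : e ∈ E (a + i)) : e ∈ E a ∨ e ∈ E (a + l) ∨ e ∈ internal E a l i := by
  by_contra! h
  exact h.2.2 (Finset.mem_filter.2 ⟨he, ⟨0, by omega, h.1⟩, l, le_rfl, hi, h.2.1⟩)

/-- The two terms on the left count different deletions. An edge of `E a` that is missing at the end
of the block must at some time lose the life that it had at the start, and such lives are tracked by
`P`. A death in `internal` ends a life that began inside the block. -/
lemma deaths_internal_le (E : ℕ → Finset (Sym2 V)) (a l : ℕ) :
    (E a \ E (a + l)).card + deaths (internal E a l) l ≤
      ∑ i ∈ Finset.range l, (E (a + i) \ E (a + (i + 1))).card := by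
  set P : ℕ → Finset (Sym2 V) := fun i => (E a).filter fun e => ∀ m ≤ i, e ∈ E (a + m) with hP
  have h0 : (E a \ E (a + l)).card ≤ deaths P l := by
    refine le_trans (Finset.card_le_card ?_) (card_sdiff_le_deaths P l)
    intro e he
    simp only [hP, Finset.mem_sdiff, Finset.mem_filter] at he ⊢
    refine ⟨⟨he.1, fun m hm => ?_⟩, fun h => he.2 (h.2 l le_rfl)⟩
    obtain rfl : m = 0 := by omega
    exact he.1
  refine (Nat.add_le_add_right h0 _).trans ?_
  rw [deaths, deaths, ← Finset.sum_add_distrib]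
  refine Finset.sum_le_sum fun i hi => ?_
  rw [Finset.mem_range] at hi
  rw [← Finset.card_union_of_disjoint]
  · refine Finset.card_le_card fun e he => ?_
    rw [Finset.mem_union, Finset.mem_sdiff, Finset.mem_sdiff] at he
    rw [Finset.mem_sdiff]
    rcases he with ⟨h1, h2⟩ | ⟨h1, h2⟩
    · simp only [hP, Finset.mem_filter] at h1 h2
      refine ⟨h1.2 i le_rfl, fun h => h2 ⟨h1.1, fun m hm => ?_⟩⟩
      rcases Nat.lt_or_ge i m with hm' | hm'
      · obtain rfl : m = i + 1 := by omega
        exact h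
      · exact h1.2 m hm'
    · rw [internal, Finset.mem_filter] at h1 h2
      refine ⟨h1.1, fun h => h2 ⟨h, ?_, ?_⟩⟩
      · obtain ⟨m, hm, h'⟩ := h1.2.1
        exact ⟨m, by omega, h'⟩
      · obtain ⟨m, hm, hm', h'⟩ := h1.2.2
        refine ⟨m, hm, ?_, h'⟩
        rcases Nat.eq_or_lt_of_le hm' with rfl | h''
        · exact absurd h1.1 h'
        · exact h''
  · rw [Finset.disjoint_left]
    intro e he he'
    rw [Finset.mem_sdiff] at he he'
    simp only [hP, Finset.mem_filter] at he
    rw [internal, Finset.mem_filter] at he'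
    obtain ⟨m, hm, h'⟩ := he'.1.2.1
    exact h' (he.1.2 m hm)

/-- Every sequence of `α`-sparse edge sets of length `l` that starts and ends with `∅` is covered
by arc sets with outdegrees at most `Δ` that get at most `c` new arcs per vanishing edge. -/
def Solvable (V : Type*) [DecidableEq V] (α l Δ c : ℕ) : Prop :=
  ∀ E : ℕ → Finset (Sym2 V), (∀ i, Sparse α (E i)) → E 0 = ∅ → E l = ∅ →
    ∃ R : ℕ → Finset (V × V), (∀ i < l, Covers (R i) (E i)) ∧
      (∀ i < l, ∀ v, outdeg (R i) v ≤ Δ) ∧ newArcs R l ≤ c * deaths E l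

/-- The only moment of the period is time `0`, when there are no edges. -/
lemma solvable_one (α c : ℕ) : Solvable V α 1 0 c := by
  intro E _ h0 _
  refine ⟨fun _ => ∅, fun i hi => ?_, fun i _ v => by simp [outdeg], by simp [newArcs]⟩
  obtain rfl : i = 0 := by omega
  simp [Covers, h0]

lemma outdeg_union_le (A B : Finset (V × V)) (v : V) :
    outdeg (A ∪ B) v ≤ outdeg A v + outdeg B v := by
  rw [outdeg, outdeg, outdeg, Finset.filter_union]
  exact Finset.card_union_le _ _

/-- Orientations at the multiples of `l` together with covers of the internal edges of the
blocks of length `l`. -/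
lemma Solvable.combine {α l Δ c δ : ℕ} (hl : 0 < l) (hsol : Solvable V α l Δ c)
    {E : ℕ → Finset (Sym2 V)} (hE : ∀ i, Sparse α (E i)) (J : ℕ) {Q : ℕ → Finset (V × V)}
    (hQ : ∀ j ≤ J, Orients (Q j) (E (j * l))) (hδ : ∀ j ≤ J, ∀ v, outdeg (Q j) v ≤ δ) :
    ∃ R : ℕ → Finset (V × V), (∀ i < J * l, Covers (R i) (E i)) ∧
      (∀ i < J * l, ∀ v, outdeg (R i) v ≤ 2 * δ + Δ) ∧
      newArcs R (J * l) ≤ newArcs Q (J + 1) +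
        c * ∑ j ∈ Finset.range J, deaths (internal E (j * l) l) l := by
  have hex : ∀ j, ∃ R : ℕ → Finset (V × V),
      (∀ i < l, Covers (R i) (internal E (j * l) l i)) ∧
      (∀ i < l, ∀ v, outdeg (R i) v ≤ Δ) ∧ newArcs R l ≤ c * deaths (internal E (j * l) l) l :=
    fun j => hsol _ (fun i => (hE _).mono (Finset.filter_subset _ _)) (internal_zero _ _ _)
      (internal_last _ _ _)
  choose R' h1 h2 h3 using hex
  have hdiv : ∀ i < J * l, i / l < J := fun i hi => (Nat.div_lt_iff_lt_mul hl).2 hi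
  -- An edge present in a block exists at its first border, at its last border, or is internal at
  -- that moment (`mem_internal_or`). The three parts of the union cover these cases, which explains
  -- `2 * δ + Δ`.
  refine ⟨fun i => Q (i / l) ∪ Q (i / l + 1) ∪ R' (i / l) (i % l), ?_, ?_, ?_⟩
  · intro i hi e he
    have hj := hdiv i hi
    have hm := Nat.mod_lt i hl
    have hi' : i / l * l + i % l = i := Nat.div_add_mod' i l
    rcases mem_internal_or E (i / l * l) l (i % l) hm.le (hi'.symm ▸ he) with h | h | h
    · rw [← (hQ _ hj.le).1, Finset.mem_image] at h
      obtain ⟨a, ha, rfl⟩ := h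
      exact ⟨a, by simp [ha], rfl⟩
    · rw [← Nat.succ_mul, ← (hQ _ hj).1, Finset.mem_image] at h
      obtain ⟨a, ha, rfl⟩ := h
      exact ⟨a, by simp [ha], rfl⟩
    · obtain ⟨a, ha, rfl⟩ := h1 _ _ hm e h
      exact ⟨a, by simp [ha], rfl⟩
  · intro i hi v
    have hj := hdiv i hi
    have e1 := outdeg_union_le (Q (i / l) ∪ Q (i / l + 1)) (R' (i / l) (i % l)) v
    have e2 := outdeg_union_le (Q (i / l)) (Q (i / l + 1)) v
    have e3 := hδ _ hj.le v
    have e4 := hδ _ (Nat.succ_le_of_lt hj) v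
    have e5 := h2 (i / l) _ (Nat.mod_lt i hl) v
    simp only [Nat.succ_eq_add_one] at e4
    change outdeg (Q (i / l) ∪ Q (i / l + 1) ∪ R' (i / l) (i % l)) v ≤ _
    omega
  · clear hQ hδ hdiv
    set R : ℕ → Finset (V × V) :=
      fun i => Q (i / l) ∪ Q (i / l + 1) ∪ R' (i / l) (i % l) with hR
    have hblock : ∀ j i, i < l → R (j * l + i) = Q j ∪ Q (j + 1) ∪ R' j i := by
      intro j i hi
      have e1 : (j * l + i) / l = j := by
        rw [add_comm, Nat.add_mul_div_right _ _ hl, Nat.div_eq_of_lt hi, zero_add]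
      have e2 : (j * l + i) % l = i := by
        rw [add_comm, Nat.add_mul_mod_self_right, Nat.mod_eq_of_lt hi]
      simp only [hR, e1, e2]
    induction J with
    | zero => simp [newArcs]
    | succ J ih =>
      have hstep : ∑ i ∈ Finset.range l, (R (J * l + i) \ prevArcs R (J * l + i)).card ≤
          (Q (J + 1) \ Q J).card + (if J = 0 then (Q 0).card else 0) + newArcs (R' J) l := by
        -- Inside a block only the part `R' J` changes. When the block starts, `Q J` is inherited
        -- from the preceding block, so only `Q (J + 1) \ Q J` and `R' J 0` can be new; the very
        -- first block must also pay for `Q 0`.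
        have hpt : ∀ i ∈ Finset.range l, (R (J * l + i) \ prevArcs R (J * l + i)).card ≤
            (if i = 0 then (Q (J + 1) \ Q J).card + (if J = 0 then (Q 0).card else 0) else 0) +
              (R' J i \ prevArcs (R' J) i).card := by
          intro i hi
          rw [Finset.mem_range] at hi
          rcases i with _ | i
          · rw [hblock J 0 hi, if_pos rfl]
            rw [show prevArcs (R' J) 0 = ∅ from rfl, Finset.sdiff_empty, add_zero]
            rcases J with _ | J
            · simp only [if_true]
              calc _ ≤ ((Q 0) ∪ (Q (0 + 1) \ Q 0) ∪ R' 0 0).card := by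
                    refine Finset.card_le_card fun a ha => ?_
                    simp only [Finset.mem_sdiff, Finset.mem_union] at ha ⊢
                    tauto
                _ ≤ _ := (Finset.card_union_le _ _).trans (Nat.add_le_add_right
                    ((Finset.card_union_le _ _).trans (by omega)) _)
            · have e : prevArcs R ((J + 1) * l) = Q J ∪ Q (J + 1) ∪ R' J (l - 1) := by
                rw [← hblock J (l - 1) (by omega), Nat.succ_mul]
                obtain ⟨l', rfl⟩ : ∃ l', l = l' + 1 := ⟨l - 1, by omega⟩
                rfl
              rw [e]
              simp only [Nat.add_eq_zero_iff, one_ne_zero, and_false, if_false, add_zero]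
              refine le_trans (Finset.card_le_card ?_) (Finset.card_union_le _ _)
              intro a ha
              simp only [Finset.mem_sdiff, Finset.mem_union] at ha ⊢
              tauto
          · rw [hblock J (i + 1) hi, if_neg (by omega), zero_add]
            have e : prevArcs R (J * l + (i + 1)) = Q J ∪ Q (J + 1) ∪ R' J i := by
              rw [← hblock J i (by omega)]; rfl
            rw [e]
            refine Finset.card_le_card fun a ha => ?_
            simp only [Finset.mem_sdiff, Finset.mem_union, prevArcs] at ha ⊢
            tauto
        refine (Finset.sum_le_sum hpt).trans ?_
        rw [Finset.sum_add_distrib, ← newArcs, Finset.sum_ite_eq' (Finset.range l) 0]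
        simp [hl]
      have e1 : newArcs R ((J + 1) * l) = newArcs R (J * l) +
          ∑ i ∈ Finset.range l, (R (J * l + i) \ prevArcs R (J * l + i)).card := by
        rw [newArcs, Nat.succ_mul, Finset.sum_range_add, newArcs]
      have e2 : newArcs Q (J + 1 + 1) = newArcs Q (J + 1) + (Q (J + 1) \ Q J).card := by
        rw [newArcs, Finset.sum_range_succ, ← newArcs]; rfl
      have e3 := h3 J
      rw [e1, e2, Finset.sum_range_succ, mul_add]
      rcases J with _ | J
      · have : newArcs Q (0 + 1) = (Q 0).card := by simp [newArcs, prevArcs]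
        simp only [if_true] at hstep
        have e4 : newArcs R (0 * l) = 0 := by simp [newArcs]
        omega
      · simp only [Nat.add_eq_zero_iff, one_ne_zero, and_false, if_false, add_zero] at hstep
        omega

/-- The deaths seen at the borders and the internal deaths share the deaths of `E`. This is why the
cost per deletion does not grow with the depth of the recursion. -/
lemma sum_deaths_internal_le (E : ℕ → Finset (Sym2 V)) (l J : ℕ) :
    ∑ j ∈ Finset.range J, (E (j * l) \ E ((j + 1) * l)).card +
      ∑ j ∈ Finset.range J, deaths (internal E (j * l) l) l ≤ deaths E (J * l) := by
  induction J with
  | zero => simp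
  | succ J ih =>
    have h1 := deaths_internal_le E (J * l) l
    have h2 : deaths E ((J + 1) * l) = deaths E (J * l) +
        ∑ i ∈ Finset.range l, (E (J * l + i) \ E (J * l + (i + 1))).card := by
      rw [deaths, Nat.succ_mul, Finset.sum_range_add, deaths]; rfl
    rw [Finset.sum_range_succ, Finset.sum_range_succ, h2, Nat.succ_mul]
    omega

end Sequences

lemma exists_chain {A : Type*} {P : ℕ → A → Prop} {r : ℕ → A → A → Prop} (h0 : ∃ x, P 0 x)
    (hs : ∀ k x, P k x → ∃ y, P (k + 1) y ∧ r k x y) :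
    ∃ q : ℕ → A, ∀ k, P k (q k) ∧ r k (q k) (q (k + 1)) := by
  choose! f hf using hs
  obtain ⟨x, hx⟩ := h0
  have h : ∀ k, P k (Nat.rec x (fun k y => f k y) k : A) := by
    intro k
    induction k with
    | zero => exact hx
    | succ k ih => exact (hf k _ ih).1
  exact ⟨fun k => Nat.rec x (fun k y => f k y) k, fun k => ⟨h k, (hf k _ (h k)).2⟩⟩

section Recursion

variable {V : Type*} [DecidableEq V] [Fintype V]

/-- One level of the recursion. The orientations at the borders of the `2 ^ g` blocks cost `g + 3`
per edge death visible at the borders; the internal deaths are paid by `hsol`. The two orientations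
with outdegrees at most `2 * α` that are active in a block add `4 * α`. -/
lemma Solvable.mul {α l Δ c g : ℕ} (hl : 0 < l) (hg : g + 3 ≤ c) (hsol : Solvable V α l Δ c) :
    Solvable V α (2 ^ g * l) (4 * α + Δ) c := by
  intro E hE h0 hlast
  set B := 2 ^ g with hB
  set L : ℕ → Finset (Sym2 V) := fun j => E (j * l) with hL
  set N := deaths L B with hN
  -- At the last border there are no edges, so every edge of `L j` dies later.
  have hLN : ∀ j ≤ B, (L j).card ≤ N := by
    intro j hj
    have h1 := card_sdiff_le_deaths (fun i => L (j + i)) (B - j)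
    rw [show j + (B - j) = B by omega, show L B = ∅ from hlast, Finset.sdiff_empty] at h1
    have h2 : N = deaths L j + deaths (fun i => L (j + i)) (B - j) := by
      rw [hN, show B = j + (B - j) by omega, deaths, Finset.sum_range_add, add_tsub_cancel_left]
      rfl
    simp only [add_zero] at h1
    omega
  -- The orientations are chosen backwards in time, with `q k` at border `B - k`. The arcs lost in a
  -- backward step, which `exists_reorient` bounds, are the arcs that appear in forward direction.
  obtain ⟨q, hq⟩ := exists_chain
    (P := fun k (Q : Finset (V × V)) => Orients Q (L (B - k)) ∧ ∀ v, outdeg Q v ≤ 2 * α)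
    (r := fun k (Q Q' : Finset (V × V)) => (Q \ Q').card ≤
      (L (B - k) \ L (B - (k + 1))).card + (g + 1) * (L (B - (k + 1)) \ L (B - k)).card +
        N / 2 ^ g)
    (exists_orients_le (hE _)) (by
      rintro k Q ⟨h1, h2⟩
      obtain ⟨Q', h3, h4, h5⟩ := h1.exists_reorient g h2 (hE _) (hLN _ (Nat.sub_le B (k + 1)))
      exact ⟨Q', ⟨h3, h4⟩, h5⟩)
  have hB0 : 0 < B := by positivity
  obtain ⟨R, hR1, hR2, hR3⟩ := hsol.combine hl hE B (Q := fun j => q (B - j)) (δ := 2 * α)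
    (fun j hj => by
      have := (hq (B - j)).1.1
      rwa [show B - (B - j) = j by omega] at this)
    (fun j _ => (hq (B - j)).1.2)
  refine ⟨R, hR1, fun i hi v => (hR2 i hi v).trans (by omega), hR3.trans ?_⟩
  have hnew : newArcs (fun j => q (B - j)) (B + 1) ≤
      ∑ j ∈ Finset.range B, ((L (j + 1) \ L j).card + (g + 1) * (L j \ L (j + 1)).card +
        N / 2 ^ g) := by
    rw [newArcs, Finset.sum_range_succ']
    have hz : (q (B - 0) \ prevArcs (fun j => q (B - j)) 0).card = 0 := by
      have := (hq B).1.1.card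
      rw [Nat.sub_self, show L 0 = ∅ by simp [hL, h0]] at this
      simpa [prevArcs] using this
    rw [hz, add_zero]
    refine Finset.sum_le_sum fun j hj => ?_
    rw [Finset.mem_range] at hj
    have := (hq (B - (j + 1))).2
    rw [show B - (j + 1) + 1 = B - j by omega, show B - (B - (j + 1)) = j + 1 by omega,
      show B - (B - j) = j by omega] at this
    exact this
  -- Births and deaths both number `N` because both ends are empty, and the `B = 2 ^ g` remainders
  -- `N / 2 ^ g` sum to at most `N`. Together this is `1 + (g + 1) + 1` times `N`.
  have hsum : ∑ j ∈ Finset.range B, ((L (j + 1) \ L j).card + (g + 1) * (L j \ L (j + 1)).card +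
        N / 2 ^ g) ≤ (g + 3) * N := by
    rw [Finset.sum_add_distrib, Finset.sum_add_distrib, ← Finset.mul_sum, ← deaths, ← hN]
    have h1 := sum_births L B
    rw [show L B = ∅ from hlast, show L 0 = ∅ by simp [hL, h0], ← hN] at h1
    have h2 : B * (N / 2 ^ g) ≤ N := Nat.mul_div_le N B
    simp only [Finset.card_empty, add_zero] at h1
    simp only [Finset.sum_const, Finset.card_range, smul_eq_mul]
    linarith
  have h1 := sum_deaths_internal_le E l B
  change N + _ ≤ _ at h1
  calc _ ≤ c * N + c * ∑ j ∈ Finset.range B, deaths (internal E (j * l) l) l := by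
        have := Nat.mul_le_mul_right N hg
        omega
    _ ≤ c * deaths E (B * l) := by
        rw [← mul_add]; exact Nat.mul_le_mul_left c h1

lemma solvable_pow {α c g : ℕ} (hg : g + 3 ≤ c) (k : ℕ) :
    Solvable V α ((2 ^ g) ^ k) (4 * α * k) c := by
  induction k with
  | zero => simpa using solvable_one (V := V) α c
  | succ k ih =>
    have := ih.mul (g := g) (by positivity) hg
    rwa [← pow_succ', show 4 * α + 4 * α * k = 4 * α * (k + 1) by ring] at this

/-- Orientations of a slowly changing sequence of sparse edge sets that change slowly. -/
lemma exists_covers {α g k t : ℕ} {E : ℕ → Finset (Sym2 V)} (hE : ∀ i, Sparse α (E i))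
    (h0 : E 0 = ∅) (hconst : ∀ i, t ≤ i → E i = E t) (hcard : ∀ i, (E i).card ≤ i)
    (hsmall : ∀ i, (E i).card ≤ (2 ^ g) ^ k) (hstep : ∀ i, (E i \ E (i + 1)).card ≤ 1) :
    ∃ R : ℕ → Finset (V × V), (∀ i ≤ t, Covers (R i) (E i)) ∧
      (∀ i ≤ t, ∀ v, outdeg (R i) v ≤ 4 * α * (k + 1)) ∧ newArcs R (t + 1) ≤ (g + 5) * t := by
  set l := (2 ^ g) ^ k with hl
  have hl0 : 0 < l := by positivity
  -- On the top level the orientations at the borders are unrelated. A complete exchange costs at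
  -- most `l` arcs per `l` updates, since there are never more than `l` edges; the last border,
  -- after time `t`, costs at most `t`. These are the two summands of `e2`.
  choose Q hQ1 hQ2 using fun j => exists_orients_le (hE (j * l))
  set J := t / l + 1 with hJ
  have htJ : t + 1 ≤ J * l := by
    have := Nat.lt_div_mul_add hl0 (a := t)
    rw [hJ, Nat.succ_mul]; omega
  obtain ⟨R, h1, h2, h3⟩ := (solvable_pow (V := V) (α := α) (le_refl (g + 3)) k).combine hl0 hE J
    (fun j _ => hQ1 j) (fun j _ => hQ2 j)
  refine ⟨R, fun i hi => h1 i (by omega), fun i hi v => (h2 i (by omega) v).trans ?_, ?_⟩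
  · exact le_of_eq (by ring)
  · have e1 : newArcs R (t + 1) ≤ newArcs R (J * l) :=
      Finset.sum_le_sum_of_subset (by simpa using htJ)
    have e2 : newArcs Q (J + 1) ≤ t + t := by
      rw [newArcs, Finset.sum_range_succ]
      refine add_le_add ?_ ?_
      · rw [hJ, Finset.sum_range_succ']
        have hz : (Q 0 \ prevArcs Q 0).card = 0 := by
          have := (hQ1 0).card
          rw [zero_mul, h0] at this
          simpa [prevArcs] using this
        rw [hz, add_zero]
        calc _ ≤ ∑ j ∈ Finset.range (t / l), l := by
              refine Finset.sum_le_sum fun j _ => ?_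
              exact (Finset.card_le_card Finset.sdiff_subset).trans ((hQ1 _).card ▸ hsmall _)
          _ ≤ t := by simpa using Nat.div_mul_le_self t l
      · refine (Finset.card_le_card Finset.sdiff_subset).trans ?_
        rw [(hQ1 _).card, hconst _ (by omega)]
        exact hcard t
    have e3 : deaths E (J * l) ≤ t := by
      have : deaths E t ≤ t := by
        refine (Finset.sum_le_sum fun i _ => hstep i).trans ?_
        simp
      rw [show J * l = t + (J * l - t) by omega, deaths, Finset.sum_range_add]
      rw [deaths] at this
      rw [Finset.sum_eq_zero (s := Finset.range (J * l - t)), add_zero]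
      · exact this
      · intro i _
        rw [hconst (t + i) (by omega), hconst (t + i + 1) (by omega)]
        simp
    have e4 := sum_deaths_internal_le E l J
    have e5 : (g + 3) * ∑ j ∈ Finset.range J, deaths (internal E (j * l) l) l ≤ (g + 3) * t :=
      Nat.mul_le_mul_left _ (by omega)
    calc _ ≤ t + t + (g + 3) * t := by omega
      _ = _ := by ring

end Recursion

end DynMatching

namespace DynMatching

/-! ### The graphs of an update sequence -/

section Graphs

open scoped Classical in
/-- The edges of the graph after `i` updates. -/
noncomputable def edgesAt {n : ℕ} (σ : List (Update n)) (i : ℕ) : Finset (Sym2 (Fin n)) :=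
  (graphAt σ i).edgeSet.toFinset

lemma mem_edgesAt {n : ℕ} {σ : List (Update n)} {i : ℕ} {e : Sym2 (Fin n)} :
    e ∈ edgesAt σ i ↔ e ∈ (graphAt σ i).edgeSet := by
  simp [edgesAt]

lemma graphAt_zero {n : ℕ} (σ : List (Update n)) : graphAt σ 0 = ⊥ := by simp [graphAt]

lemma graphAt_succ {n : ℕ} (σ : List (Update n)) {i : ℕ} (hi : i < σ.length) :
    graphAt σ (i + 1) = (σ[i]).apply (graphAt σ i) := by
  rw [graphAt, graphAt, List.take_succ_eq_append_getElem hi, List.foldl_append]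
  rfl

lemma graphAt_of_length_le {n : ℕ} (σ : List (Update n)) {i : ℕ} (hi : σ.length ≤ i) :
    graphAt σ i = graphAt σ σ.length := by
  rw [graphAt, graphAt, List.take_of_length_le hi, List.take_length]

lemma Update.edgeSet_apply_insert {n : ℕ} (G : SimpleGraph (Fin n)) (u v : Fin n) :
    (Update.apply G ⟨.insert, u, v⟩).edgeSet ⊆ insert s(u, v) G.edgeSet := by
  intro e he
  simp only [Update.apply, SimpleGraph.edgeSet_sup, Set.mem_union] at he
  rcases he with he | he
  · exact Or.inr he
  · induction e using Sym2.ind with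
    | _ x y =>
      rw [SimpleGraph.mem_edgeSet, SimpleGraph.edge_adj] at he
      exact Or.inl (Sym2.eq_iff.2 (by tauto))

lemma card_edgesAt_sdiff_le {n : ℕ} (σ : List (Update n)) (i : ℕ) :
    (edgesAt σ i \ edgesAt σ (i + 1)).card ≤ 1 := by
  by_cases hi : i < σ.length
  · refine (Finset.card_le_card (t := {s((σ[i]).u, (σ[i]).v)}) ?_).trans (by simp)
    intro e he
    rw [Finset.mem_sdiff, mem_edgesAt, mem_edgesAt, graphAt_succ σ hi, Update.apply] at he
    split at he
    · simp only [SimpleGraph.edgeSet_sup, Set.mem_union] at he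
      exact absurd (Or.inl he.1) he.2
    · by_contra hne
      rw [Finset.mem_singleton] at hne
      refine he.2 ?_
      rw [SimpleGraph.edgeSet_deleteEdges]
      exact ⟨he.1, hne⟩
  · rw [edgesAt, edgesAt, graphAt_of_length_le σ (i := i) (by omega),
      graphAt_of_length_le σ (i := i + 1) (by omega)]
    simp

lemma card_edgesAt_sdiff_le' {n : ℕ} (σ : List (Update n)) (i : ℕ) :
    (edgesAt σ (i + 1) \ edgesAt σ i).card ≤ 1 := by
  by_cases hi : i < σ.length
  · refine (Finset.card_le_card (t := {s((σ[i]).u, (σ[i]).v)}) ?_).trans (by simp)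
    intro e he
    rw [Finset.mem_sdiff, mem_edgesAt, mem_edgesAt, graphAt_succ σ hi] at he
    rcases hk : σ[i] with ⟨_ | _, u, v⟩
    · rw [hk] at he
      have := (Update.edgeSet_apply_insert _ _ _ he.1).resolve_right he.2
      simpa using this
    · rw [hk] at he
      simp only [Update.apply, SimpleGraph.edgeSet_deleteEdges] at he
      exact absurd he.1.1 he.2
  · rw [edgesAt, edgesAt, graphAt_of_length_le σ (i := i) (by omega),
      graphAt_of_length_le σ (i := i + 1) (by omega)]
    simp

lemma card_edgesAt_le {n : ℕ} (σ : List (Update n)) (i : ℕ) : (edgesAt σ i).card ≤ i := by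
  induction i with
  | zero => simp [edgesAt, graphAt_zero]
  | succ i ih =>
    have h1 := Finset.card_sdiff_add_card_inter (edgesAt σ (i + 1)) (edgesAt σ i)
    have h2 := card_edgesAt_sdiff_le' σ i
    have h3 := Finset.card_le_card
      (Finset.inter_subset_right (s₁ := edgesAt σ (i + 1)) (s₂ := edgesAt σ i))
    omega

/-- For at least two vertices the definition gives even `α * (|U| - 1)`; smaller sets span no edges,
because there are no loops. -/
lemma sparse_of_arboricity_le {n α i : ℕ} {σ : List (Update n)}
    (h : arboricity (graphAt σ i) ≤ α) : Sparse α (edgesAt σ i) := by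
  intro U
  have hcard : (edgesAt σ i ∩ U.sym2).card =
      {e ∈ (graphAt σ i).edgeSet | ∀ x ∈ e, x ∈ U}.ncard := by
    rw [← Set.ncard_coe_finset]
    congr 1
    ext e
    rw [Finset.coe_inter, Set.mem_inter_iff, Finset.mem_coe, Finset.mem_coe, mem_edgesAt,
      Finset.mem_sym2_iff]
    rfl
  rcases Nat.lt_or_ge U.card 2 with hU | hU
  · refine le_trans (le_of_eq ?_) (Nat.zero_le _)
    rw [Finset.card_eq_zero, Finset.eq_empty_iff_forall_notMem]
    intro e he
    rw [Finset.mem_inter, mem_edgesAt, Finset.mem_sym2_iff] at he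
    induction e using Sym2.ind with
    | _ x y =>
      have hxy : x ≠ y := (SimpleGraph.mem_edgeSet _).1 he.1 |>.ne
      have : 1 < U.card := Finset.one_lt_card.2 ⟨x, he.2 x (by simp), y, he.2 y (by simp), hxy⟩
      omega
  · have h1 : ⌈(({e ∈ (graphAt σ i).edgeSet | ∀ x ∈ e, x ∈ U}.ncard : ℚ) /
        ((U.card : ℚ) - 1))⌉₊ ≤ α :=
      le_trans (Finset.le_sup (f := fun U : Finset (Fin n) =>
        ⌈(({e ∈ (graphAt σ i).edgeSet | ∀ x ∈ e, x ∈ U}.ncard : ℚ) / ((U.card : ℚ) - 1))⌉₊)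
        (by simpa using hU)) h
    rw [Nat.ceil_le, ← hcard] at h1
    have h2 : (2 : ℚ) ≤ U.card := by exact_mod_cast hU
    rw [div_le_iff₀ (by linarith)] at h1
    have h3 : ((edgesAt σ i ∩ U.sym2).card : ℚ) ≤ α * U.card := by
      have : (0 : ℚ) ≤ α := Nat.cast_nonneg α
      nlinarith
    exact_mod_cast h3

lemma ArboricityPreserving.sparse {n α : ℕ} {σ : List (Update n)}
    (h : ArboricityPreserving α σ) (i : ℕ) : Sparse α (edgesAt σ i) := by
  have key : ∀ i ≤ σ.length, Sparse α (edgesAt σ i) := by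
    intro i hi
    rcases i with _ | i
    · intro U; simp [edgesAt, graphAt_zero]
    · exact sparse_of_arboricity_le (h i hi).2
  rcases Nat.lt_or_ge i σ.length with hi | hi
  · exact key i hi.le
  · have := key _ le_rfl
    rwa [edgesAt, ← graphAt_of_length_le σ hi] at this

/-- The first update acts on the empty graph, so it is an insertion and creates an edge. The bound
`1 ≤ α` absorbs all additive constants later. -/
lemma ArboricityPreserving.bounds {n α : ℕ} {σ : List (Update n)}
    (h : ArboricityPreserving α σ) (hσ : 0 < σ.length) : 2 ≤ n ∧ 1 ≤ α := by
  have h1 := (h 0 hσ).1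
  have hs := h.sparse 1 Finset.univ
  have hne := graphAt_succ σ hσ
  rw [graphAt_zero] at h1 hne
  rcases hk : σ[0] with ⟨_ | _, u, v⟩
  · rw [hk] at h1 hne
    simp only [Update.Valid] at h1
    have hu := u.2
    have hv := v.2
    have huv : (u : ℕ) ≠ v := fun h => h1.1 (Fin.ext h)
    refine ⟨by omega, ?_⟩
    have hmem : s(u, v) ∈ edgesAt σ 1 := by
      rw [mem_edgesAt, hne]
      simp [Update.apply, h1.1]
    have : 0 < (edgesAt σ 1 ∩ (Finset.univ : Finset (Fin n)).sym2).card :=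
      Finset.card_pos.2 ⟨s(u, v), by simp [hmem]⟩
    by_contra h0
    obtain rfl : α = 0 := by omega
    omega
  · rw [hk] at h1
    simp [Update.Valid] at h1

end Graphs

/-! ### Flips and their amortized cost -/

section Flips

variable {V : Type*} [DecidableEq V]

/-- The arcs of `O` that `R` contains only reversed. -/
def badArcs (O R : Finset (V × V)) : ℕ := (O.filter fun a => (a.2, a.1) ∈ R).card

/-- Reverse the arcs of `O` from `w` to the vertices in `F`. -/
def flipArcs (O : Finset (V × V)) (w : V) (F : Finset V) : Finset (V × V) :=
  (O \ F.image fun x => (w, x)) ∪ F.image fun x => (x, w)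

/-- The orientation `O'` results from `O` by reversing `k` times some arcs with a common tail,
`D` arcs in total. -/
inductive Flips : ℕ → ℕ → Finset (V × V) → Finset (V × V) → Prop
  | refl (O : Finset (V × V)) : Flips 0 0 O O
  | step {k D : ℕ} {O O' : Finset (V × V)} (w : V) (F : Finset V) :
      Flips k D O O' → (∀ x ∈ F, (w, x) ∈ O') → Flips (k + 1) (D + F.card) O (flipArcs O' w F)

lemma badArcs_le (O R O' R' : Finset (V × V)) :
    badArcs O' R' ≤ badArcs O R + (O' \ O).card + (R' \ R).card := by
  calc badArcs O' R' ≤ ((O.filter fun a => (a.2, a.1) ∈ R) ∪ (O' \ O) ∪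
        (R' \ R).image Prod.swap).card := by
        refine Finset.card_le_card fun a ha => ?_
        simp only [Finset.mem_filter, Finset.mem_union, Finset.mem_sdiff, Finset.mem_image] at ha ⊢
        by_cases h1 : a ∈ O
        · by_cases h2 : (a.2, a.1) ∈ R
          · exact Or.inl (Or.inl ⟨h1, h2⟩)
          · exact Or.inr ⟨(a.2, a.1), ⟨ha.2, h2⟩, rfl⟩
        · exact Or.inl (Or.inr ⟨ha.1, h1⟩)
    _ ≤ _ := (Finset.card_union_le _ _).trans
        (add_le_add (Finset.card_union_le _ _) Finset.card_image_le)

/-- An arc counts as bad when its reversal is in `R`. Of the reversed arcs, the at most `Δ` with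
`(w, x) ∈ R` are bad afterwards. For all others the cover contains `(x, w)`, so they were bad before
and disappear from the count. The potential thus falls by `|F \ F₁|` and rises by at most `|F₁|`. -/
lemma badArcs_flipArcs_le {O R : Finset (V × V)} {w : V} {F : Finset V} {Δ : ℕ}
    (hF : ∀ x ∈ F, (w, x) ∈ O) (hcov : ∀ x ∈ F, (w, x) ∈ R ∨ (x, w) ∈ R)
    (hΔ : outdeg R w ≤ Δ) : badArcs (flipArcs O w F) R + F.card ≤ badArcs O R + 2 * Δ := by
  set F₁ := F.filter fun x => (w, x) ∈ R with hF₁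
  have h1 : F₁.card ≤ Δ := by
    refine le_trans (Finset.card_le_card_of_injOn (fun x => (w, x)) ?_ ?_) hΔ
    · intro x hx
      simp only [hF₁, Finset.coe_filter, Set.mem_ofPred_eq] at hx
      simp [hx.2]
    · intro x _ y _ hxy
      simpa using hxy
  have h2 : badArcs (flipArcs O w F) R ≤
      ((O \ F.image fun x => (w, x)).filter fun a => (a.2, a.1) ∈ R).card + F₁.card := by
    rw [badArcs, flipArcs, Finset.filter_union]
    refine (Finset.card_union_le _ _).trans (Nat.add_le_add_left ?_ _)
    rw [Finset.filter_image]
    exact Finset.card_image_le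
  have h3 : ((O \ F.image fun x => (w, x)).filter fun a => (a.2, a.1) ∈ R).card +
      (F \ F₁).card ≤ badArcs O R := by
    have e : ((F \ F₁).image fun x => (w, x)).card = (F \ F₁).card :=
      Finset.card_image_of_injective _ fun x y hxy => by simpa using hxy
    rw [← e, ← Finset.card_union_of_disjoint, badArcs]
    · refine Finset.card_le_card fun a ha => ?_
      simp only [Finset.mem_union, Finset.mem_filter, Finset.mem_sdiff, Finset.mem_image] at ha ⊢
      rcases ha with ha | ⟨x, ⟨hx, hx'⟩, rfl⟩
      · exact ⟨ha.1.1, ha.2⟩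
      · refine ⟨hF x hx, (hcov x hx).resolve_left fun h => hx' ?_⟩
        rw [hF₁, Finset.mem_filter]
        exact ⟨hx, h⟩
    · rw [Finset.disjoint_left]
      intro a ha hb
      obtain ⟨x, hx, rfl⟩ := Finset.mem_image.1 hb
      rw [Finset.mem_filter, Finset.mem_sdiff] at ha
      exact ha.1.2 (Finset.mem_image_of_mem _ (Finset.mem_sdiff.1 hx).1)
  have h4 : (F \ F₁).card + F₁.card = F.card :=
    Finset.card_sdiff_add_card_eq_card (Finset.filter_subset _ _)
  omega

lemma adj_of_mem_flipArcs {G : SimpleGraph V} {O : Finset (V × V)} {w : V} {F : Finset V}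
    (hF : ∀ x ∈ F, (w, x) ∈ O) (hO : ∀ a ∈ O, G.Adj a.1 a.2) :
    ∀ a ∈ flipArcs O w F, G.Adj a.1 a.2 := by
  intro a ha
  simp only [flipArcs, Finset.mem_union, Finset.mem_sdiff, Finset.mem_image] at ha
  rcases ha with ha | ⟨x, hx, rfl⟩
  · exact hO a ha.1
  · exact (hO _ (hF x hx)).symm

lemma Flips.trans {k l D D' : ℕ} {O O' O'' : Finset (V × V)} (h : Flips k D O O')
    (h' : Flips l D' O' O'') : Flips (k + l) (D + D') O O'' := by
  induction h' with
  | refl => exact h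
  | step w F _ hF ih =>
    rw [← add_assoc, ← add_assoc]
    exact (ih h).step w F hF

lemma Flips.single {O : Finset (V × V)} (w : V) (F : Finset V) (hF : ∀ x ∈ F, (w, x) ∈ O) :
    Flips 1 F.card O (flipArcs O w F) := by
  simpa using (Flips.refl O).step w F hF

lemma Flips.badArcs_le {G : SimpleGraph V} {k D Δ : ℕ} {O O' R : Finset (V × V)}
    (h : Flips k D O O') (hO : ∀ a ∈ O, G.Adj a.1 a.2)
    (hcov : ∀ x y, G.Adj x y → (x, y) ∈ R ∨ (y, x) ∈ R) (hΔ : ∀ w, outdeg R w ≤ Δ) :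
    badArcs O' R + D ≤ badArcs O R + k * (2 * Δ) ∧ ∀ a ∈ O', G.Adj a.1 a.2 := by
  induction h with
  | refl => exact ⟨by simp, hO⟩
  | step w F _ hF ih =>
    obtain ⟨h1, h2⟩ := ih hO
    refine ⟨?_, adj_of_mem_flipArcs hF h2⟩
    have h3 := badArcs_flipArcs_le hF (fun x hx => hcov _ _ (h2 _ (hF x hx))) (hΔ w)
    rw [add_mul, one_mul]
    omega

end Flips

/-- Rounding up adds at most `1 ≤ log n / log 2`, and `2 / log 2 < 3`. -/
lemma clog_le_log {n : ℕ} (hn : 2 ≤ n) : (Nat.clog 2 n : ℝ) ≤ 3 * Real.log n := by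
  have h1 : (2 : ℝ) ^ (Nat.clog 2 n - 1) ≤ n := by
    exact_mod_cast (Nat.pow_pred_clog_lt_self (by norm_num) (by omega)).le
  have h2 := Real.log_le_log (by positivity) h1
  rw [Real.log_pow] at h2
  have h3 : (Nat.clog 2 n : ℝ) - 1 ≤ ((Nat.clog 2 n - 1 : ℕ) : ℝ) := by
    have : Nat.clog 2 n ≤ (Nat.clog 2 n - 1) + 1 := by omega
    have : (Nat.clog 2 n : ℝ) ≤ ((Nat.clog 2 n - 1 : ℕ) : ℝ) + 1 := by exact_mod_cast this
    linarith
  have h4 : Real.log 2 ≤ Real.log n := Real.log_le_log (by norm_num) (by exact_mod_cast hn)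
  have h5 := Real.log_two_gt_d9
  nlinarith

/-- The trade-off between `α * k` and `g`, subject to `g * k ≥ L`, is balanced at `g` about `√(α *
L)`. The summand `α` in `g` is affordable, and the summand `1` keeps `g` positive. -/
lemma ArboricityPreserving.exists_covers {n α : ℕ} {σ : List (Update n)}
    (h : ArboricityPreserving α σ) (hσ : 0 < σ.length) :
    ∃ (R : ℕ → Finset (Fin n × Fin n)) (Δ T : ℕ),
      (∀ i ≤ σ.length, Covers (R i) (edgesAt σ i)) ∧
      (∀ i ≤ σ.length, ∀ v, outdeg (R i) v ≤ Δ) ∧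
      newArcs R (σ.length + 1) ≤ T * σ.length ∧
      (1 + 12 * Δ + T : ℝ) ≤ 152 * (α + Real.sqrt (α * Real.log n)) := by
  obtain ⟨hn, hα⟩ := h.bounds hσ
  -- With this value `2 ^ L ≥ n * n` bounds the number of edges.
  set L := 2 * Nat.clog 2 n with hL
  set s := Nat.sqrt (α * L) with hs
  set g := α + s + 1 with hg
  set k := L / g + 1 with hk
  have hgk : L ≤ g * k := by
    have := Nat.lt_mul_div_succ L (show 0 < g by omega)
    exact this.le
  obtain ⟨R, h1, h2, h3⟩ := DynMatching.exists_covers (α := α) (g := g) (k := k) (t := σ.length)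
    (E := edgesAt σ) h.sparse (by simp [edgesAt, graphAt_zero])
    (fun i hi => by rw [edgesAt, edgesAt, graphAt_of_length_le σ hi]) (card_edgesAt_le σ)
    (fun i => by
      calc (edgesAt σ i).card ≤ Fintype.card (Sym2 (Fin n)) := Finset.card_le_univ _
        _ = (n + 1).choose 2 := by simp [Sym2.card]
        _ ≤ n * n := by
            rw [Nat.choose_two_right, Nat.add_sub_cancel]
            refine Nat.div_le_of_le_mul ?_
            nlinarith
        _ ≤ 2 ^ Nat.clog 2 n * 2 ^ Nat.clog 2 n := by
            have := Nat.le_pow_clog (b := 2) (by norm_num) n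
            exact Nat.mul_le_mul this this
        _ = 2 ^ L := by rw [hL, two_mul, pow_add]
        _ ≤ 2 ^ (g * k) := Nat.pow_le_pow_right (by norm_num) hgk
        _ = _ := pow_mul _ _ _)
    (card_edgesAt_sdiff_le σ)
  refine ⟨R, _, g + 5, h1, h2, h3, ?_⟩
  have hk' : α * (L / g) ≤ s + 1 := by
    have e1 : α * L < (s + 1) * (s + 1) := Nat.lt_succ_sqrt _
    have e2 : L / g * g ≤ L := Nat.div_mul_le_self L g
    have e3 : L / g * (s + 1) ≤ L := (Nat.mul_le_mul_left _ (by omega)).trans e2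
    by_contra! hlt
    have e4 : (s + 1) * (s + 1) ≤ α * (L / g) * (s + 1) := Nat.mul_le_mul_right _ hlt.le
    nlinarith
  -- By `hk'` the left side is at most `97 * α + 49 * s + 55`, and `55 ≤ 55 * α`.
  have hN : 1 + 12 * (4 * α * (k + 1)) + (g + 5) ≤ 152 * α + 49 * s := by
    have : 4 * α * (k + 1) = 4 * (α * (L / g)) + 8 * α := by rw [hk]; ring
    omega
  have hs' : (s : ℝ) ≤ 3 * Real.sqrt (α * Real.log n) := by
    have e1 : (s : ℝ) ≤ Real.sqrt ((α * L : ℕ) : ℝ) := Real.nat_sqrt_le_real_sqrt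
    refine e1.trans ?_
    rw [show (3 : ℝ) = Real.sqrt 9 by
      rw [show (9 : ℝ) = 3 ^ 2 by norm_num, Real.sqrt_sq (by norm_num)],
      ← Real.sqrt_mul (by norm_num)]
    refine Real.sqrt_le_sqrt ?_
    have e2 := clog_le_log hn
    have e3 : (0 : ℝ) ≤ α := Nat.cast_nonneg α
    have e4 : (0 : ℝ) ≤ Real.log n := Real.log_natCast_nonneg n
    have e5 : (0 : ℝ) ≤ α * Real.log n := mul_nonneg e3 e4
    push_cast [hL]
    nlinarith
  have hN' : ((1 + 12 * (4 * α * (k + 1)) + (g + 5) : ℕ) : ℝ) ≤ ((152 * α + 49 * s : ℕ) : ℝ) :=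
    Nat.cast_le.2 hN
  have : (0 : ℝ) ≤ Real.sqrt (α * Real.log n) := Real.sqrt_nonneg _
  push_cast at hN' ⊢
  linarith

/-- The amortized cost of a dynamic orientation with at most six flips per update. -/
lemma ArboricityPreserving.sum_flips_le {n α : ℕ} {σ : List (Update n)}
    (h : ArboricityPreserving α σ) (O : ℕ → Finset (Fin n × Fin n)) (D : ℕ → ℕ) (h0 : O 0 = ∅)
    (hO : ∀ i < σ.length, ∃ O₁ k, (O₁ \ O i).card ≤ 1 ∧
      (∀ a ∈ O₁, (graphAt σ (i + 1)).Adj a.1 a.2) ∧ k ≤ 6 ∧ Flips k (D i) O₁ (O (i + 1))) :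
    (∑ i ∈ Finset.range σ.length, (D i : ℝ)) ≤
      152 * (α + Real.sqrt (α * Real.log n)) * σ.length := by
  rcases Nat.eq_zero_or_pos σ.length with hσ | hσ
  · simp [hσ]
  obtain ⟨R, Δ, T, h1, h2, h3, h4⟩ := h.exists_covers hσ
  -- The potential argument: an update raises `badArcs` by at most one for the inserted arc and by
  -- the number of new arcs of `R`. Each of the at most six resets adds at most `2 * Δ` minus the
  -- number of arcs that it reverses.
  have key : ∀ i ≤ σ.length, badArcs (O i) (R i) + ∑ j ∈ Finset.range i, D j ≤
      i * (1 + 12 * Δ) + newArcs R (i + 1) := by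
    intro i
    induction i with
    | zero => intro _; simp [h0, badArcs]
    | succ i ih =>
      intro hi
      obtain ⟨O₁, k, e1, e2, e3, e4⟩ := hO i hi
      have e5 := ih (by omega)
      have e6 := badArcs_le (O i) (R i) O₁ (R (i + 1))
      have e7 := (e4.badArcs_le e2 (R := R (i + 1)) (Δ := Δ) (by
        intro x y hxy
        obtain ⟨a, ha, hae⟩ := h1 (i + 1) hi s(x, y) (mem_edgesAt.2 hxy)
        rcases Sym2.eq_iff.1 hae with ⟨rfl, rfl⟩ | ⟨rfl, rfl⟩
        · exact Or.inl ha
        · exact Or.inr ha) (h2 (i + 1) hi)).1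
      have e8 : k * (2 * Δ) ≤ 6 * (2 * Δ) := Nat.mul_le_mul_right _ e3
      have e9 : newArcs R (i + 1 + 1) = newArcs R (i + 1) + (R (i + 1) \ R i).card := by
        rw [newArcs, Finset.sum_range_succ, ← newArcs]; rfl
      rw [e9, Finset.sum_range_succ, add_mul, one_mul]
      omega
  have h5 := key _ le_rfl
  have h6 : ∑ j ∈ Finset.range σ.length, D j ≤ σ.length * (1 + 12 * Δ) + T * σ.length := by omega
  have h7 : ((∑ j ∈ Finset.range σ.length, D j : ℕ) : ℝ) ≤
      ((σ.length * (1 + 12 * Δ) + T * σ.length : ℕ) : ℝ) := Nat.cast_le.2 h6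
  push_cast at h7
  have h8 : (0 : ℝ) ≤ σ.length := Nat.cast_nonneg _
  nlinarith

lemma ArboricityPreserving.length_le {n α : ℕ} {σ : List (Update n)}
    (h : ArboricityPreserving α σ) :
    (σ.length : ℝ) ≤ (α + Real.sqrt (α * Real.log n)) * σ.length := by
  rcases Nat.eq_zero_or_pos σ.length with hσ | hσ
  · simp [hσ]
  have h1 : (1 : ℝ) ≤ α := by exact_mod_cast (h.bounds hσ).2
  have h2 : (0 : ℝ) ≤ Real.sqrt (α * Real.log n) := Real.sqrt_nonneg _
  have h8 : (0 : ℝ) ≤ σ.length := Nat.cast_nonneg _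
  nlinarith

/-! ### Maximal matchings -/

/-- The table `μ` describes a set of edges of `G` that are pairwise disjoint. -/
def IsMateTable {n : ℕ} (G : SimpleGraph (Fin n)) (μ : Fin n → Option ℕ) : Prop :=
  ∀ v k, μ v = some k → ∃ w : Fin n, (w : ℕ) = k ∧ G.Adj v w ∧ μ w = some (v : ℕ)

lemma describesMaximalMatching {n : ℕ} {G : SimpleGraph (Fin n)} {μ : Fin n → Option ℕ}
    (hμ : IsMateTable G μ) (hmax : ∀ v w, G.Adj v w → μ v ≠ none ∨ μ w ≠ none) :
    DescribesMaximalMatching G μ := by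
  let M : G.Subgraph :=
    { verts := {v | μ v ≠ none}
      Adj := fun v w => μ v = some (w : ℕ)
      adj_sub := by
        intro v w hvw
        obtain ⟨w', hw', hadj, -⟩ := hμ v w hvw
        rwa [← Fin.ext hw']
      edge_vert := by
        intro v w hvw
        simp [hvw]
      symm := ⟨by
        intro v w hvw
        obtain ⟨w', hw', -, h⟩ := hμ v w hvw
        rwa [← Fin.ext hw']⟩ }
  have hMadj : ∀ v w, M.Adj v w ↔ μ v = some (w : ℕ) := fun _ _ => Iff.rfl
  have hMverts : ∀ v, v ∈ M.verts ↔ μ v ≠ none := fun _ => Iff.rfl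
  have hM : M.IsMatching := by
    intro v hv
    obtain ⟨k, hk⟩ := Option.ne_none_iff_exists'.1 ((hMverts v).1 hv)
    obtain ⟨w, rfl, -, -⟩ := hμ v k hk
    refine ⟨w, hk, fun w' hw' => ?_⟩
    replace hw' := (hMadj v w').1 hw'
    rw [hk] at hw'
    exact Fin.ext (Option.some.inj hw').symm
  refine ⟨M, ⟨hM, fun M' hM' hle => ?_⟩, fun v k => ?_⟩
  -- An edge of a larger matching has an endpoint that `M` already covers, and its edge in `M`
  -- belongs to the larger matching too. By uniqueness of partners the two edges agree.
  · have key : ∀ v w, M'.Adj v w → M.Adj v w := by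
      intro v w hvw
      rcases hmax v w hvw.adj_sub with h | h
      · obtain ⟨w', hw', -⟩ := hM ((hMverts v).2 h)
        have := (hM' hvw.fst_mem).unique (hle.2 hw') hvw
        rwa [← this]
      · obtain ⟨v', hv', -⟩ := hM ((hMverts w).2 h)
        have := (hM' hvw.snd_mem).unique (hle.2 hv') hvw.symm
        rw [← this]
        exact hv'.symm
    refine ⟨fun v hv => ?_, fun v w hvw => key v w hvw⟩
    obtain ⟨w, hw, -⟩ := hM' hv
    exact (key v w hw).fst_mem
  · constructor
    · intro h
      obtain ⟨w, hw, -, -⟩ := hμ v k h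
      exact ⟨w, hw, by rw [hMadj, h, hw]⟩
    · rintro ⟨w, rfl, h⟩
      exact h

end DynMatching

namespace DynMatching

/-! ### Orientations of a graph and matchings -/

section Abstract

variable {V : Type*} [DecidableEq V]

/-- `O` contains exactly one arc for every edge of `G`. -/
structure IsOrientation (G : SimpleGraph V) (O : Finset (V × V)) : Prop where
  adj : ∀ {v w}, (v, w) ∈ O → G.Adj v w
  total : ∀ {v w}, G.Adj v w → (v, w) ∈ O ∨ (w, v) ∈ O
  asymm : ∀ {v w}, (v, w) ∈ O → (w, v) ∉ O

lemma mem_flipArcs {O : Finset (V × V)} {z : V} {F : Finset V} {v w : V} :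
    (v, w) ∈ flipArcs O z F ↔ ((v, w) ∈ O ∧ ¬ (v = z ∧ w ∈ F)) ∨ (w = z ∧ v ∈ F) := by
  simp only [flipArcs, Finset.mem_union, Finset.mem_sdiff, Finset.mem_image, Prod.mk.injEq]
  constructor
  · rintro (⟨h1, h2⟩ | ⟨x, hx, rfl, rfl⟩)
    · exact Or.inl ⟨h1, fun h => h2 ⟨w, h.2, h.1.symm, rfl⟩⟩
    · exact Or.inr ⟨rfl, hx⟩
  · rintro (⟨h1, h2⟩ | ⟨rfl, h⟩)
    · exact Or.inl ⟨h1, fun ⟨x, hx, hz, hxw⟩ => h2 ⟨hz.symm, hxw ▸ hx⟩⟩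
    · exact Or.inr ⟨v, h, rfl, rfl⟩

lemma IsOrientation.flipArcs {G : SimpleGraph V} {O : Finset (V × V)} (h : IsOrientation G O)
    {z : V} {F : Finset V} (hF : ∀ x ∈ F, (z, x) ∈ O) : IsOrientation G (flipArcs O z F) where
  adj := by
    intro v w hvw
    rcases mem_flipArcs.1 hvw with h1 | ⟨rfl, h1⟩
    · exact h.adj h1.1
    · exact (h.adj (hF v h1)).symm
  total := by
    intro v w hvw
    rw [mem_flipArcs, mem_flipArcs]
    rcases h.total hvw with h1 | h1
    · by_cases h2 : v = z ∧ w ∈ F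
      · exact Or.inr (Or.inr h2)
      · exact Or.inl (Or.inl ⟨h1, h2⟩)
    · by_cases h2 : w = z ∧ v ∈ F
      · exact Or.inl (Or.inr h2)
      · exact Or.inr (Or.inl ⟨h1, h2⟩)
  asymm := by
    intro v w hvw hwv
    rw [mem_flipArcs] at hvw hwv
    rcases hvw with h1 | ⟨rfl, h1⟩
    · rcases hwv with h2 | ⟨rfl, h2⟩
      · exact h.asymm h1.1 h2.1
      · exact h1.2 ⟨rfl, h2⟩
    · rcases hwv with h2 | ⟨rfl, h2⟩
      · exact h2.2 ⟨rfl, h1⟩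
      · exact h.asymm (hF _ h1) (hF _ h1)

end Abstract

section Mates

variable {n : ℕ} {G : SimpleGraph (Fin n)}

/-- The table `μ` after `y` and `w` have been matched. -/
def setMates (μ : Fin n → Option ℕ) (y w : Fin n) : Fin n → Option ℕ :=
  Function.update (Function.update μ y (some (w : ℕ))) w (some (y : ℕ))

/-- Edges between free vertices have an endpoint in `X`. -/
def MaximalOutside (G : SimpleGraph (Fin n)) (μ : Fin n → Option ℕ) (X : Set (Fin n)) : Prop :=
  ∀ v w, G.Adj v w → μ v = none → μ w = none → v ∈ X ∨ w ∈ X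

lemma IsMateTable.setMates {μ : Fin n → Option ℕ} (h : IsMateTable G μ) {y w : Fin n}
    (hyw : G.Adj y w) (hy : μ y = none) (hw : μ w = none) : IsMateTable G (setMates μ y w) := by
  intro v k hv
  unfold DynMatching.setMates at hv ⊢
  by_cases h1 : v = w
  · subst h1
    rw [Function.update_self, Option.some_inj] at hv
    refine ⟨y, hv, hyw.symm, ?_⟩
    rw [Function.update_of_ne hyw.ne, Function.update_self]
  · rw [Function.update_of_ne h1] at hv
    by_cases h2 : v = y
    · subst h2
      rw [Function.update_self, Option.some_inj] at hv
      exact ⟨w, hv, hyw, by rw [Function.update_self]⟩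
    · rw [Function.update_of_ne h2] at hv
      obtain ⟨x, hx, hadj, hx'⟩ := h v k hv
      refine ⟨x, hx, hadj, ?_⟩
      rw [Function.update_of_ne, Function.update_of_ne, hx']
      · rintro rfl; rw [hy] at hx'; cases hx'
      · rintro rfl; rw [hw] at hx'; cases hx'

lemma setMates_eq_none {μ : Fin n → Option ℕ} {y w v : Fin n} :
    setMates μ y w v = none ↔ v ≠ y ∧ v ≠ w ∧ μ v = none := by
  unfold setMates
  by_cases h1 : v = w
  · subst h1; simp
  · rw [Function.update_of_ne h1]
    by_cases h2 : v = y
    · subst h2; simp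
    · rw [Function.update_of_ne h2]; simp [h1, h2]

lemma MaximalOutside.setMates {μ : Fin n → Option ℕ} {X : Set (Fin n)}
    (h : MaximalOutside G μ X) (y w : Fin n) :
    MaximalOutside G (setMates μ y w) (X \ {y}) := by
  intro v x hvx hv hx
  rw [setMates_eq_none] at hv hx
  exact (h v x hvx hv.2.2 hx.2.2).imp (fun h => ⟨h, hv.1⟩) (fun h => ⟨h, hx.1⟩)

/-- A vertex without outgoing arcs has only in-neighbors. If none of these is free, the vertex no
longer endangers maximality although it stays free. -/
lemma MaximalOutside.of_no_free {μ : Fin n → Option ℕ} {X : Set (Fin n)}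
    (h : MaximalOutside G μ X) {O : Finset (Fin n × Fin n)} (hO : IsOrientation G O) {y : Fin n}
    (hy : ∀ x, (y, x) ∉ O) (hfree : ∀ x, (x, y) ∈ O → μ x ≠ none) :
    MaximalOutside G μ (X \ {y}) := by
  intro v x hvx hv hx
  have h1 : v ≠ y := by
    rintro rfl
    exact hfree x ((hO.total hvx).resolve_left (hy x)) hx
  have h2 : x ≠ y := by
    rintro rfl
    exact hfree v ((hO.total hvx).resolve_right (hy v)) hv
  exact (h v x hvx hv hx).imp (fun h => ⟨h, h1⟩) (fun h => ⟨h, h2⟩)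

lemma MaximalOutside.describes {μ : Fin n → Option ℕ} (h : MaximalOutside G μ ∅)
    (hμ : IsMateTable G μ) : DescribesMaximalMatching G μ := by
  refine describesMaximalMatching hμ fun v w hvw => ?_
  by_contra! hcon
  rcases h v w hvw hcon.1 hcon.2 with h | h <;> exact h

end Mates

/-! ### The distributed algorithm -/

/-- The state of a processor: its name, its out-neighbors, its free in-neighbors, its partner,
and a timer. -/
structure ProcState where
  id : ℕ
  out : Set ℕ
  free : Set ℕ
  mate : Option ℕ
  timer : ℕ

open scoped Classical in
/-- The tail of a new edge is the endpoint with the smaller name. A free processor whose timer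
shows `3` is about to look for a partner; if both endpoints of a deleted edge have to do so, the
one with the larger name waits. -/
noncomputable def ProcState.notify (q : ProcState) (k : Kind) (w : ℕ) : ProcState :=
  match k with
  | .insert =>
      if q.id < w then
        { q with out := q.out ∪ {w}, timer := if q.mate = none then 3 else 0 }
      else q
  | .delete =>
      { q with
        out := q.out \ {w}
        free := q.free \ {w}
        mate := if q.mate = some w then none else q.mate
        -- A search occupies six rounds, so the timer `9 = 3 + 6` starts the second search exactly
        -- when the first is over.
        timer := if q.mate = some w then (if q.id < w then 3 else 9) else 0 }

open scoped Classical in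
/-- The message `a` to all processors in `s`. -/
noncomputable def broadcast (s : Set ℕ) (a : ℕ) (x : ℕ) : Option ℕ :=
  if x ∈ s then some a else none

/-- The out-neighbors after the messages `f` have been received. -/
def ProcState.newOut (q : ProcState) (f : ℕ → Option ℕ) : Set ℕ := q.out ∪ {y | f y = some 1}

/-- The free in-neighbors after the messages `f` have been received. -/
def ProcState.newFree (q : ProcState) (f : ℕ → Option ℕ) : Set ℕ :=
  (q.free \ {y | f y = some 1}) ∪ {y | f y = some 2}

open scoped Classical in
/-- The message `1` from `y` reverses the arc from `y`, the message `2` reports that the sender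
is free, the message `3` is a proposal, which is always accepted. -/
noncomputable def ProcState.step (q : ProcState) (f : ℕ → Option ℕ) :
    ProcState × (ℕ → Option ℕ) :=
  if ∃ y, f y = some 3 then
    (⟨q.id, ∅, q.newFree f, some (sInf {y | f y = some 3}), q.timer - 1⟩,
      broadcast (q.newOut f) 1)
  else if q.timer = 3 then
    (⟨q.id, ∅, q.newFree f, q.mate, 2⟩, broadcast (q.newOut f) 1)
  else if q.timer = 1 ∧ (q.newFree f).Nonempty then
    (⟨q.id, q.newOut f, q.newFree f, some (sInf (q.newFree f)), 0⟩,
      broadcast {sInf (q.newFree f)} 3)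
  else
    (⟨q.id, q.newOut f, q.newFree f, q.mate, q.timer - 1⟩,
      -- A processor whose timer is running does not report itself as free: it is going to search on
      -- its own and must not receive a proposal before.
      broadcast {x | f x = some 1 ∧ q.mate = none ∧ q.timer = 0} 2)

/-- The distributed algorithm for maximal matchings. -/
noncomputable def matchingProtocol : Protocol where
  State := ProcState
  start v := ⟨v, ∅, ∅, none, 0⟩
  notify := ProcState.notify
  step := ProcState.step
  mate := ProcState.mate

/-- This serves twice: it shows that the network comes to rest, and it allows sleeping processors to
be treated as if they were awake. -/
lemma ProcState.step_idle {q : ProcState} (hq : q.timer = 0) :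
    q.step (fun _ => none) = (q, fun _ => none) := by
  obtain ⟨id, out, free, mate, timer⟩ := q
  simp only at hq
  subst hq
  have : broadcast ∅ 2 = fun _ => none := by ext1 x; simp [broadcast]
  simp [ProcState.step, ProcState.newOut, ProcState.newFree, this]

section Rounds

variable {n : ℕ}

/-- The names of the vertices with the property `p`. -/
def names (p : Fin n → Prop) : Set ℕ := {x | ∃ w : Fin n, (w : ℕ) = x ∧ p w}

/-- The family of messages that contains `f w` from (or to) `w`. -/
def mailbox (f : Fin n → Option ℕ) (x : ℕ) : Option ℕ := if h : x < n then f ⟨x, h⟩ else none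

@[simp] lemma mailbox_val (f : Fin n → Option ℕ) (w : Fin n) : mailbox f w = f w := by
  simp [mailbox]

@[simp] lemma mem_names {p : Fin n → Prop} {w : Fin n} : (w : ℕ) ∈ names p ↔ p w := by
  constructor
  · rintro ⟨w', hw', h⟩; rwa [← Fin.ext hw']
  · exact fun h => ⟨w, rfl, h⟩

lemma mailbox_eq_some {f : Fin n → Option ℕ} {x a : ℕ} :
    mailbox f x = some a ↔ ∃ w : Fin n, (w : ℕ) = x ∧ f w = some a := by
  unfold mailbox
  constructor
  · intro h
    split at h
    · exact ⟨_, rfl, h⟩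
    · cases h
  · rintro ⟨w, rfl, h⟩
    simpa using h

/-- The state of the vertex `v` with out-neighbors `p`, free in-neighbors `r`, partner `m` and
timer `t`. -/
def procState (v : Fin n) (p r : Fin n → Prop) (m : Option ℕ) (t : ℕ) : ProcState :=
  ⟨v, names p, names r, m, t⟩

lemma names_union (p r : Fin n → Prop) : names p ∪ names r = names fun x => p x ∨ r x := by
  ext x
  constructor
  · rintro (⟨w, rfl, h⟩ | ⟨w, rfl, h⟩)
    · exact ⟨w, rfl, Or.inl h⟩
    · exact ⟨w, rfl, Or.inr h⟩
  · rintro ⟨w, rfl, h | h⟩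
    · exact Or.inl ⟨w, rfl, h⟩
    · exact Or.inr ⟨w, rfl, h⟩

lemma names_sdiff (p r : Fin n → Prop) : names p \ names r = names fun x => p x ∧ ¬ r x := by
  ext x
  constructor
  · rintro ⟨⟨w, rfl, h⟩, h'⟩
    exact ⟨w, rfl, h, fun hr => h' ⟨w, rfl, hr⟩⟩
  · rintro ⟨w, rfl, h, h'⟩
    exact ⟨⟨w, rfl, h⟩, fun hr => h' (mem_names.1 hr)⟩

lemma setOf_mailbox (f : Fin n → Option ℕ) (a : ℕ) :
    {y | mailbox f y = some a} = names fun x => f x = some a := by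
  ext x
  exact mailbox_eq_some

lemma names_false : (names fun _ : Fin n => False) = ∅ := by
  ext x; simp [names]

open scoped Classical in
/-- The message `a` from (or to) the vertices with the property `p`. -/
noncomputable def sendTo (p : Fin n → Prop) (a : ℕ) (x : Fin n) : Option ℕ :=
  if p x then some a else none

@[simp] lemma sendTo_eq_some {p : Fin n → Prop} {a b : ℕ} {x : Fin n} :
    sendTo p a x = some b ↔ p x ∧ a = b := by
  unfold sendTo
  split <;> simp_all

@[simp] lemma sendTo_eq_none {p : Fin n → Prop} {a : ℕ} {x : Fin n} :
    sendTo p a x = none ↔ ¬ p x := by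
  unfold sendTo
  split <;> simp_all

lemma broadcast_names (p : Fin n → Prop) (a : ℕ) :
    broadcast (names p) a = mailbox (sendTo p a) := by
  ext1 x
  by_cases hx : x < n
  · lift x to Fin n using hx with x
    rw [mailbox_val, broadcast, mem_names, sendTo]
  · have : x ∉ names p := by
      rintro ⟨w, rfl, -⟩
      exact hx w.2
    rw [broadcast, if_neg this, mailbox, dif_neg hx]

variable {v : Fin n} {p r : Fin n → Prop} {m : Option ℕ} {t : ℕ} {f : Fin n → Option ℕ}

lemma newOut_procState : (procState v p r m t).newOut (mailbox f) =
    names fun x => p x ∨ f x = some 1 := by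
  rw [ProcState.newOut, setOf_mailbox, procState, names_union]

lemma newFree_procState : (procState v p r m t).newFree (mailbox f) =
    names fun x => (r x ∧ f x ≠ some 1) ∨ f x = some 2 := by
  rw [ProcState.newFree, setOf_mailbox, setOf_mailbox, procState, names_sdiff, names_union]

lemma exists_mailbox_eq {a : ℕ} : (∃ y, mailbox f y = some a) ↔ ∃ x, f x = some a := by
  constructor
  · rintro ⟨y, hy⟩
    obtain ⟨w, -, hw⟩ := mailbox_eq_some.1 hy
    exact ⟨w, hw⟩
  · rintro ⟨x, hx⟩
    exact ⟨x, by simpa using hx⟩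

lemma nonempty_names : (names p).Nonempty ↔ ∃ x, p x := by
  constructor
  · rintro ⟨x, w, -, hw⟩
    exact ⟨w, hw⟩
  · rintro ⟨x, hx⟩
    exact ⟨x, x, rfl, hx⟩

lemma step_plain (h3 : ∀ x, f x ≠ some 3) (ht : t ≠ 3)
    (ht' : t = 1 → ∀ x, ¬ ((r x ∧ f x ≠ some 1) ∨ f x = some 2)) :
    (procState v p r m t).step (mailbox f) =
      (procState v (fun x => p x ∨ f x = some 1)
        (fun x => (r x ∧ f x ≠ some 1) ∨ f x = some 2) m (t - 1),
      mailbox (sendTo (fun x => f x = some 1 ∧ m = none ∧ t = 0) 2)) := by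
  have e : {x | mailbox f x = some 1 ∧ (procState v p r m t).mate = none ∧
      (procState v p r m t).timer = 0} = names fun x => f x = some 1 ∧ m = none ∧ t = 0 := by
    ext x
    constructor
    · rintro ⟨hx, hm⟩
      obtain ⟨w, rfl, hw⟩ := mailbox_eq_some.1 hx
      exact ⟨w, rfl, hw, hm⟩
    · rintro ⟨w, rfl, hw, hm⟩
      exact ⟨by simpa using hw, hm⟩
  rw [ProcState.step, newOut_procState, newFree_procState, e, if_neg, if_neg, if_neg,
    broadcast_names]
  · rfl
  · rw [nonempty_names]
    rintro ⟨h1, x, hx⟩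
    exact ht' h1 x hx
  · exact ht
  · rw [exists_mailbox_eq]
    rintro ⟨x, hx⟩
    exact h3 x hx

lemma step_flip (h3 : ∀ x, f x ≠ some 3) :
    (procState v p r m 3).step (mailbox f) =
      (procState v (fun _ => False) (fun x => (r x ∧ f x ≠ some 1) ∨ f x = some 2) m 2,
      mailbox (sendTo (fun x => p x ∨ f x = some 1) 1)) := by
  have ht : (procState v p r m 3).timer = 3 := rfl
  rw [ProcState.step, newOut_procState, newFree_procState, if_neg, if_pos ht, broadcast_names,
    procState, procState, names_false]
  · rw [exists_mailbox_eq]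
    rintro ⟨x, hx⟩
    exact h3 x hx

lemma step_accept {y : Fin n} (hy : f y = some 3) (huniq : ∀ x, f x = some 3 → x = y) :
    (procState v p r m t).step (mailbox f) =
      (procState v (fun _ => False) (fun x => (r x ∧ f x ≠ some 1) ∨ f x = some 2)
        (some (y : ℕ)) (t - 1),
      mailbox (sendTo (fun x => p x ∨ f x = some 1) 1)) := by
  have hinf : sInf (names fun x => f x = some 3) = (y : ℕ) := by
    have : (names fun x => f x = some 3) = {(y : ℕ)} := by
      ext x
      constructor
      · rintro ⟨w, rfl, hw⟩; rw [huniq w hw]; rfl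
      · rintro rfl; exact ⟨y, rfl, hy⟩
    rw [this, csInf_singleton]
  rw [ProcState.step, newOut_procState, newFree_procState, if_pos (exists_mailbox_eq.2 ⟨y, hy⟩),
    broadcast_names, setOf_mailbox, hinf, procState, procState, names_false]

lemma step_propose (h3 : ∀ x, f x ≠ some 3)
    (hex : ∃ x, (r x ∧ f x ≠ some 1) ∨ f x = some 2) :
    ∃ w, ((r w ∧ f w ≠ some 1) ∨ f w = some 2) ∧
      (procState v p r m 1).step (mailbox f) =
      (procState v (fun x => p x ∨ f x = some 1)
        (fun x => (r x ∧ f x ≠ some 1) ∨ f x = some 2) (some (w : ℕ)) 0,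
      mailbox (sendTo (fun x => x = w) 3)) := by
  have hne := nonempty_names.2 hex
  obtain ⟨w, hw, hw'⟩ := Nat.sInf_mem hne
  refine ⟨w, hw', ?_⟩
  have e : ({(w : ℕ)} : Set ℕ) = names fun x => x = w := by
    ext x
    constructor
    · rintro rfl; exact ⟨w, rfl, rfl⟩
    · rintro ⟨w', rfl, rfl⟩; rfl
  rw [ProcState.step, newOut_procState, newFree_procState, if_neg, if_neg, if_pos, ← hw, e,
    broadcast_names]
  · rfl
  · exact ⟨rfl, hne⟩
  · simp [procState]
  · rw [exists_mailbox_eq]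
    rintro ⟨x, hx⟩
    exact h3 x hx

end Rounds

end DynMatching

namespace DynMatching

/-! ### Single communication rounds -/

section Runs

variable {n : ℕ}

/-- The vertices have the out-neighbors `p`, the known free in-neighbors `r`, the partners `μ` and
the timers `τ`, and `f v x` is the message that `v` is about to receive from `x`. -/
structure Runs (c : Network matchingProtocol n) (p r : Fin n → Fin n → Prop)
    (μ : Fin n → Option ℕ) (τ : Fin n → ℕ) (f : Fin n → Fin n → Option ℕ) : Prop where
  state : c.state = fun v => procState v (p v) (r v) (μ v) (τ v)
  inbox : c.inbox = fun v => mailbox (f v)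
  asleep : ∀ v ∉ c.awake, (∀ x, f v x = none) ∧ τ v = 0

lemma mailbox_none : mailbox (fun _ : Fin n => none) = fun _ => none := by
  ext1 x; unfold mailbox; split <;> rfl

/-- It suffices to compute `step` at every vertex, awake or not. A sleeping vertex has an empty
inbox and timer `0`, so its step changes and sends nothing. The hypothesis `hadj` ensures that every
message sent travels along an edge and is delivered. -/
lemma Runs.round {G : SimpleGraph (Fin n)} {c : Network matchingProtocol n}
    {p r p' r' : Fin n → Fin n → Prop} {μ μ' : Fin n → Option ℕ} {τ τ' : Fin n → ℕ}
    {f : Fin n → Fin n → Option ℕ} (h : Runs c p r μ τ f) (g : Fin n → Fin n → Option ℕ)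
    (hstep : ∀ v, (procState v (p v) (r v) (μ v) (τ v)).step (mailbox (f v)) =
      (procState v (p' v) (r' v) (μ' v) (τ' v), mailbox (g v)))
    (hadj : ∀ x w, g x w ≠ none → G.Adj x w) :
    Runs (c.round G) p' r' μ' τ' (fun w x => g x w) := by
  have hidle : ∀ v ∉ c.awake, procState v (p v) (r v) (μ v) (τ v) =
      procState v (p' v) (r' v) (μ' v) (τ' v) ∧ ∀ x, g v x = none := by
    intro v hv
    obtain ⟨h1, h2⟩ := h.asleep v hv
    have h3 := hstep v
    rw [show f v = fun _ => none from funext h1, mailbox_none,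
      ProcState.step_idle (by exact h2)] at h3
    refine ⟨congrArg Prod.fst h3, fun x => ?_⟩
    have h4 := congrFun (congrArg Prod.snd h3) (x : ℕ)
    simp only [mailbox_val] at h4
    exact h4.symm
  have hdel : ∀ w, c.delivered G w = mailbox fun x => g x w := by
    intro w
    ext1 x
    rw [Network.delivered, mailbox]
    by_cases hx : x < n
    · rw [dif_pos hx, dif_pos hx]
      have h4 := hstep ⟨x, hx⟩
      have h5 : matchingProtocol.step = ProcState.step := rfl
      split
      · rename_i h6
        rw [h5, h.state, h.inbox, h4]
        simp
      · rename_i h6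
        by_cases h7 : (⟨x, hx⟩ : Fin n) ∈ c.awake
        · by_contra h8
          exact h6 ⟨h7, hadj _ _ (Ne.symm h8)⟩
        · exact ((hidle _ h7).2 w).symm
    · rw [dif_neg hx, dif_neg hx]
  refine ⟨?_, ?_, ?_⟩
  · ext1 v
    simp only [Network.round]
    split
    · rw [h.state, h.inbox]
      exact congrArg Prod.fst (hstep v)
    · rename_i hv
      rw [h.state]
      exact (hidle v hv).1
  · simp only [Network.round]
    ext1 w
    exact hdel w
  · intro v hv
    simp only [Network.round, Set.mem_union, not_or, Set.mem_ofPred_eq, not_exists, not_not] at hv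
    refine ⟨fun x => ?_, ?_⟩
    · have := hv.2 x
      rwa [hdel, mailbox_val] at this
    · have h1 := congrArg ProcState.timer (hidle v hv.1).1
      exact h1.symm.trans (h.asleep v hv.1).2

lemma Runs.congr {c : Network matchingProtocol n} {p r p' r' : Fin n → Fin n → Prop}
    {μ μ' : Fin n → Option ℕ} {τ τ' : Fin n → ℕ} {f f' : Fin n → Fin n → Option ℕ}
    (h : Runs c p r μ τ f) (hp : ∀ v x, p v x ↔ p' v x) (hr : ∀ v x, r v x ↔ r' v x)
    (hμ : ∀ v, μ v = μ' v) (hτ : ∀ v, τ v = τ' v) (hf : ∀ v x, f v x = f' v x) :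
    Runs c p' r' μ' τ' f' := by
  obtain rfl : p = p' := funext fun v => funext fun x => propext (hp v x)
  obtain rfl : r = r' := funext fun v => funext fun x => propext (hr v x)
  obtain rfl : μ = μ' := funext hμ
  obtain rfl : τ = τ' := funext hτ
  obtain rfl : f = f' := funext fun v => funext fun x => hf v x
  exact h

lemma Runs.messageCount_le {c : Network matchingProtocol n} {p r : Fin n → Fin n → Prop}
    {μ : Fin n → Option ℕ} {τ : Fin n → ℕ} {f : Fin n → Fin n → Option ℕ}
    (h : Runs c p r μ τ f) (S : Finset (Fin n × Fin n))
    (hS : ∀ v x, f v x ≠ none → (v, x) ∈ S) : c.messageCount ≤ S.card := by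
  rw [Network.messageCount, ← Set.ncard_coe_finset S]
  refine Set.ncard_le_ncard_of_injOn
    (f := fun a : Fin n × ℕ => (a.1, if hx : a.2 < n then (⟨a.2, hx⟩ : Fin n) else a.1)) ?_ ?_
  · rintro ⟨v, x⟩ hx
    simp only [Set.mem_ofPred_eq, h.inbox, mailbox] at hx
    split at hx
    · rename_i hxn
      simp only [hxn, dif_pos]
      exact hS v _ hx
    · exact absurd rfl hx
  · rintro ⟨v, x⟩ hx ⟨w, y⟩ hy hxy
    simp only [Set.mem_ofPred_eq, h.inbox, mailbox] at hx hy
    split at hx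
    · split at hy
      · rename_i h1 h2
        simp only [h1, h2, dif_pos, Prod.mk.injEq, Fin.mk.injEq] at hxy
        rw [hxy.1, hxy.2]
      · exact absurd rfl hy
    · exact absurd rfl hx

lemma Runs.inbox_le {c : Network matchingProtocol n} {p r : Fin n → Fin n → Prop}
    {μ : Fin n → Option ℕ} {τ : Fin n → ℕ} {f : Fin n → Fin n → Option ℕ}
    (h : Runs c p r μ τ f) (hf : ∀ v x a, f v x = some a → a ≤ 3) {w : Fin n} {x a : ℕ}
    (ha : c.inbox w x = some a) : a ≤ 3 := by
  rw [h.inbox] at ha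
  obtain ⟨y, -, hy⟩ := mailbox_eq_some.1 ha
  exact hf w y a hy

variable {G : SimpleGraph (Fin n)} {c : Network matchingProtocol n} {O : Finset (Fin n × Fin n)}
  {μ : Fin n → Option ℕ} {τ : Fin n → ℕ} {A A' : Fin n → Prop}

/-- All arcs from `z` reversed. -/
def flipAll (O : Finset (Fin n × Fin n)) (z : Fin n) : Finset (Fin n × Fin n) :=
  flipArcs O z (Finset.univ.filter fun x => (z, x) ∈ O)

lemma mem_flipAll {z v w : Fin n} :
    (v, w) ∈ flipAll O z ↔ ((v, w) ∈ O ∧ v ≠ z) ∨ (w = z ∧ (z, v) ∈ O) := by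
  rw [flipAll, mem_flipArcs]
  simp only [Finset.mem_filter, Finset.mem_univ, true_and]
  constructor
  · rintro (⟨h1, h2⟩ | h)
    · exact Or.inl ⟨h1, fun h => h2 ⟨h, h ▸ h1⟩⟩
    · exact Or.inr h
  · rintro (⟨h1, h2⟩ | h)
    · exact Or.inl ⟨h1, fun h => h2 h.1⟩
    · exact Or.inr h

lemma sendTo_of_not {p : Fin n → Prop} (a : ℕ) (h : ∀ x, ¬ p x) : sendTo p a = fun _ => none := by
  ext1 x; rw [sendTo_eq_none]; exact h x

lemma sendTo_congr {p q : Fin n → Prop} (a : ℕ) (h : ∀ x, p x ↔ q x) : sendTo p a = sendTo q a := by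
  obtain rfl : p = q := funext fun x => propext (h x)
  rfl

lemma procState_congr {v : Fin n} {p p' r r' : Fin n → Prop} {m m' : Option ℕ} {t t' : ℕ}
    (hp : ∀ x, p x ↔ p' x) (hr : ∀ x, r x ↔ r' x) (hm : m = m') (ht : t = t') :
    procState v p r m t = procState v p' r' m' t' := by
  obtain rfl : p = p' := funext fun x => propext (hp x)
  obtain rfl : r = r' := funext fun x => propext (hr x)
  rw [hm, ht]

/-- Nothing is sent while no timer runs out. -/
lemma Runs.round_idle (h : Runs c (fun v x => (v, x) ∈ O) (fun v x => (x, v) ∈ O ∧ A x) μ τ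
      fun _ _ => none) (hτ : ∀ v, τ v ≠ 3 ∧ τ v ≠ 1) :
    Runs (c.round G) (fun v x => (v, x) ∈ O) (fun v x => (x, v) ∈ O ∧ A x) μ (fun v => τ v - 1)
      fun _ _ => none := by
  refine h.round (fun _ _ => none) (fun v => ?_) (by simp)
  rw [step_plain (by simp) (hτ v).1 (fun h => absurd h (hτ v).2)]
  exact Prod.ext (procState_congr (by simp) (by simp) rfl rfl)
    (by rw [sendTo_of_not _ (by simp)])

/-- The vertex `y` whose timer shows `3` reverses all its arcs. -/
lemma Runs.round_start {r : Fin n → Fin n → Prop}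
    (h : Runs c (fun v x => (v, x) ∈ O) r μ τ fun _ _ => none) (hO : IsOrientation G O)
    {y : Fin n} (hy : τ y = 3) (hτ : ∀ v ≠ y, τ v ≠ 3 ∧ τ v ≠ 1) :
    Runs (c.round G) (fun v x => v ≠ y ∧ (v, x) ∈ O) r μ
      (fun v => τ v - 1) fun v x => sendTo (fun v => x = y ∧ (y, v) ∈ O) 1 v := by
  refine h.round (fun x => sendTo (fun v => x = y ∧ (y, v) ∈ O) 1) (fun v => ?_) ?_
  · by_cases hv : v = y
    · subst hv
      rw [hy, step_flip (by simp)]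
      exact Prod.ext (procState_congr (by simp) (by simp) rfl rfl)
        (congrArg mailbox (sendTo_congr _ (by simp)))
    · rw [step_plain (by simp) (hτ v hv).1 (fun h => absurd h (hτ v hv).2)]
      exact Prod.ext (procState_congr (by simp [hv]) (by simp) rfl rfl)
        (by rw [sendTo_of_not _ (by simp), sendTo_of_not _ (by simp [hv])])
  · intro x w hxw
    simp only [ne_eq, sendTo_eq_none, not_not] at hxw
    obtain ⟨rfl, hxw⟩ := hxw
    exact hO.adj hxw

/-- The out-neighbors of `z` reverse the arcs from `z`. -/
lemma Runs.round_reply {r : Fin n → Fin n → Prop} {z : Fin n}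
    (h : Runs c (fun v x => v ≠ z ∧ (v, x) ∈ O) r μ τ
      fun v x => sendTo (fun v => x = z ∧ (z, v) ∈ O) 1 v)
    (hO : IsOrientation G O) (hτ : ∀ v, τ v ≠ 3 ∧ τ v ≠ 1)
    (hr : ∀ v x, x ≠ z → (r v x ↔ (x, v) ∈ O ∧ A x)) (hrz : ∀ v, r v z → (z, v) ∈ O)
    (hA : ∀ x v, (x, v) ∈ O → x ≠ z → (A x ↔ A' x))
    (hA' : ∀ x, (z, x) ∈ O → (A' x ↔ μ x = none ∧ τ x = 0)) :
    Runs (c.round G) (fun v x => (v, x) ∈ flipAll O z)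
      (fun v x => if v = z then (x, z) ∈ O ∧ A x else (x, v) ∈ flipAll O z ∧ A' x) μ
      (fun v => τ v - 1) fun v x => sendTo (fun v => v = z ∧ (z, x) ∈ O ∧ A' x) 2 v := by
  refine h.round (fun x => sendTo (fun v => v = z ∧ (z, x) ∈ O ∧ A' x) 2) (fun v => ?_) ?_
  · rw [step_plain (by simp) (hτ v).1 (fun h => absurd h (hτ v).2)]
    refine Prod.ext (procState_congr (fun x => ?_) (fun x => ?_) rfl rfl)
      (congrArg mailbox (sendTo_congr _ fun x => ?_))
    · simp only [sendTo_eq_some, and_true, mem_flipAll]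
      tauto
    · simp only [sendTo_eq_some, and_true, ne_eq, OfNat.one_ne_ofNat, and_false, or_false,
        mem_flipAll]
      have hzz : (z, z) ∉ O := fun h => (hO.adj h).ne rfl
      by_cases hx : x = z
      · subst hx
        have := hrz v
        by_cases hv : v = x
        · subst hv; simp; tauto
        · simp only [hv, if_false, not_true, and_false, false_and, or_false, iff_false]
          tauto
      · rw [hr v x hx]
        by_cases hv : v = z
        · subst hv
          simp [hzz]
        · simp only [hv, if_false, false_and, or_false, hx, not_false_eq_true, and_true]
          constructor
          · rintro ⟨h1, h2⟩
            exact ⟨h1, (hA x v h1 hx).1 h2⟩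
          · rintro ⟨h1, h2⟩
            exact ⟨h1, (hA x v h1 hx).2 h2⟩
    · simp only [sendTo_eq_some, and_true]
      constructor
      · rintro ⟨⟨h1, h2⟩, h3⟩
        exact ⟨h1, h2, (hA' v h2).2 h3⟩
      · rintro ⟨h1, h2, h3⟩
        exact ⟨⟨h1, h2⟩, (hA' v h2).1 h3⟩
  · intro x w hxw
    simp only [ne_eq, sendTo_eq_none, not_not] at hxw
    obtain ⟨rfl, hxw, -⟩ := hxw
    exact (hO.adj hxw).symm

lemma mem_flipAll_self (hO : IsOrientation G O) {z x : Fin n} :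
    (x, z) ∈ flipAll O z ↔ (x, z) ∈ O ∨ (z, x) ∈ O := by
  rw [mem_flipAll]
  constructor
  · rintro (h | h)
    · exact Or.inl h.1
    · exact Or.inr h.2
  · rintro (h | h)
    · exact Or.inl ⟨h, (hO.adj h).ne⟩
    · exact Or.inr ⟨rfl, h⟩

/-- After its reset, the in-neighbors of `z` are the old ones, whose status was on record, and the
former out-neighbors, which have just replied. -/
lemma free_after_replies (hO : IsOrientation G O) {z : Fin n}
    (hA : ∀ x v, (x, v) ∈ O → x ≠ z → (A x ↔ A' x)) (x : Fin n) :
    ((x, z) ∈ O ∧ A x) ∨ ((z, x) ∈ O ∧ A' x) ↔ (x, z) ∈ flipAll O z ∧ A' x := by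
  rw [mem_flipAll_self hO]
  constructor
  · rintro (⟨h1, h2⟩ | ⟨h1, h2⟩)
    · exact ⟨Or.inl h1, (hA x z h1 (hO.adj h1).ne).1 h2⟩
    · exact ⟨Or.inr h1, h2⟩
  · rintro ⟨h1 | h1, h2⟩
    · exact Or.inl ⟨h1, (hA x z h1 (hO.adj h1).ne).2 h2⟩
    · exact Or.inr ⟨h1, h2⟩

/-- The vertex `z` receives the replies and does not look for a partner. -/
lemma Runs.round_collect {z : Fin n} (h : Runs c (fun v x => (v, x) ∈ flipAll O z)
      (fun v x => if v = z then (x, z) ∈ O ∧ A x else (x, v) ∈ flipAll O z ∧ A' x) μ τ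
      fun v x => sendTo (fun v => v = z ∧ (z, x) ∈ O ∧ A' x) 2 v)
    (hO : IsOrientation G O) (hA : ∀ x v, (x, v) ∈ O → x ≠ z → (A x ↔ A' x))
    (hτ : ∀ v, τ v ≠ 3)
    (hτ' : ∀ v, τ v = 1 → v = z ∧ ∀ x, ¬ ((x, z) ∈ flipAll O z ∧ A' x)) :
    Runs (c.round G) (fun v x => (v, x) ∈ flipAll O z) (fun v x => (x, v) ∈ flipAll O z ∧ A' x) μ
      (fun v => τ v - 1) fun _ _ => none := by
  have key : ∀ v x, (((if v = z then (x, z) ∈ O ∧ A x else (x, v) ∈ flipAll O z ∧ A' x) ∧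
      sendTo (fun v => v = z ∧ (z, x) ∈ O ∧ A' x) 2 v ≠ some 1) ∨
      sendTo (fun v => v = z ∧ (z, x) ∈ O ∧ A' x) 2 v = some 2) ↔
      (x, v) ∈ flipAll O z ∧ A' x := by
    intro v x
    by_cases hv : v = z
    · subst hv
      rw [← free_after_replies hO hA]
      simp
    · simp [hv]
  refine h.round (fun _ _ => none) (fun v => ?_) (by simp)
  rw [step_plain (by simp) (hτ v)]
  · exact Prod.ext (procState_congr (by simp) (fun x => key v x) rfl rfl)
      (by rw [sendTo_of_not _ (by simp)])
  · intro hv x hx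
    rw [key] at hx
    obtain ⟨rfl, h'⟩ := hτ' v hv
    exact h' x hx

/-- The vertex `z` receives the replies and proposes to a free neighbor `w`. -/
lemma Runs.round_propose {z : Fin n} (h : Runs c (fun v x => (v, x) ∈ flipAll O z)
      (fun v x => if v = z then (x, z) ∈ O ∧ A x else (x, v) ∈ flipAll O z ∧ A' x) μ τ
      fun v x => sendTo (fun v => v = z ∧ (z, x) ∈ O ∧ A' x) 2 v)
    (hO : IsOrientation G O) (hA : ∀ x v, (x, v) ∈ O → x ≠ z → (A x ↔ A' x))
    (hz : τ z = 1) (hτ : ∀ v ≠ z, τ v ≠ 3 ∧ τ v ≠ 1)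
    (hex : ∃ x, (x, z) ∈ flipAll O z ∧ A' x) :
    ∃ w, ((w, z) ∈ flipAll O z ∧ A' w) ∧
    Runs (c.round G) (fun v x => (v, x) ∈ flipAll O z) (fun v x => (x, v) ∈ flipAll O z ∧ A' x)
      (Function.update μ z (some (w : ℕ))) (fun v => τ v - 1)
      fun v x => sendTo (fun v => x = z ∧ v = w) 3 v := by
  have key : ∀ v x, (((if v = z then (x, z) ∈ O ∧ A x else (x, v) ∈ flipAll O z ∧ A' x) ∧
      sendTo (fun v => v = z ∧ (z, x) ∈ O ∧ A' x) 2 v ≠ some 1) ∨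
      sendTo (fun v => v = z ∧ (z, x) ∈ O ∧ A' x) 2 v = some 2) ↔
      (x, v) ∈ flipAll O z ∧ A' x := by
    intro v x
    by_cases hv : v = z
    · subst hv
      rw [← free_after_replies hO hA]
      simp
    · simp [hv]
  obtain ⟨w, hw, hstep⟩ := step_propose (v := z) (p := fun x => (z, x) ∈ flipAll O z)
    (r := fun x => if z = z then (x, z) ∈ O ∧ A x else (x, z) ∈ flipAll O z ∧ A' x) (m := μ z)
    (f := fun x => sendTo (fun v => v = z ∧ (z, x) ∈ O ∧ A' x) 2 z) (by simp) (by
      obtain ⟨x, hx⟩ := hex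
      exact ⟨x, (key z x).2 hx⟩)
  rw [key] at hw
  refine ⟨w, hw, h.round (fun x => sendTo (fun v => x = z ∧ v = w) 3) (fun v => ?_) ?_⟩
  · by_cases hv : v = z
    · subst hv
      rw [hz, hstep]
      exact Prod.ext (procState_congr (by simp) (fun x => key v x) (by simp) rfl)
        (congrArg mailbox (sendTo_congr _ (by simp)))
    · rw [step_plain (by simp) (hτ v hv).1 (fun h => absurd h (hτ v hv).2)]
      exact Prod.ext (procState_congr (by simp) (fun x => key v x)
        (by rw [Function.update_of_ne hv]) rfl)
        (by rw [sendTo_of_not _ (by simp), sendTo_of_not _ (by simp [hv])])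
  · intro x w' hxw
    simp only [ne_eq, sendTo_eq_none, not_not] at hxw
    obtain ⟨rfl, rfl⟩ := hxw
    rcases (mem_flipAll_self hO).1 hw.1 with h' | h'
    · exact (hO.adj h').symm
    · exact hO.adj h'

/-- The vertex `w` accepts the proposal of `y` and reverses all its arcs. -/
lemma Runs.round_accept {y w : Fin n} (h : Runs c (fun v x => (v, x) ∈ O)
      (fun v x => (x, v) ∈ O ∧ A x) (Function.update μ y (some (w : ℕ))) τ
      fun v x => sendTo (fun v => x = y ∧ v = w) 3 v) (hO : IsOrientation G O)
    (hτ : ∀ v, τ v ≠ 3 ∧ τ v ≠ 1) :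
    Runs (c.round G) (fun v x => v ≠ w ∧ (v, x) ∈ O) (fun v x => (x, v) ∈ O ∧ A x)
      (setMates μ y w) (fun v => τ v - 1) fun v x => sendTo (fun v => x = w ∧ (w, v) ∈ O) 1 v := by
  refine h.round (fun x => sendTo (fun v => x = w ∧ (w, v) ∈ O) 1) (fun v => ?_) ?_
  · by_cases hv : v = w
    · subst hv
      rw [step_accept (y := y) (by simp) (by simp)]
      exact Prod.ext (procState_congr (by simp) (by simp) (by simp [setMates]) rfl)
        (congrArg mailbox (sendTo_congr _ (by simp)))
    · rw [step_plain (by simp [hv]) (hτ v).1 (fun h => absurd h (hτ v).2)]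
      exact Prod.ext (procState_congr (by simp [hv]) (by simp)
        (by rw [setMates, Function.update_of_ne hv]) rfl)
        (by rw [sendTo_of_not _ (by simp), sendTo_of_not _ (by simp [hv])])
  · intro x w' hxw
    simp only [ne_eq, sendTo_eq_none, not_not] at hxw
    obtain ⟨rfl, hxw⟩ := hxw
    exact hO.adj hxw

end Runs

end DynMatching

namespace DynMatching

/-! ### The search of a free processor for a partner -/

section Rematch

variable {n : ℕ} {G : SimpleGraph (Fin n)} {c : Network matchingProtocol n}
  {O : Finset (Fin n × Fin n)} {μ : Fin n → Option ℕ} {τ : Fin n → ℕ}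

/-- No messages are in transit, and the local information is correct. -/
def Rests (c : Network matchingProtocol n) (O : Finset (Fin n × Fin n)) (μ : Fin n → Option ℕ)
    (τ : Fin n → ℕ) : Prop :=
  Runs c (fun v x => (v, x) ∈ O) (fun v x => (x, v) ∈ O ∧ (μ x = none ∧ τ x = 0)) μ τ
    fun _ _ => none

/-- All messages in transit are at most `3`. -/
def SmallMessages (c : Network matchingProtocol n) : Prop :=
  ∀ w x a, c.inbox w x = some a → a ≤ 3

lemma Runs.messageCount_eq_zero {p r : Fin n → Fin n → Prop}
    (h : Runs c p r μ τ fun _ _ => none) : c.messageCount = 0 := by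
  have := h.messageCount_le ∅ (by simp)
  simpa using this

lemma Runs.smallMessages_none {p r : Fin n → Fin n → Prop}
    (h : Runs c p r μ τ fun _ _ => none) : SmallMessages c :=
  fun _ _ _ ha => h.inbox_le (by simp) ha

lemma Runs.messages_flip {p r : Fin n → Fin n → Prop} {z : Fin n}
    (h : Runs c p r μ τ fun v x => sendTo (fun v => x = z ∧ (z, v) ∈ O) 1 v) :
    c.messageCount ≤ (Finset.univ.filter fun x => (z, x) ∈ O).card ∧ SmallMessages c := by
  refine ⟨(h.messageCount_le ((Finset.univ.filter fun x => (z, x) ∈ O).image fun v => (v, z))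
    ?_).trans Finset.card_image_le, fun _ _ _ ha => h.inbox_le ?_ ha⟩
  · intro v x hvx
    simp only [ne_eq, sendTo_eq_none, not_not] at hvx
    simp [hvx]
  · intro v x a ha
    rw [sendTo_eq_some] at ha
    omega

lemma Runs.messages_reply {p r : Fin n → Fin n → Prop} {A : Fin n → Prop} {z : Fin n}
    (h : Runs c p r μ τ fun v x => sendTo (fun v => v = z ∧ (z, x) ∈ O ∧ A x) 2 v) :
    c.messageCount ≤ (Finset.univ.filter fun x => (z, x) ∈ O).card ∧ SmallMessages c := by
  refine ⟨(h.messageCount_le ((Finset.univ.filter fun x => (z, x) ∈ O).image fun v => (z, v))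
    ?_).trans Finset.card_image_le, fun _ _ _ ha => h.inbox_le ?_ ha⟩
  · intro v x hvx
    simp only [ne_eq, sendTo_eq_none, not_not] at hvx
    simp [hvx]
  · intro v x a ha
    rw [sendTo_eq_some] at ha
    omega

lemma Runs.messages_propose {p r : Fin n → Fin n → Prop} {z w : Fin n}
    (h : Runs c p r μ τ fun v x => sendTo (fun v => x = z ∧ v = w) 3 v) :
    c.messageCount ≤ 1 ∧ SmallMessages c := by
  refine ⟨(h.messageCount_le {(w, z)} ?_).trans (by simp), fun _ _ _ ha => h.inbox_le ?_ ha⟩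
  · intro v x hvx
    simp only [ne_eq, sendTo_eq_none, not_not] at hvx
    simp [hvx]
  · intro v x a ha
    rw [sendTo_eq_some] at ha
    omega

lemma flips_flipAll (O : Finset (Fin n × Fin n)) (z : Fin n) :
    Flips 1 (Finset.univ.filter fun x => (z, x) ∈ O).card O (flipAll O z) :=
  Flips.single z _ (by simp)

lemma IsOrientation.flipAll (hO : IsOrientation G O) (z : Fin n) :
    IsOrientation G (flipAll O z) := hO.flipArcs (by simp)

lemma notMem_flipAll (hO : IsOrientation G O) (z x : Fin n) : (z, x) ∉ flipAll O z := by
  rw [mem_flipAll]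
  rintro (h | ⟨rfl, h⟩)
  · exact h.2 rfl
  · exact (hO.adj h).ne rfl

lemma sum_range_six (f : ℕ → ℕ) :
    ∑ k ∈ Finset.range 6, f (k + 1) = f 1 + f 2 + f 3 + f 4 + f 5 + f 6 := by
  simp [Finset.sum_range_succ]

lemma forall_le_six {p : ℕ → Prop} (h0 : p 0) (h1 : p 1) (h2 : p 2) (h3 : p 3) (h4 : p 4)
    (h5 : p 5) (h6 : p 6) : ∀ k ≤ 6, p k := by
  intro k hk
  interval_cases k <;> assumption

/-- The six rounds in which the free vertex `y` looks for a partner. -/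
lemma Runs.rematch {r : Fin n → Fin n → Prop} {y : Fin n}
    (h : Runs c (fun v x => (v, x) ∈ O) r μ τ fun _ _ => none)
    (hr : ∀ v x, x ≠ y → (r v x ↔ (x, v) ∈ O ∧ (μ x = none ∧ τ x = 0)))
    (hry : ∀ v, r v y → (y, v) ∈ O) (hO : IsOrientation G O) (hμ : IsMateTable G μ)
    {X : Set (Fin n)} (hX : MaximalOutside G μ X) (hy : μ y = none) (hτy : τ y = 3)
    (hτ : ∀ v ≠ y, τ v = 0 ∨ τ v = 9) (hfar : ∀ v, G.Adj y v → τ v = 0) :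
    ∃ O' μ' D k, k ≤ 2 ∧ Flips k D O O' ∧ IsOrientation G O' ∧ IsMateTable G μ' ∧
      MaximalOutside G μ' (X \ {y}) ∧ (∀ x ≠ y, ¬ G.Adj y x → μ' x = μ x) ∧
      Rests ((Network.round G)^[6] c) O' μ' (fun v => τ v - 6) ∧
      ∑ k ∈ Finset.range 6, ((Network.round G)^[k + 1] c).messageCount ≤ 2 * D + 1 ∧
      ∀ k ≤ 6, SmallMessages ((Network.round G)^[k] c) := by
  have h1 := Runs.round_start h hO hτy (fun v hv => by have := hτ v hv; omega)
  -- The status is expressed by the timers that remain when the six rounds are over. For vertices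
  -- other than `y` this agrees with the present status, since timers are `0` or `9`; a waiting
  -- vertex is left with `3` and does not count as available.
  set A' : Fin n → Prop := fun x => μ x = none ∧ τ x - 6 = 0 with hA'
  have hAA : ∀ x v, (x, v) ∈ O → x ≠ y → ((μ x = none ∧ τ x = 0) ↔ A' x) := by
    intro x v _ hx
    have := hτ x hx
    simp only [hA']
    constructor <;> (rintro ⟨e1, e2⟩; exact ⟨e1, by omega⟩)
  have h2 := h1.round_reply (A' := A') hO
    (fun v => by
      by_cases hv : v = y
      · subst hv; omega
      · have := hτ v hv; omega) hr hry hAA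
    (fun x hx => by
      have := hτ x (hO.adj hx).ne'
      simp only [hA']
      constructor <;> (rintro ⟨e1, e2⟩; exact ⟨e1, by omega⟩))
  have hO1 := hO.flipAll y
  have m0 := Runs.smallMessages_none h
  have m1 := h1.messages_flip
  have m2 := h2.messages_reply
  by_cases hex : ∃ x, (x, y) ∈ flipAll O y ∧ A' x
  · obtain ⟨w, ⟨hw, hw'⟩, h3⟩ := h2.round_propose hO hAA (by omega)
      (fun v hv => by have := hτ v hv; omega) hex
    have h4 := h3.round_accept hO1 (fun v => by
      by_cases hv : v = y
      · subst hv; omega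
      · have := hτ v hv; omega)
    set A'' : Fin n → Prop := fun x => setMates μ y w x = none ∧ τ x - 6 = 0 with hA''
    -- Only `y` and `w` change their status, and `y` is on nobody's record because it has no
    -- outgoing arcs after its reset.
    have hAA' : ∀ x v, (x, v) ∈ flipAll O y → x ≠ w → (A' x ↔ A'' x) := by
      intro x v hxv hxw
      have hxy : x ≠ y := by rintro rfl; exact notMem_flipAll hO _ _ hxv
      simp only [hA', hA'', setMates_eq_none]
      tauto
    have h5 := h4.round_reply (A' := A'') hO1
      (fun v => by
        by_cases hv : v = y
        · subst hv; omega
        · have := hτ v hv; omega) (fun _ _ _ => Iff.rfl) (fun _ h => h.1) hAA'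
      (fun x _ => by
        simp only [hA'', setMates_eq_none]
        by_cases hxy : x = y
        · simp [hxy]
        · have := hτ x hxy
          constructor <;> (rintro ⟨e1, e2⟩; exact ⟨e1, by omega⟩))
    have h6 := h5.round_collect hO1 hAA'
      (fun v => by
        by_cases hv : v = y
        · subst hv; omega
        · have := hτ v hv; omega)
      (fun v => by
        by_cases hv : v = y
        · subst hv; omega
        · have := hτ v hv; omega)
    have hyw : G.Adj y w := (hO1.adj hw).symm
    have m3 := h3.messages_propose
    have m4 := h4.messages_flip
    have m5 := h5.messages_reply
    refine ⟨flipAll (flipAll O y) w, setMates μ y w, _, 2, le_rfl,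
      (flips_flipAll O y).trans (flips_flipAll _ w), hO1.flipAll w,
      hμ.setMates hyw hy hw'.1, hX.setMates y w, ?_, ?_, ?_, ?_⟩
    · intro x hx hadj
      rw [setMates, Function.update_of_ne, Function.update_of_ne hx]
      rintro rfl; exact hadj hyw
    · exact Runs.congr h6 (fun _ _ => Iff.rfl) (fun _ _ => Iff.rfl) (fun _ => rfl)
        (fun v => by simp only [Nat.sub_sub]) (fun _ _ => rfl)
    -- Each of the two resets sends one message per reversed arc and receives at most as many
    -- replies; the proposal accounts for the summand `1`.
    · rw [sum_range_six fun k => ((Network.round G)^[k] c).messageCount]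
      have m6 := h6.messageCount_eq_zero
      simp only [Function.iterate_succ_apply, Function.iterate_zero_apply] at *
      omega
    · exact forall_le_six m0 m1.2 m2.2 m3.2 m4.2 m5.2 h6.smallMessages_none
  · have hall : ∀ x, ¬ ((x, y) ∈ flipAll O y ∧ A' x) := not_exists.1 hex
    have h3 := h2.round_collect hO hAA
      (fun v => by
        by_cases hv : v = y
        · subst hv; omega
        · have := hτ v hv; omega)
      (fun v hv => by
        by_cases hvy : v = y
        · exact ⟨hvy, hall⟩
        · have := hτ v hvy; omega)
    have h4 := h3.round_idle (G := G) (fun v => by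
      by_cases hv : v = y
      · subst hv; omega
      · have := hτ v hv; omega)
    have h5 := h4.round_idle (G := G) (fun v => by
      by_cases hv : v = y
      · subst hv; omega
      · have := hτ v hv; omega)
    have h6 := h5.round_idle (G := G) (fun v => by
      by_cases hv : v = y
      · subst hv; omega
      · have := hτ v hv; omega)
    refine ⟨flipAll O y, μ, _, 1, by omega, flips_flipAll O y, hO1, hμ, ?_, fun _ _ _ => rfl,
      ?_, ?_, ?_⟩
    · refine hX.of_no_free hO1 (notMem_flipAll hO y) fun x hx hx' => hall x ⟨hx, hx', ?_⟩
      -- No neighbor of `y` is waiting, so the absence of available neighbors means that no neighbor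
      -- is free.
      rw [hfar x (hO1.adj hx).symm]
    · exact Runs.congr h6 (fun _ _ => Iff.rfl) (fun _ _ => Iff.rfl) (fun _ => rfl)
        (fun v => by simp only [Nat.sub_sub]) (fun _ _ => rfl)
    · rw [sum_range_six fun k => ((Network.round G)^[k] c).messageCount]
      have m3 := h3.messageCount_eq_zero
      have m4 := h4.messageCount_eq_zero
      have m5 := h5.messageCount_eq_zero
      have m6 := h6.messageCount_eq_zero
      simp only [Function.iterate_succ_apply, Function.iterate_zero_apply] at *
      omega
    · exact forall_le_six m0 m1.2 m2.2 h3.smallMessages_none h4.smallMessages_none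
        h5.smallMessages_none h6.smallMessages_none

end Rematch

end DynMatching

namespace DynMatching

/-! ### A complete update in the network -/

section DistributedUpdate

variable {n : ℕ} {G : SimpleGraph (Fin n)}

lemma Update.apply_insert_adj {u v x y : Fin n} (huv : u ≠ v) :
    (Update.apply G ⟨.insert, u, v⟩).Adj x y ↔
      G.Adj x y ∨ (x = u ∧ y = v) ∨ (x = v ∧ y = u) := by
  simp only [Update.apply, SimpleGraph.sup_adj, SimpleGraph.edge_adj]
  constructor
  · rintro (h | h)
    · exact Or.inl h
    · tauto
  · rintro (h | ⟨rfl, rfl⟩ | ⟨rfl, rfl⟩)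
    · exact Or.inl h
    · exact Or.inr ⟨by simp, huv⟩
    · exact Or.inr ⟨by simp, huv.symm⟩

lemma Update.apply_delete_adj {u v x y : Fin n} :
    (Update.apply G ⟨.delete, u, v⟩).Adj x y ↔
      G.Adj x y ∧ ¬ ((x = u ∧ y = v) ∨ (x = v ∧ y = u)) := by
  simp only [Update.apply, SimpleGraph.deleteEdges_adj, Set.mem_singleton_iff, Sym2.eq_iff]

lemma Update.Valid.ne {e : Update n} (h : e.Valid G) : e.u ≠ e.v := by
  rcases e with ⟨_ | _, u, v⟩
  · exact h.1
  · exact SimpleGraph.Adj.ne h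

/-- An orientation, a matching, and the conditions under which they may be left behind. -/
structure IsSolution (G : SimpleGraph (Fin n)) (O : Finset (Fin n × Fin n))
    (μ : Fin n → Option ℕ) : Prop where
  orientation : IsOrientation G O
  mates : IsMateTable G μ
  maximal : MaximalOutside G μ ∅

lemma IsMateTable.mono {H : SimpleGraph (Fin n)} {μ : Fin n → Option ℕ} (h : IsMateTable G μ)
    (hGH : G ≤ H) : IsMateTable H μ := by
  intro v k hv
  obtain ⟨w, h1, h2, h3⟩ := h v k hv
  exact ⟨w, h1, hGH h2, h3⟩

lemma IsOrientation.insert {O : Finset (Fin n × Fin n)} (h : IsOrientation G O) {u v : Fin n}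
    (huv : u ≠ v) (hadj : ¬ G.Adj u v) :
    IsOrientation (Update.apply G ⟨.insert, u, v⟩) (insert (u, v) O) where
  adj := by
    intro x y hxy
    rw [Update.apply_insert_adj huv]
    rcases Finset.mem_insert.1 hxy with h1 | h1
    · simp only [Prod.mk.injEq] at h1; tauto
    · exact Or.inl (h.adj h1)
  total := by
    intro x y hxy
    rw [Update.apply_insert_adj huv] at hxy
    simp only [Finset.mem_insert, Prod.mk.injEq]
    rcases hxy with h1 | h1 | h1
    · have := h.total h1; tauto
    · tauto
    · tauto
  asymm := by
    intro x y hxy hyx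
    simp only [Finset.mem_insert, Prod.mk.injEq] at hxy hyx
    rcases hxy with ⟨rfl, rfl⟩ | h1
    · rcases hyx with ⟨rfl, -⟩ | h2
      · exact huv rfl
      · exact hadj (h.adj h2).symm
    · rcases hyx with ⟨rfl, rfl⟩ | h2
      · exact hadj (h.adj h1).symm
      · exact h.asymm h1 h2

/-- `O` without the arcs between `u` and `v`. -/
def eraseEdge (O : Finset (Fin n × Fin n)) (u v : Fin n) : Finset (Fin n × Fin n) :=
  (O.erase (u, v)).erase (v, u)

lemma mem_eraseEdge {O : Finset (Fin n × Fin n)} {u v x y : Fin n} :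
    (x, y) ∈ eraseEdge O u v ↔ (x, y) ∈ O ∧ ¬ ((x = u ∧ y = v) ∨ (x = v ∧ y = u)) := by
  simp only [eraseEdge, Finset.mem_erase, ne_eq, Prod.mk.injEq]
  tauto

lemma IsOrientation.eraseEdge {O : Finset (Fin n × Fin n)} (h : IsOrientation G O)
    (u v : Fin n) : IsOrientation (Update.apply G ⟨.delete, u, v⟩) (eraseEdge O u v) where
  adj := by
    intro x y hxy
    rw [Update.apply_delete_adj]
    rw [mem_eraseEdge] at hxy
    exact ⟨h.adj hxy.1, hxy.2⟩
  total := by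
    intro x y hxy
    rw [Update.apply_delete_adj] at hxy
    rw [mem_eraseEdge, mem_eraseEdge]
    have := h.total hxy.1
    tauto
  asymm := by
    intro x y hxy hyx
    rw [mem_eraseEdge] at hxy hyx
    exact h.asymm hxy.1 hyx.1

lemma MaximalOutside.insert {μ : Fin n → Option ℕ} (h : MaximalOutside G μ ∅) {u v : Fin n}
    (huv : u ≠ v) : MaximalOutside (Update.apply G ⟨.insert, u, v⟩) μ {u} := by
  intro x y hxy hx hy
  rw [Update.apply_insert_adj huv] at hxy
  rcases hxy with h1 | ⟨rfl, -⟩ | ⟨-, rfl⟩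
  · exact absurd (h x y h1 hx hy) (by simp)
  · exact Or.inl rfl
  · exact Or.inr rfl

lemma MaximalOutside.insert_of_matched {μ : Fin n → Option ℕ} (h : MaximalOutside G μ ∅)
    {u v : Fin n} (huv : u ≠ v) (hu : μ u ≠ none) :
    MaximalOutside (Update.apply G ⟨.insert, u, v⟩) μ ∅ := by
  intro x y hxy hx hy
  rcases h.insert huv x y hxy hx hy with h1 | h1
  · exact absurd (h1 ▸ hx) hu
  · exact absurd (h1 ▸ hy) hu

/-- The table `μ` after the partners `u` and `v` have been separated. -/
def clearMates (μ : Fin n → Option ℕ) (u v : Fin n) : Fin n → Option ℕ :=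
  fun x => if x = u ∨ x = v then none else μ x

lemma IsMateTable.clearMates {μ : Fin n → Option ℕ} (h : IsMateTable G μ) {u v : Fin n}
    (huv : μ u = some (v : ℕ)) :
    IsMateTable (Update.apply G ⟨.delete, u, v⟩) (clearMates μ u v) := by
  have hvu : μ v = some (u : ℕ) := by
    obtain ⟨w, h1, -, h3⟩ := h u v huv
    rwa [← Fin.ext h1]
  intro x k hx
  unfold DynMatching.clearMates at hx ⊢
  split at hx
  · cases hx
  · rename_i hx'
    push Not at hx'
    obtain ⟨w, h1, h2, h3⟩ := h x k hx
    have hwu : w ≠ u := by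
      rintro rfl
      rw [huv] at h3
      exact hx'.2 (Fin.ext (Option.some.inj h3).symm)
    have hwv : w ≠ v := by
      rintro rfl
      rw [hvu] at h3
      exact hx'.1 (Fin.ext (Option.some.inj h3).symm)
    refine ⟨w, h1, ?_, ?_⟩
    · rw [Update.apply_delete_adj]
      exact ⟨h2, by tauto⟩
    · rw [if_neg (by tauto), h3]

lemma IsMateTable.delete {μ : Fin n → Option ℕ} (h : IsMateTable G μ) {u v : Fin n}
    (huv : μ u ≠ some (v : ℕ)) : IsMateTable (Update.apply G ⟨.delete, u, v⟩) μ := by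
  intro x k hx
  obtain ⟨w, h1, h2, h3⟩ := h x k hx
  refine ⟨w, h1, ?_, h3⟩
  rw [Update.apply_delete_adj]
  refine ⟨h2, ?_⟩
  rintro (⟨rfl, rfl⟩ | ⟨rfl, rfl⟩)
  · exact huv (by rw [hx, h1])
  · exact huv h3

lemma MaximalOutside.clearMates {μ : Fin n → Option ℕ} (h : MaximalOutside G μ ∅) (u v : Fin n) :
    MaximalOutside (Update.apply G ⟨.delete, u, v⟩) (clearMates μ u v) {u, v} := by
  intro x y hxy hx hy
  rw [Update.apply_delete_adj] at hxy
  unfold DynMatching.clearMates at hx hy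
  by_contra! hcon
  simp only [Set.mem_insert_iff, Set.mem_singleton_iff] at hcon
  rw [if_neg hcon.1] at hx
  rw [if_neg hcon.2] at hy
  exact absurd (h x y hxy.1 hx hy) (by simp)

lemma MaximalOutside.delete {μ : Fin n → Option ℕ} (h : MaximalOutside G μ ∅) (u v : Fin n) :
    MaximalOutside (Update.apply G ⟨.delete, u, v⟩) μ ∅ := by
  intro x y hxy hx hy
  rw [Update.apply_delete_adj] at hxy
  exact h x y hxy.1 hx hy

variable {O : Finset (Fin n × Fin n)} {μ : Fin n → Option ℕ}

/-- The states of the processors between two updates. -/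
def restStates (O : Finset (Fin n × Fin n)) (μ : Fin n → Option ℕ) (v : Fin n) :
    matchingProtocol.State :=
  procState v (fun x => (v, x) ∈ O) (fun x => (x, v) ∈ O ∧ μ x = none) (μ v) 0

lemma names_union_singleton (p : Fin n → Prop) (w : Fin n) :
    names p ∪ {(w : ℕ)} = names fun y => p y ∨ y = w := by
  ext x
  constructor
  · rintro (⟨y, rfl, h⟩ | rfl)
    · exact ⟨y, rfl, Or.inl h⟩
    · exact ⟨w, rfl, Or.inr rfl⟩
  · rintro ⟨y, rfl, h | rfl⟩
    · exact Or.inl ⟨y, rfl, h⟩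
    · exact Or.inr rfl

lemma names_sdiff_singleton (p : Fin n → Prop) (w : Fin n) :
    names p \ {(w : ℕ)} = names fun y => p y ∧ y ≠ w := by
  ext x
  constructor
  · rintro ⟨⟨y, rfl, h⟩, h'⟩
    exact ⟨y, rfl, h, fun hy => h' (hy ▸ rfl)⟩
  · rintro ⟨y, rfl, h, h'⟩
    exact ⟨⟨y, rfl, h⟩, fun hy => h' (Fin.ext hy)⟩

lemma notify_insert_lt {x w : Fin n} (h : x < w) (p r : Fin n → Prop) (m : Option ℕ) (t : ℕ) :
    (procState x p r m t).notify .insert w =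
      procState x (fun y => p y ∨ y = w) r m (if m = none then 3 else 0) := by
  have h' : (procState x p r m t).id < (w : ℕ) := h
  simp only [ProcState.notify]
  rw [if_pos h', procState, procState, names_union_singleton]

lemma notify_insert_gt {x w : Fin n} (h : w < x) (p r : Fin n → Prop) (m : Option ℕ) (t : ℕ) :
    (procState x p r m t).notify .insert w = procState x p r m t := by
  exact if_neg (show (w : ℕ) < x from h).le.not_gt

lemma notify_delete (x w : Fin n) (p r : Fin n → Prop) (m : Option ℕ) (t : ℕ) :
    (procState x p r m t).notify .delete w =
      procState x (fun y => p y ∧ y ≠ w) (fun y => r y ∧ y ≠ w)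
        (if m = some (w : ℕ) then none else m)
        (if m = some (w : ℕ) then (if x < w then 3 else 9) else 0) := by
  simp only [ProcState.notify, procState]
  rw [names_sdiff_singleton, names_sdiff_singleton]
  rfl

/-- The head `v` makes no record of the new arc, so the records still refer to `O`. This is correct:
if `u` is matched there is nothing to record, and if `u` is free it is about to reverse the arc. -/
lemma runs_wake_insert {u v : Fin n} (huv : u < v) :
    Runs (Network.wake (P := matchingProtocol) ⟨.insert, u, v⟩ (restStates O μ))
      (fun y x => (y, x) ∈ insert (u, v) O) (fun y x => (x, y) ∈ O ∧ μ x = none) μ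
      (fun x => if x = u ∧ μ u = none then 3 else 0) (fun _ _ => none) := by
  refine ⟨?_, ?_, ?_⟩
  · ext1 x
    simp only [Network.wake]
    split
    · rename_i hx
      subst hx
      refine (notify_insert_lt huv _ _ _ _).trans (procState_congr (fun y => ?_)
        (fun y => Iff.rfl) rfl (by simp))
      simp only [Finset.mem_insert, Prod.mk.injEq]
      tauto
    · rename_i hx
      split
      · rename_i hx'
        subst hx'
        refine (notify_insert_gt huv _ _ _ _).trans (procState_congr (fun y => ?_)
          (fun y => Iff.rfl) rfl (by simp [hx]))
        simp only [Finset.mem_insert, Prod.mk.injEq]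
        tauto
      · refine procState_congr (fun y => ?_) (fun y => Iff.rfl) rfl (by simp [hx])
        simp only [Finset.mem_insert, Prod.mk.injEq]
        tauto
  · simp only [Network.wake, mailbox_none]
  · intro x hx
    refine ⟨fun _ => rfl, if_neg ?_⟩
    rintro ⟨rfl, -⟩
    exact hx (Or.inl rfl)

/-- The timers after the deletion of an edge between `u` and `v`. -/
def deleteTimer (μ : Fin n → Option ℕ) (u v x : Fin n) : ℕ :=
  if μ u = some (v : ℕ) then (if x = u then 3 else if x = v then 9 else 0) else 0

/-- The partners after the deletion of an edge between `u` and `v`. -/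
def deleteMates (μ : Fin n → Option ℕ) (u v : Fin n) : Fin n → Option ℕ :=
  if μ u = some (v : ℕ) then clearMates μ u v else μ

lemma IsMateTable.symm (hμ : IsMateTable G μ) (u v : Fin n) :
    μ u = some (v : ℕ) ↔ μ v = some (u : ℕ) := by
  constructor <;>
  · intro h
    obtain ⟨w, h1, -, h3⟩ := hμ _ _ h
    rwa [← Fin.ext h1]

lemma rests_wake_delete {u v : Fin n} (huv : u < v) (hμ : IsMateTable G μ) :
    Rests (Network.wake (P := matchingProtocol) ⟨.delete, u, v⟩ (restStates O μ))
      (eraseEdge O u v) (deleteMates μ u v) (deleteTimer μ u v) := by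
  have hsymm := hμ.symm u v
  have key : ∀ y x, ((x, y) ∈ O ∧ μ x = none) ∧ ¬ (x = u ∧ y = v ∨ x = v ∧ y = u) ↔
      (x, y) ∈ eraseEdge O u v ∧ deleteMates μ u v x = none ∧ deleteTimer μ u v x = 0 := by
    intro y x
    rw [mem_eraseEdge]
    by_cases hm : μ u = some (v : ℕ)
    · have hm' := hsymm.1 hm
      simp only [deleteMates, deleteTimer, if_pos hm, clearMates]
      by_cases hxu : x = u
      · simp [hxu, hm]
      · by_cases hxv : x = v
        · simp [hxv, hm', huv.ne']
        · simp [hxu, hxv]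
    · simp only [deleteMates, deleteTimer, if_neg hm, and_true]
      tauto
  refine ⟨?_, ?_, ?_⟩
  · ext1 x
    simp only [Network.wake]
    split
    · rename_i hx
      subst hx
      refine (notify_delete _ _ _ _ _ _).trans (procState_congr (fun y => ?_)
        (fun y => ?_) ?_ ?_)
      · rw [mem_eraseEdge]
        have := huv.ne
        simp only [true_and]
        tauto
      · rw [← key]
        have := huv.ne
        tauto
      · rw [deleteMates]
        split <;> simp [clearMates, *]
      · simp [deleteTimer, huv]
    · rename_i hx
      split
      · rename_i hx'
        subst hx'
        refine (notify_delete _ _ _ _ _ _).trans (procState_congr (fun y => ?_)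
          (fun y => ?_) ?_ ?_)
        · rw [mem_eraseEdge]
          have := huv.ne
          simp only [true_and]
          tauto
        · rw [← key]
          have := huv.ne
          tauto
        · rw [deleteMates]
          split <;> simp_all [clearMates]
        · simp [deleteTimer, hsymm, huv.le.not_gt, hx]
      · rename_i hx'
        refine procState_congr (fun y => ?_) (fun y => ?_) ?_ ?_
        · rw [mem_eraseEdge]
          tauto
        · rw [← key]
          tauto
        · simp only [deleteMates]
          split <;> simp [clearMates, hx, hx']
        · simp [deleteTimer, hx, hx']
  · simp only [Network.wake, mailbox_none]
  · intro x hx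
    have hxu : x ≠ u := fun h => hx (Or.inl h)
    have hxv : x ≠ v := fun h => hx (Or.inr h)
    exact ⟨fun _ => rfl, by simp [deleteTimer, hxu, hxv]⟩

lemma Rests.iterate {c : Network matchingProtocol n} (h : Rests c O μ fun _ => 0) (k : ℕ) :
    Rests ((Network.round G)^[k] c) O μ fun _ => 0 := by
  induction k with
  | zero => exact h
  | succ k ih =>
    rw [Function.iterate_succ_apply']
    exact ih.round_idle fun _ => by omega

/-- What the twelve rounds after an update from a configuration `c` achieve in the network `G`,
when the orientation at the beginning is `O₁`. -/
structure Achieves (G : SimpleGraph (Fin n)) (c : Network matchingProtocol n)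
    (O₁ O' : Finset (Fin n × Fin n)) (μ' : Fin n → Option ℕ) (D : ℕ) : Prop where
  flips : ∃ k ≤ 6, Flips k D O₁ O'
  solution : IsSolution G O' μ'
  rests : Rests ((Network.round G)^[12] c) O' μ' fun _ => 0
  messages : ∑ k ∈ Finset.range 12, ((Network.round G)^[k + 1] c).messageCount ≤ 2 * D + 2
  small : ∀ k ≤ 12, SmallMessages ((Network.round G)^[k] c)

lemma achieves_of_rests {c : Network matchingProtocol n} (h : Rests c O μ fun _ => 0)
    (hs : IsSolution G O μ) : Achieves G c O O μ 0 where
  flips := ⟨0, by omega, Flips.refl _⟩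
  solution := hs
  rests := h.iterate 12
  messages := by
    rw [Finset.sum_eq_zero fun k _ => Runs.messageCount_eq_zero (h.iterate (k + 1))]
    omega
  small k _ := Runs.smallMessages_none (h.iterate k)

lemma sum_range_twelve (f : ℕ → ℕ) :
    ∑ k ∈ Finset.range 12, f k = ∑ k ∈ Finset.range 6, f k + ∑ k ∈ Finset.range 6, f (k + 6) := by
  rw [Finset.sum_range_add f 6 6]
  simp only [add_comm]

lemma sum_messages {c : Network matchingProtocol n} :
    ∑ k ∈ Finset.range 12, ((Network.round G)^[k + 1] c).messageCount =
    ∑ k ∈ Finset.range 6, ((Network.round G)^[k + 1] c).messageCount +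
    ∑ k ∈ Finset.range 6,
      ((Network.round G)^[k + 1] ((Network.round G)^[6] c)).messageCount := by
  rw [sum_range_twelve fun k => ((Network.round G)^[k + 1] c).messageCount]
  refine congrArg₂ _ rfl (Finset.sum_congr rfl fun k _ => ?_)
  rw [← Function.iterate_add_apply]

lemma small_of_six {c : Network matchingProtocol n}
    (h : ∀ k ≤ 6, SmallMessages ((Network.round G)^[k] c))
    (h' : ∀ k ≤ 6, SmallMessages ((Network.round G)^[k] ((Network.round G)^[6] c))) :
    ∀ k ≤ 12, SmallMessages ((Network.round G)^[k] c) := by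
  intro k hk
  by_cases hk6 : k ≤ 6
  · exact h k hk6
  · have := h' (k - 6) (by omega)
    rwa [← Function.iterate_add_apply, Nat.sub_add_cancel (by omega)] at this

lemma Achieves.of_six {c : Network matchingProtocol n} {O' : Finset (Fin n × Fin n)}
    {μ' : Fin n → Option ℕ} {D k : ℕ} (hk : k ≤ 6) (hf : Flips k D O O')
    (hs : IsSolution G O' μ') (hr : Rests ((Network.round G)^[6] c) O' μ' fun _ => 0)
    (hm : ∑ k ∈ Finset.range 6, ((Network.round G)^[k + 1] c).messageCount ≤ 2 * D + 1)
    (hsm : ∀ k ≤ 6, SmallMessages ((Network.round G)^[k] c)) : Achieves G c O O' μ' D where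
  flips := ⟨k, hk, hf⟩
  solution := hs
  rests := by
    have := hr.iterate (G := G) 6
    rwa [← Function.iterate_add_apply] at this
  messages := by
    rw [sum_messages]
    rw [Finset.sum_eq_zero (s := Finset.range 6) (f := fun k => ((Network.round G)^[k + 1]
      ((Network.round G)^[6] c)).messageCount)
      fun k _ => Runs.messageCount_eq_zero (hr.iterate (k + 1))]
    omega
  small := small_of_six hsm fun k _ => Runs.smallMessages_none (hr.iterate k)

lemma exists_achieves_insert {u v : Fin n} (huv : u < v) (hs : IsSolution G O μ)
    (hadj : ¬ G.Adj u v) :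
    ∃ O' μ' D, Achieves (Update.apply G ⟨.insert, u, v⟩)
      (Network.wake (P := matchingProtocol) ⟨.insert, u, v⟩ (restStates O μ))
      (insert (u, v) O) O' μ' D := by
  have h := runs_wake_insert (O := O) (μ := μ) huv
  have hO := hs.orientation.insert huv.ne hadj
  have hμ := hs.mates.mono (H := Update.apply G ⟨.insert, u, v⟩) fun x y hxy =>
    (Update.apply_insert_adj huv.ne).2 (Or.inl hxy)
  by_cases hu : μ u = none
  · obtain ⟨O', μ', D, k, hk, hf, h1, h2, h3, -, h4, h5, h6⟩ := h.rematch (y := u)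
      (fun w x hx => by
        simp only [Finset.mem_insert, Prod.mk.injEq]
        simp [hx]) (fun w hw => Finset.mem_insert_of_mem hw.1) hO hμ
      (hs.maximal.insert huv.ne) hu (by simp [hu]) (fun w hw => by simp [hw])
      (fun w hw => by simp [hw.ne'])
    refine ⟨O', μ', D, Achieves.of_six (by omega) hf ⟨h1, h2, by simpa using h3⟩ ?_ h5 h6⟩
    refine Runs.congr h4 ?_ ?_ (fun _ => rfl) ?_ (fun _ _ => rfl)
    · exact fun _ _ => Iff.rfl
    · intro w x
      by_cases hx : x = u <;> simp [hx, hu]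
    · intro x
      by_cases hx : x = u <;> simp [hx, hu]
  · refine ⟨_, μ, 0, achieves_of_rests ?_
      ⟨hO, hμ, hs.maximal.insert_of_matched huv.ne hu⟩⟩
    refine Runs.congr h (fun _ _ => Iff.rfl) ?_ (fun _ => rfl) ?_ (fun _ _ => rfl)
    · intro w x
      simp only [Finset.mem_insert, Prod.mk.injEq, and_true]
      constructor
      · exact fun h => ⟨Or.inr h.1, h.2⟩
      · rintro ⟨⟨rfl, -⟩ | h, h'⟩
        · exact absurd h' hu
        · exact ⟨h, h'⟩
    · simp [hu]

/-- Separated partners search one after the other. They are no longer adjacent, so the search of `u`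
can neither match `v` nor overlook it; after six rounds `v` is still free and its timer shows `9 - 6
= 3`. -/
lemma exists_achieves_delete {u v : Fin n} (huv : u < v) (hs : IsSolution G O μ) :
    ∃ O' μ' D, Achieves (Update.apply G ⟨.delete, u, v⟩)
      (Network.wake (P := matchingProtocol) ⟨.delete, u, v⟩ (restStates O μ))
      (eraseEdge O u v) O' μ' D := by
  have h := rests_wake_delete (O := O) huv hs.mates
  have hO := hs.orientation.eraseEdge u v
  by_cases hm : μ u = some (v : ℕ)
  · have hT : deleteTimer μ u v = fun x => if x = u then 3 else if x = v then 9 else 0 := by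
      ext1 x; rw [deleteTimer, if_pos hm]
    have hM : deleteMates μ u v = clearMates μ u v := if_pos hm
    rw [hT, hM] at h
    have hnadj : ¬ (Update.apply G ⟨.delete, u, v⟩).Adj u v := by
      rw [Update.apply_delete_adj]; simp
    have hμ := hs.mates.clearMates hm
    obtain ⟨O', μ', D, k, hk, hf, h1, h2, h3, h7, h4, h5, h6⟩ := h.rematch (y := u)
      (fun w x hx => Iff.rfl) (fun w hw => hw.1) hO hμ
      (hs.maximal.clearMates u v) (by simp [clearMates]) (by simp)
      (fun w hw => by by_cases hw' : w = v <;> simp [hw, hw', huv.ne'])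
      (fun w hw => by
        have : w ≠ v := by rintro rfl; exact hnadj hw
        simp [hw.ne', this])
    obtain ⟨O₂, μ₂, D₂, k₂, hk₂, hf₂, g1, g2, g3, -, g4, g5, g6⟩ := Runs.rematch h4 (y := v)
      (fun w x hx => Iff.rfl) (fun w hw => hw.1) h1 h2 h3
      (by rw [h7 v huv.ne' hnadj]; simp [clearMates]) (by simp [huv.ne'])
      (fun w hw => by by_cases hw' : w = u <;> simp [hw, hw'])
      (fun w hw => by by_cases hw' : w = u <;> simp [hw.ne', hw'])
    have hX : (({u, v} : Set (Fin n)) \ {u}) \ {v} = ∅ := by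
      ext x
      simp only [Set.mem_sdiff, Set.mem_insert_iff, Set.mem_singleton_iff, Set.mem_empty_iff_false,
        iff_false]
      tauto
    rw [hX] at g3
    refine ⟨O₂, μ₂, D + D₂, ⟨⟨k + k₂, by omega, hf.trans hf₂⟩, ⟨g1, g2, g3⟩, ?_, ?_,
      small_of_six h6 g6⟩⟩
    · rw [← Function.iterate_add_apply] at g4
      have hτ : ∀ x, (if x = u then 3 else if x = v then 9 else 0) - 6 - 6 = 0 := by
        intro x
        split
        · rfl
        · split <;> rfl
      refine Runs.congr g4 (fun _ _ => Iff.rfl) (fun w x => ?_) (fun _ => rfl) hτ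
        (fun _ _ => rfl)
      change _ ∧ _ ∧ (if x = u then 3 else if x = v then 9 else 0) - 6 - 6 = 0 ↔ _
      rw [hτ x]
    · rw [sum_messages]
      omega
  · have hT : deleteTimer μ u v = fun _ => 0 := by ext1 x; rw [deleteTimer, if_neg hm]
    have hM : deleteMates μ u v = μ := if_neg hm
    rw [hT, hM] at h
    exact ⟨_, μ, 0, achieves_of_rests h ⟨hO, hs.mates.delete hm, hs.maximal.delete u v⟩⟩

/-- The order of the endpoints is invisible to the network, so `u < v` may be assumed. -/
lemma wake_swap {n : ℕ} {P : Protocol} (k : Kind) {u v : Fin n} (huv : u ≠ v)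
    (q : Fin n → P.State) : Network.wake ⟨k, u, v⟩ q = Network.wake ⟨k, v, u⟩ q := by
  simp only [Network.wake, Network.mk.injEq, and_true]
  refine ⟨?_, Set.pair_comm u v⟩
  ext1 x
  by_cases h1 : x = u
  · have : x ≠ v := h1 ▸ huv
    rw [if_pos h1, if_neg this, if_pos h1]
  · rw [if_neg h1]
    split <;> simp_all

lemma card_insert_sdiff_le (O : Finset (Fin n × Fin n)) (a : Fin n × Fin n) :
    (insert a O \ O).card ≤ 1 := by
  refine (Finset.card_le_card (t := {a}) fun b hb => ?_).trans (by simp)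
  simp only [Finset.mem_sdiff, Finset.mem_insert] at hb
  simp only [Finset.mem_singleton]
  tauto

lemma card_eraseEdge_sdiff_le (O : Finset (Fin n × Fin n)) (u v : Fin n) :
    (eraseEdge O u v \ O).card ≤ 1 := by
  rw [eraseEdge, Finset.sdiff_eq_empty_iff_subset.2
    ((Finset.erase_subset _ _).trans (Finset.erase_subset _ _))]
  simp

lemma exists_achieves {e : Update n} (he : e.Valid G) (hs : IsSolution G O μ) :
    ∃ O₁ O' μ' D, (O₁ \ O).card ≤ 1 ∧ (∀ a ∈ O₁, (e.apply G).Adj a.1 a.2) ∧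
      Achieves (e.apply G) (Network.wake (P := matchingProtocol) e (restStates O μ))
        O₁ O' μ' D := by
  have hne := he.ne
  rcases e with ⟨_ | _, u, v⟩
  · rcases lt_or_gt_of_ne hne with huv | huv
    · obtain ⟨O', μ', D, h⟩ := exists_achieves_insert huv hs he.2
      exact ⟨_, O', μ', D, card_insert_sdiff_le _ _, fun a ha => (hs.orientation.insert hne he.2).adj ha, h⟩
    · have he' : ¬ G.Adj v u := fun h => he.2 h.symm
      have hG : Update.apply G ⟨.insert, u, v⟩ = Update.apply G ⟨.insert, v, u⟩ := by
        ext x y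
        rw [Update.apply_insert_adj hne, Update.apply_insert_adj hne.symm]
        tauto
      rw [wake_swap _ hne, hG]
      obtain ⟨O', μ', D, h⟩ := exists_achieves_insert huv hs he'
      exact ⟨_, O', μ', D, card_insert_sdiff_le _ _,
        fun a ha => (hs.orientation.insert hne.symm he').adj ha, h⟩
  · rcases lt_or_gt_of_ne hne with huv | huv
    · obtain ⟨O', μ', D, h⟩ := exists_achieves_delete huv hs
      exact ⟨_, O', μ', D, card_eraseEdge_sdiff_le _ _ _, fun a ha => (hs.orientation.eraseEdge u v).adj ha, h⟩
    · have hG : Update.apply G ⟨.delete, u, v⟩ = Update.apply G ⟨.delete, v, u⟩ := by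
        ext x y
        rw [Update.apply_delete_adj, Update.apply_delete_adj]
        tauto
      rw [wake_swap _ hne, hG]
      obtain ⟨O', μ', D, h⟩ := exists_achieves_delete huv hs
      exact ⟨_, O', μ', D, card_eraseEdge_sdiff_le _ _ _, fun a ha => (hs.orientation.eraseEdge v u).adj ha, h⟩

end DistributedUpdate

section DistributedMain

variable {n α : ℕ} {σ : List (Update n)}

lemma exists_restStates (h : ArboricityPreserving α σ) : ∀ i ≤ σ.length,
    ∃ O μ, matchingProtocol.statesAfter 12 σ i = restStates O μ ∧
      IsSolution (graphAt σ i) O μ ∧ (i = 0 → O = ∅) := by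
  intro i
  induction i with
  | zero =>
    refine fun _ => ⟨∅, fun _ => none, ?_, ⟨⟨?_, ?_, ?_⟩, ?_, ?_⟩, fun _ => rfl⟩
    · ext1 v
      simp only [Protocol.statesAfter, restStates, Finset.notMem_empty, false_and]
      change (⟨v, ∅, ∅, none, 0⟩ : ProcState) = _
      rw [procState, names_false]
    · simp
    · simp [graphAt_zero]
    · simp
    · intro v k hv
      cases hv
    · intro v w hvw
      simp [graphAt_zero] at hvw
  | succ i ih =>
    intro hi
    obtain ⟨O, μ, h1, h2, -⟩ := ih (by omega)
    obtain ⟨O₁, O', μ', D, -, -, h3⟩ := exists_achieves (h i hi).1 h2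
    refine ⟨O', μ', ?_, ?_, fun h => absurd h (by omega)⟩
    · rw [Protocol.statesAfter, dif_pos (by omega), h1, graphAt_succ σ hi, h3.rests.state]
      ext1 v
      exact procState_congr (fun _ => Iff.rfl) (fun _ => by simp) rfl rfl
    · rw [graphAt_succ σ hi]
      exact h3.solution

/-- The orientation and the partners can be read off from the states. Hence the data chosen
independently for each time fit together along the sequence. -/
lemma restStates_injective {O O' : Finset (Fin n × Fin n)} {μ μ' : Fin n → Option ℕ}
    (h : restStates O μ = restStates O' μ') : O = O' ∧ μ = μ' := by
  constructor
  · ext ⟨v, x⟩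
    have h1 : names (fun x => (v, x) ∈ O) = names fun x => (v, x) ∈ O' :=
      congrArg ProcState.out (congrFun h v)
    have h2 : (x : ℕ) ∈ names (fun x => (v, x) ∈ O) ↔ (x : ℕ) ∈ names fun x => (v, x) ∈ O' := by
      rw [h1]
    simpa using h2
  · ext1 v
    exact congrArg ProcState.mate (congrFun h v)

lemma Rests.finished {c : Network matchingProtocol n} {O : Finset (Fin n × Fin n)}
    {μ : Fin n → Option ℕ} (h : Rests c O μ fun _ => 0) : c.Finished := by
  refine ⟨fun w x => ?_, fun w _ => ?_⟩
  · rw [h.inbox]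
    exact congrFun mailbox_none x
  · rw [h.state]
    exact ProcState.step_idle rfl

lemma IsWord.of_le_three (hn : 0 < n) {a : ℕ} (ha : a ≤ 3) : IsWord 4 n a := by
  have h1 : 0 < Nat.size n := Nat.size_pos.2 hn
  have h2 : Nat.size a ≤ 2 := Nat.size_le.2 (by omega)
  rw [IsWord]
  omega

lemma matchingProtocol_correct (h : ArboricityPreserving α σ) :
    (∀ i (hi : i < σ.length), (matchingProtocol.config 12 σ i hi 12).Finished ∧
      ∀ k ≤ 12, ∀ w x a, (matchingProtocol.config 12 σ i hi k).inbox w x = some a →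
        IsWord 4 n a) ∧
    (∀ i ≤ σ.length, DescribesMaximalMatching (graphAt σ i)
      (fun v => matchingProtocol.mate (matchingProtocol.statesAfter 12 σ i v))) ∧
    (∑ i : Fin σ.length, ∑ k ∈ Finset.range 12,
        ((matchingProtocol.config 12 σ i i.isLt (k + 1)).messageCount : ℝ)) ≤
      (306 : ℕ) * (α + Real.sqrt (α * Real.log n)) * σ.length := by
  have hex := exists_restStates h
  choose! O μ h1 h2 h0 using hex
  have hstep : ∀ i, i < σ.length → ∃ D O₁, (O₁ \ O i).card ≤ 1 ∧
      (∀ a ∈ O₁, (graphAt σ (i + 1)).Adj a.1 a.2) ∧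
      ∀ hi : i < σ.length, Achieves (graphAt σ (i + 1)) (matchingProtocol.config 12 σ i hi 0) O₁
        (O (i + 1)) (μ (i + 1)) D := by
    intro i hi
    obtain ⟨O₁, O', μ', D, h3, h4, h5⟩ := exists_achieves (h i hi).1 (h2 i hi.le)
    rw [← graphAt_succ σ hi, ← h1 i hi.le] at h5
    rw [← graphAt_succ σ hi] at h4
    have h6 : restStates O' μ' = restStates (O (i + 1)) (μ (i + 1)) := by
      rw [← h1 (i + 1) hi, Protocol.statesAfter, dif_pos hi, h5.rests.state]
      ext1 v
      exact procState_congr (fun _ => Iff.rfl) (fun _ => by simp) rfl rfl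
    obtain ⟨rfl, rfl⟩ := restStates_injective h6
    exact ⟨D, O₁, h3, h4, fun _ => h5⟩
  choose! D O₁ h3 h4 h5 using hstep
  refine ⟨fun i hi => ⟨(h5 i hi hi).rests.finished, fun k hk w x a ha => ?_⟩, fun i hi => ?_, ?_⟩
  · exact IsWord.of_le_three (by have := w.2; omega) ((h5 i hi hi).small k hk w x a ha)
  · have := (h2 i hi).maximal.describes (h2 i hi).mates
    rwa [h1 i hi]
  · have hsum := h.sum_flips_le O D (h0 0 (by omega) rfl) fun i hi => by
      obtain ⟨k, hk, hf⟩ := (h5 i hi hi).flips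
      exact ⟨O₁ i, k, h3 i hi, h4 i hi, hk, hf⟩
    have hlen := h.length_le
    calc (∑ i : Fin σ.length, ∑ k ∈ Finset.range 12,
          ((matchingProtocol.config 12 σ i i.isLt (k + 1)).messageCount : ℝ))
        ≤ ∑ i : Fin σ.length, (2 * (D i : ℝ) + 2) := by
          refine Finset.sum_le_sum fun i _ => ?_
          have := (h5 i i.isLt i.isLt).messages
          exact_mod_cast this
      _ = ∑ i ∈ Finset.range σ.length, (2 * (D i : ℝ) + 2) :=
          Fin.sum_univ_eq_sum_range (fun i => 2 * (D i : ℝ) + 2) σ.length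
      _ = 2 * ∑ i ∈ Finset.range σ.length, (D i : ℝ) + 2 * σ.length := by
          rw [Finset.sum_add_distrib, ← Finset.mul_sum]
          simp [mul_comm]
      -- `306 = 2 * 152 + 2`, where the last summand is absorbed by
      -- `ArboricityPreserving.length_le`.
      _ ≤ (306 : ℕ) * (α + Real.sqrt (α * Real.log n)) * σ.length := by
          push_cast
          nlinarith

end DistributedMain

end DynMatching

namespace DynMatching

/-! ### Programs for the word RAM -/

section Ram

/-- The program `p`, started in `s`, halts after at most `T` steps in a state with the property
`Q`, touches only the vertices in `A`, and passes only through states with the property `Ok`. -/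
def Does (A : Set ℕ) (Ok : RamState → Prop) (p : Program) (s : RamState) (T : ℕ)
    (Q : RamState → Prop) : Prop :=
  ∃ t ≤ T, ∃ s', Exec A Ok p s t s' ∧ Q s'

variable {A : Set ℕ} {Ok : RamState → Prop} {p q : Program} {s : RamState} {T T₁ T₂ : ℕ}
  {Q Q₁ Q₂ : RamState → Prop}

lemma Does.mono (h : Does A Ok p s T₁ Q₁) (hT : T₁ ≤ T₂) (hQ : ∀ s', Q₁ s' → Q₂ s') :
    Does A Ok p s T₂ Q₂ := by
  obtain ⟨t, ht, s', h1, h2⟩ := h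
  exact ⟨t, ht.trans hT, s', h1, hQ s' h2⟩

lemma Does.skip (h : Q s) : Does A Ok .skip s 1 Q := ⟨1, le_rfl, s, .skip s, h⟩

lemma Does.seq (h : Does A Ok p s T₁ Q₁) (h' : ∀ s', Q₁ s' → Does A Ok q s' T₂ Q) :
    Does A Ok (.seq p q) s (T₁ + T₂) Q := by
  obtain ⟨t, ht, s', h1, h2⟩ := h
  obtain ⟨t', ht', s'', h3, h4⟩ := h' s' h2
  exact ⟨t + t', by omega, s'', .seq _ _ _ _ _ _ _ h1 h3, h4⟩

lemma Does.ite {b : Test} (h : b.Holds s → Does A Ok p s T Q)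
    (h' : ¬ b.Holds s → Does A Ok q s T Q) : Does A Ok (.ite b p q) s (T + 1) Q := by
  by_cases hb : b.Holds s
  · obtain ⟨t, ht, s', h1, h2⟩ := h hb
    exact ⟨t + 1, by omega, s', .ite_true _ _ _ _ _ _ hb h1, h2⟩
  · obtain ⟨t, ht, s', h1, h2⟩ := h' hb
    exact ⟨t + 1, by omega, s', .ite_false _ _ _ _ _ _ hb h1, h2⟩

lemma Does.while_false {b : Test} (hb : ¬ b.Holds s) (hQ : Q s) :
    Does A Ok (.while b p) s 1 Q := ⟨1, le_rfl, s, .while_false _ _ _ hb, hQ⟩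

lemma Does.while_true {b : Test} (hb : b.Holds s) (h : Does A Ok p s T₁ Q₁)
    (h' : ∀ s', Q₁ s' → Does A Ok (.while b p) s' T₂ Q) :
    Does A Ok (.while b p) s (T₁ + T₂ + 1) Q := by
  obtain ⟨t, ht, s', h1, h2⟩ := h
  obtain ⟨t', ht', s'', h3, h4⟩ := h' s' h2
  exact ⟨t + t' + 1, by omega, s'', .while_true _ _ _ _ _ _ _ hb h1 h3, h4⟩

lemma Exec.mono {Ok' : RamState → Prop} (hOk : ∀ s, Ok s → Ok' s) {t : ℕ} {s' : RamState}
    (h : Exec A Ok p s t s') : Exec A Ok' p s t s' := by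
  induction h with
  | skip s => exact .skip s
  | instr i s h1 h2 => exact .instr i s h1 (hOk _ h2)
  | seq p q s₁ s₂ s₃ t₁ t₂ _ _ h1 h2 => exact .seq _ _ _ _ _ _ _ h1 h2
  | ite_true b p q s s' t hb _ h => exact .ite_true _ _ _ _ _ _ hb h
  | ite_false b p q s s' t hb _ h => exact .ite_false _ _ _ _ _ _ hb h
  | while_true b p s₁ s₂ s₃ t₁ t₂ hb _ _ h1 h2 => exact .while_true _ _ _ _ _ _ _ hb h1 h2
  | while_false b p s hb => exact .while_false _ _ _ hb

/-- Numbers are bounded by `B`, and only the cells `i < len v` of the vertices `v` are used. -/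
structure Fits (B : ℕ) (len : ℕ → ℕ) (s : RamState) : Prop where
  reg : ∀ x, s.reg x ≤ B
  mem : ∀ v i, s.mem v i ≤ B
  support : ∀ v i, s.mem v i ≠ 0 → i < len v

/-- The memory after `a` has been written to the cell `i` of `v`. -/
def write (m : Memory) (v i a : ℕ) : Memory := Function.update m v (Function.update (m v) i a)

lemma write_apply (m : Memory) (v i a v' i' : ℕ) :
    write m v i a v' i' = if v' = v ∧ i' = i then a else m v' i' := by
  unfold write
  by_cases hv : v' = v
  · subst hv
    rw [Function.update_self]
    by_cases hi : i' = i
    · subst hi; simp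
    · simp [hi]
  · simp [hv]

/-- The condition under which an instruction respects the limits. -/
def Instr.Safe (A : Set ℕ) (B : ℕ) (len : ℕ → ℕ) : Instr → RamState → Prop
  | .const _ k, _ => k ≤ B
  | .add _ y z, s => s.reg y + s.reg z ≤ B
  | .sub _ _ _, _ => True
  | .load _ y _, s => s.reg y ∈ A
  | .store x y z, s => s.reg y ∈ A ∧ (s.reg x ≠ 0 → s.reg z < len (s.reg y))

/-- A sequence of instructions. -/
def block : List Instr → Program
  | [] => .skip
  | i :: l => .seq (.instr i) (block l)

/-- The effect of a sequence of instructions. -/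
def runAll : List Instr → RamState → RamState
  | [], s => s
  | i :: l, s => runAll l (i.run s)

/-- All instructions of the sequence respect the limits. -/
def SafeAll (A : Set ℕ) (B : ℕ) (len : ℕ → ℕ) : List Instr → RamState → Prop
  | [], _ => True
  | i :: l, s => i.Safe A B len s ∧ SafeAll A B len l (i.run s)

variable {B : ℕ} {len : ℕ → ℕ}

lemma Fits.setReg (h : Fits B len s) {x a : ℕ} (ha : a ≤ B) : Fits B len (s.setReg x a) where
  reg y := by
    simp only [RamState.setReg, Function.update_apply]
    split
    · exact ha
    · exact h.reg y
  mem := h.mem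
  support := h.support

lemma Fits.run (h : Fits B len s) {i : Instr} (hi : i.Safe A B len s) :
    Fits B len (i.run s) := by
  cases i with
  | const x k => exact h.setReg hi
  | add x y z => exact h.setReg hi
  | sub x y z => exact h.setReg ((Nat.sub_le _ _).trans (h.reg y))
  | load x y z => exact h.setReg (h.mem _ _)
  | store x y z =>
    refine ⟨h.reg, fun v i => ?_, fun v i hvi => ?_⟩
    · change write s.mem _ _ _ v i ≤ B
      rw [write_apply]
      split
      · exact h.reg x
      · exact h.mem v i
    · change write s.mem _ _ _ v i ≠ 0 at hvi
      rw [write_apply] at hvi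
      split at hvi
      · rename_i hv
        rw [hv.1, hv.2]
        exact hi.2 hvi
      · exact h.support v i hvi

lemma Instr.Safe.touches {i : Instr} (hi : i.Safe A B len s) : i.touches s ⊆ A := by
  cases i with
  | load x y z => exact Set.singleton_subset_iff.2 hi
  | store x y z => exact Set.singleton_subset_iff.2 hi.1
  | _ => exact Set.empty_subset _

/-- Straight-line code is verified by symbolic evaluation: unfolding `runAll` and `SafeAll` leaves
only arithmetic. The additional step is the final `skip`. -/
lemma Does.block {l : List Instr} (h : Fits B len s) (hl : SafeAll A B len l s) :
    Does A (Fits B len) (block l) s (l.length + 1) (fun s' => s' = runAll l s ∧ Fits B len s') := by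
  induction l generalizing s with
  | nil => exact Does.skip ⟨rfl, h⟩
  | cons i l ih =>
    have h1 := h.run hl.1
    have h2 := Does.seq (T₁ := 1) (Q₁ := fun s' => s' = i.run s)
      ⟨1, le_rfl, _, .instr i s hl.1.touches h1, rfl⟩ fun s' hs' => by
        subst hs'
        exact ih h1 hl.2
    refine h2.mono ?_ fun _ h => h
    rw [List.length_cons]
    omega

end Ram

end DynMatching

namespace DynMatching

/-! ### The data structure -/

section Data

/-- The cell `4 * j + c` of `v`. For `j = 0` it holds, depending on `c`, the partner, the number
of out-neighbors, and the number of free in-neighbors; for `1 ≤ j` the `j`-th out-neighbor, the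
position of `v` among its free in-neighbors, the `j`-th free in-neighbor, and the position of `v`
among its out-neighbors. -/
def cell (m : Memory) (c v j : ℕ) : ℕ := m v (4 * j + c)

/-- The memory after `a` has been written to the cell `4 * j + c` of `v`. -/
def put (m : Memory) (c v j a : ℕ) : Memory := write m v (4 * j + c) a

lemma cell_put (m : Memory) {c c' : ℕ} (hc : c < 4) (hc' : c' < 4) (v j a v' j' : ℕ) :
    cell (put m c v j a) c' v' j' = if c = c' ∧ v' = v ∧ j' = j then a else cell m c' v' j' := by
  rw [cell, cell, put, write_apply]
  refine if_congr ?_ rfl rfl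
  constructor
  · rintro ⟨h1, h2⟩; exact ⟨by omega, h1, by omega⟩
  · rintro ⟨h1, h2, h3⟩; exact ⟨h2, by omega⟩

/-- `y` is an out-neighbor of `x`. -/
def Arc (m : Memory) (x y : ℕ) : Prop :=
  ∃ j, 1 ≤ j ∧ j ≤ cell m 1 x 0 ∧ cell m 0 x j = y

/-- The memory is a valid data structure for an orientation of a subgraph of the graph in which
the vertex `v` has the set `N v` of neighbors. -/
structure Rep (N : ℕ → Finset ℕ) (m : Memory) : Prop where
  nb_mem : ∀ v j, 1 ≤ j → j ≤ cell m 1 v 0 → cell m 0 v j ∈ N v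
  nb_inj : ∀ v i j, 1 ≤ i → i ≤ cell m 1 v 0 → 1 ≤ j → j ≤ cell m 1 v 0 →
    cell m 0 v i = cell m 0 v j → i = j
  -- Cells beyond the ends of the lists are cleared; this is what yields linear space.
  out_zero : ∀ v j, cell m 1 v 0 < j → cell m 0 v j = 0 ∧ cell m 1 v j = 0
  in_zero : ∀ v j, cell m 2 v 0 < j → cell m 2 v j = 0 ∧ cell m 3 v j = 0
  -- An arc with a free tail and its entry in the list of the head point to each other. Arcs with a
  -- matched tail have no entry, which the pointer `0` indicates.
  ptr : ∀ v j, 1 ≤ j → j ≤ cell m 1 v 0 → cell m 0 v 0 = 0 →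
    1 ≤ cell m 1 v j ∧ cell m 1 v j ≤ cell m 2 (cell m 0 v j) 0 ∧
      cell m 2 (cell m 0 v j) (cell m 1 v j) = v ∧ cell m 3 (cell m 0 v j) (cell m 1 v j) = j
  ptr_zero : ∀ v j, 1 ≤ j → j ≤ cell m 1 v 0 → cell m 0 v 0 ≠ 0 → cell m 1 v j = 0
  in_ptr : ∀ v j, 1 ≤ j → j ≤ cell m 2 v 0 →
    1 ≤ cell m 3 v j ∧ cell m 3 v j ≤ cell m 1 (cell m 2 v j) 0 ∧
      cell m 0 (cell m 2 v j) (cell m 3 v j) = v ∧ cell m 1 (cell m 2 v j) (cell m 3 v j) = j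
  unused : ∀ v, cell m 3 v 0 = 0

/-- The memory after the arc from `x` to `y` has been added. -/
def push (m : Memory) (x y : ℕ) : Memory :=
  let k := cell m 1 x 0 + 1
  let f := cell m 2 y 0 + 1
  let m₁ := put (put m 1 x 0 k) 0 x k y
  if cell m 0 x 0 = 0 then
    put (put (put (put m₁ 2 y 0 f) 2 y f x) 3 y f k) 1 x k f
  else m₁

/-- The memory after the last arc from `x` has been removed. -/
def pop (m : Memory) (x : ℕ) : Memory :=
  let k := cell m 1 x 0
  let y := cell m 0 x k
  let p := cell m 1 x k
  let f := cell m 2 y 0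
  let m₁ :=
    if p = 0 then m
    else
      -- The last entry of the list of `y` moves into the hole at position `p`, and the arc it
      -- belongs to is redirected. Clearing position `f` only afterwards makes the case `p = f` come
      -- out right.
      put (put (put (put (put (put m 2 y p (cell m 2 y f)) 3 y p (cell m 3 y f)) 1 (cell m 2 y f)
        (cell m 3 y f) p) 2 y f 0) 3 y f 0) 2 y 0 (f - 1)
  put (put (put m₁ 0 x k 0) 1 x k 0) 1 x 0 (k - 1)

variable {N : ℕ → Finset ℕ} {m : Memory} {x y : ℕ}

lemma cell_push_zero (v j : ℕ) : cell (push m x y) 0 v j =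
    if v = x ∧ j = cell m 1 x 0 + 1 then y else cell m 0 v j := by
  unfold push
  simp only []
  split <;> simp [cell_put]

lemma cell_push_one (v j : ℕ) : cell (push m x y) 1 v j =
    if v = x ∧ j = cell m 1 x 0 + 1 ∧ cell m 0 x 0 = 0 then cell m 2 y 0 + 1
    else if v = x ∧ j = 0 then cell m 1 x 0 + 1 else cell m 1 v j := by
  unfold push
  simp only []
  split <;> simp [cell_put, *]

lemma cell_push_two (v j : ℕ) : cell (push m x y) 2 v j =
    if v = y ∧ j = cell m 2 y 0 + 1 ∧ cell m 0 x 0 = 0 then x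
    else if v = y ∧ j = 0 ∧ cell m 0 x 0 = 0 then cell m 2 y 0 + 1 else cell m 2 v j := by
  unfold push
  simp only []
  split <;> simp [cell_put, *]

lemma cell_push_three (v j : ℕ) : cell (push m x y) 3 v j =
    if v = y ∧ j = cell m 2 y 0 + 1 ∧ cell m 0 x 0 = 0 then cell m 1 x 0 + 1
    else cell m 3 v j := by
  unfold push
  simp only []
  split <;> simp [cell_put, *]

/-- All new entries lie beyond the ends of the old lists, so old pointers stay valid. -/
lemma Rep.push (h : Rep N m) (hy : y ∈ N x) (hnew : ¬ Arc m x y) :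
    Rep N (push m x y) := by
  refine ⟨?_, ?_, ?_, ?_, ?_, ?_, ?_, ?_⟩
  · intro v j
    have := h.nb_mem v j
    simp only [cell_push_zero, cell_push_one]
    grind
  · intro v i j
    have h1 : ∀ j, 1 ≤ j → j ≤ cell m 1 x 0 → cell m 0 x j ≠ y := fun j hj hj' hy =>
      hnew ⟨j, hj, hj', hy⟩
    have h2 := h.nb_inj v i j
    have h3 := h1 i
    have h4 := h1 j
    simp only [cell_push_zero, cell_push_one]
    grind
  · intro v j
    have := h.out_zero v j
    simp only [cell_push_zero, cell_push_one]
    grind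
  · intro v j
    have := h.in_zero v j
    simp only [cell_push_two, cell_push_three]
    grind
  · intro v j hj hj' hm
    have e1 : cell (DynMatching.push m x y) 1 v 0 =
        if v = x then cell m 1 x 0 + 1 else cell m 1 v 0 := by rw [cell_push_one]; grind
    have e2 : cell (DynMatching.push m x y) 0 v 0 = cell m 0 v 0 := by rw [cell_push_zero]; grind
    rw [e1] at hj'
    rw [e2] at hm
    by_cases hn : v = x ∧ j = cell m 1 x 0 + 1
    · obtain ⟨rfl, rfl⟩ := hn
      simp [cell_push_zero, cell_push_one, cell_push_two, cell_push_three, hm]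
    · have := h.ptr v j hj (by grind) hm
      simp only [cell_push_zero, cell_push_one, cell_push_two, cell_push_three]
      rw [if_neg hn, if_neg (by grind), if_neg (by omega)]
      grind
  · intro v j
    have := h.ptr_zero v j
    have := h.out_zero v j
    simp only [cell_push_zero, cell_push_one]
    grind
  · intro v j hj hj'
    have e2 : cell (DynMatching.push m x y) 2 v 0 =
        if v = y ∧ cell m 0 x 0 = 0 then cell m 2 y 0 + 1 else cell m 2 v 0 := by
      rw [cell_push_two]; grind
    rw [e2] at hj'
    by_cases hn : v = y ∧ j = cell m 2 y 0 + 1 ∧ cell m 0 x 0 = 0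
    · obtain ⟨rfl, rfl, hm⟩ := hn
      simp [cell_push_zero, cell_push_one, cell_push_two, cell_push_three, hm]
    · have := h.in_ptr v j hj (by grind)
      simp only [cell_push_zero, cell_push_one, cell_push_two, cell_push_three]
      rw [if_neg hn, if_neg (by grind), if_neg hn]
      grind
  · intro v
    have := h.unused v
    simp only [cell_push_three]
    grind

lemma arc_push {a b : ℕ} : Arc (DynMatching.push m x y) a b ↔ Arc m a b ∨ (a = x ∧ b = y) := by
  unfold Arc
  simp only [cell_push_zero, cell_push_one]
  constructor
  · rintro ⟨j, hj⟩
    by_cases h1 : a = x ∧ j = cell m 1 x 0 + 1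
    · grind
    · exact Or.inl ⟨j, by grind⟩
  · rintro (⟨j, hj⟩ | ⟨rfl, rfl⟩)
    · exact ⟨j, by grind⟩
    · exact ⟨cell m 1 a 0 + 1, by grind⟩

section Pop

variable {k p f z q : ℕ}

lemma cell_pop_zero (hk : k = cell m 1 x 0) (v j : ℕ) : cell (pop m x) 0 v j =
    if v = x ∧ j = k then 0 else cell m 0 v j := by
  subst hk
  unfold pop
  simp only []
  split <;> simp [cell_put]

lemma cell_pop_one (hk : k = cell m 1 x 0) (hy : y = cell m 0 x k) (hp : p = cell m 1 x k)
    (hf : f = cell m 2 y 0) (hz : z = cell m 2 y f) (hq : q = cell m 3 y f) (v j : ℕ) :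
    cell (pop m x) 1 v j =
      if v = x ∧ j = 0 then k - 1 else if v = x ∧ j = k then 0
      else if p ≠ 0 ∧ v = z ∧ j = q then p else cell m 1 v j := by
  subst hq hz hf hp hy hk
  unfold pop
  simp only []
  split <;> simp [cell_put, *]

lemma cell_pop_two (hk : k = cell m 1 x 0) (hy : y = cell m 0 x k) (hp : p = cell m 1 x k)
    (hf : f = cell m 2 y 0) (hz : z = cell m 2 y f) (v j : ℕ) :
    cell (pop m x) 2 v j =
      if p ≠ 0 ∧ v = y ∧ j = 0 then f - 1 else if p ≠ 0 ∧ v = y ∧ j = f then 0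
      else if p ≠ 0 ∧ v = y ∧ j = p then z else cell m 2 v j := by
  subst hz hf hp hy hk
  unfold pop
  simp only []
  split <;> simp [cell_put, *]

lemma cell_pop_three (hk : k = cell m 1 x 0) (hy : y = cell m 0 x k) (hp : p = cell m 1 x k)
    (hf : f = cell m 2 y 0) (hq : q = cell m 3 y f) (v j : ℕ) :
    cell (pop m x) 3 v j =
      if p ≠ 0 ∧ v = y ∧ j = f then 0
      else if p ≠ 0 ∧ v = y ∧ j = p then q else cell m 3 v j := by
  subst hq hf hp hy hk
  unfold pop
  simp only []
  split <;> simp [cell_put, *]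

/-- If the removed arc has an entry (`p ≠ 0`), the entry `(z, q)` moves from position `f` to `p` in
the list of `y`. The invariants on pointers are critical only for this entry and for the arc `q` of
`z`; mutual pointers distinguish them from all the others. -/
lemma Rep.pop (h : Rep N m) (hx : cell m 1 x 0 ≠ 0) : Rep N (pop m x) := by
  obtain ⟨k, hk⟩ : ∃ k, k = cell m 1 x 0 := ⟨_, rfl⟩
  obtain ⟨y, hy⟩ : ∃ y, y = cell m 0 x k := ⟨_, rfl⟩
  obtain ⟨p, hp⟩ : ∃ p, p = cell m 1 x k := ⟨_, rfl⟩
  obtain ⟨f, hf⟩ : ∃ f, f = cell m 2 y 0 := ⟨_, rfl⟩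
  obtain ⟨z, hz⟩ : ∃ z, z = cell m 2 y f := ⟨_, rfl⟩
  obtain ⟨q, hq⟩ : ∃ q, q = cell m 3 y f := ⟨_, rfl⟩
  have e0 := cell_pop_zero hk
  have e1 := cell_pop_one hk hy hp hf hz hq
  have e2 := cell_pop_two hk hy hp hf hz
  have e3 := cell_pop_three hk hy hp hf hq
  have f1 := h.ptr x k
  have f2 := h.ptr_zero x k
  have f3 := h.in_ptr y f
  rw [← hz, ← hq] at f3
  rw [← hy, ← hp, ← hf, ← hk] at f1
  rw [← hp, ← hk] at f2
  rw [← hk] at hx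
  have f4 : p ≠ 0 → 1 ≤ p ∧ p ≤ f ∧ cell m 2 y p = x ∧ cell m 3 y p = k ∧
      1 ≤ q ∧ q ≤ cell m 1 z 0 ∧ cell m 0 z q = y ∧ cell m 1 z q = f := by
    intro hp0
    have g0 : cell m 0 x 0 = 0 := by
      by_contra hne
      exact hp0 (f2 (by omega) le_rfl hne)
    obtain ⟨g1, g2, g3, g4⟩ := f1 (by omega) le_rfl g0
    obtain ⟨g5, g6, g7, g8⟩ := f3 (by omega) (by omega)
    exact ⟨g1, g2, g3, g4, g5, g6, g7, g8⟩
  clear f1 f2 f3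
  refine ⟨?_, ?_, ?_, ?_, ?_, ?_, ?_, ?_⟩
  · intro v j
    have := h.nb_mem v j
    simp only [e0, e1]
    clear e0 e1 e2 e3 h
    grind
  · intro v i j
    have h2 := h.nb_inj v i j
    simp only [e0, e1]
    clear e0 e1 e2 e3 h
    grind
  · intro v j
    have := h.out_zero v j
    simp only [e0, e1]
    clear e0 e1 e2 e3 h
    grind
  · intro v j
    have := h.in_zero v j
    simp only [e2, e3]
    clear e0 e1 e2 e3 h
    grind
  · intro v j hj hj' hm
    rw [e1] at hj'
    rw [e0, if_neg (by omega)] at hm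
    have hjv : j ≤ cell m 1 v 0 := by clear e0 e1 e2 e3 h; grind
    have hne : ¬ (v = x ∧ j = k) := by clear e0 e1 e2 e3 h; grind
    obtain ⟨g1, g2, g3, g4⟩ := h.ptr v j hj hjv hm
    simp only [e0, e1, e2, e3]
    rw [if_neg hne, if_neg (by omega), if_neg hne]
    clear e0 e1 e2 e3 h
    generalize hY : cell m 0 v j = Y at *
    generalize hP : cell m 1 v j = P at *
    by_cases hp0 : p = 0
    · simp [hp0, g1, g2, g3, g4]
    · obtain ⟨a1, a2, a3, a4, a5, a6, a7, a8⟩ := f4 hp0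
      simp only [hp0, ne_eq, not_false_eq_true, true_and]
      by_cases hzq : v = z ∧ j = q
      · obtain ⟨rfl, rfl⟩ := hzq
        rw [if_pos ⟨rfl, rfl⟩]
        have hYy : Y = y := by omega
        subst hYy
        grind
      · rw [if_neg hzq]
        by_cases hYy : Y = y
        · subst hYy
          grind
        · grind
  · intro v j
    have := h.ptr_zero v j
    have := h.ptr v j
    simp only [e0, e1]
    clear e0 e1 e2 e3 h
    grind
  · intro v j hj hj'
    rw [e2] at hj'
    have hjv : j ≤ cell m 2 v 0 := by clear e0 e1 e2 e3 h; grind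
    obtain ⟨g1, g2, g3, g4⟩ := h.in_ptr v j hj hjv
    have hjf : ¬ (p ≠ 0 ∧ v = y ∧ j = f) := by clear e0 e1 e2 e3 h; grind
    simp only [e2, e3]
    have hj0 : ¬ (p ≠ 0 ∧ v = y ∧ j = 0) := by omega
    rw [if_neg hjf, if_neg hjf, if_neg hj0]
    simp only [e0, e1]
    clear e0 e1 e2 e3 h
    generalize hX : cell m 2 v j = X at *
    generalize hQ : cell m 3 v j = Q at *
    by_cases hp0 : p = 0
    · have : ¬ (X = x ∧ Q = k) := by rintro ⟨rfl, rfl⟩; omega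
      simp only [hp0, ne_eq, not_true_eq_false, false_and, if_false]
      grind
    · obtain ⟨a1, a2, a3, a4, a5, a6, a7, a8⟩ := f4 hp0
      simp only [hp0, ne_eq, not_false_eq_true, true_and]
      by_cases hvp : v = y ∧ j = p
      · rw [if_pos hvp, if_pos hvp]
        obtain ⟨rfl, rfl⟩ := hvp
        have : ¬ (z = x ∧ q = k) := by rintro ⟨rfl, rfl⟩; omega
        grind
      · rw [if_neg hvp, if_neg hvp]
        have : ¬ (X = x ∧ Q = k) := by rintro ⟨rfl, rfl⟩; omega
        have : ¬ (X = z ∧ Q = q) := by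
          rintro ⟨rfl, rfl⟩
          simp only [hp0, ne_eq, not_false_eq_true, true_and] at hjf
          omega
        grind
  · intro v
    have := h.unused v
    simp only [e3]
    clear e0 e1 e2 e3 h
    grind

lemma arc_pop (h : Rep N m) (hx : cell m 1 x 0 ≠ 0) {a b : ℕ} :
    Arc (DynMatching.pop m x) a b ↔
      Arc m a b ∧ ¬ (a = x ∧ b = cell m 0 x (cell m 1 x 0)) := by
  obtain ⟨k, hk⟩ : ∃ k, k = cell m 1 x 0 := ⟨_, rfl⟩
  have e0 := cell_pop_zero hk
  have e1 : cell (DynMatching.pop m x) 1 a 0 = if a = x then k - 1 else cell m 1 a 0 := by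
    by_cases hp : cell m 1 x k = 0
    · rw [cell_pop_one hk rfl rfl rfl rfl rfl]
      grind
    · have h1 := h.ptr_zero x k
      have h2 := h.ptr x k
      -- The redirected pointer has a positive index and therefore does not overwrite an outdegree,
      -- which is stored at index `0`.
      have h3 := (h.in_ptr (cell m 0 x k) (cell m 2 (cell m 0 x k) 0) (by omega) le_rfl).1
      rw [cell_pop_one hk rfl rfl rfl rfl rfl]
      grind
  unfold Arc
  rw [← hk, e1]
  simp only [e0]
  constructor
  · rintro ⟨j, hj1, hj2, hj3⟩
    have h2 := h.nb_inj x j k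
    refine ⟨⟨j, by grind⟩, ?_⟩
    grind
  · rintro ⟨⟨j, hj1, hj2, rfl⟩, hne⟩
    exact ⟨j, by grind⟩

end Pop

end Data

end DynMatching

namespace DynMatching

/-! ### Programs that add or remove one arc -/

section Fragments

/-- The properties of the sets `N v` of the neighbors of the vertices `v < n` of a graph. -/
structure IsNeighborhood (n : ℕ) (N : ℕ → Finset ℕ) : Prop where
  symm : ∀ {a b}, b ∈ N a → a ∈ N b
  lt : ∀ {a b}, b ∈ N a → b < n
  ne : ∀ {a b}, b ∈ N a → a ≠ b

variable {n : ℕ} {N : ℕ → Finset ℕ} {m : Memory} {x y : ℕ} {A : Set ℕ} {s : RamState}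

lemma IsNeighborhood.card_le (hN : IsNeighborhood n N) (v : ℕ) : (N v).card ≤ n := by
  have := Finset.card_le_card (show N v ⊆ Finset.range n from fun b hb =>
    Finset.mem_range.2 (hN.lt hb))
  simpa using this

lemma Rep.outdeg_le (h : Rep N m) (v : ℕ) : cell m 1 v 0 ≤ (N v).card := by
  have := Finset.card_le_card_of_injOn (s := Finset.Icc 1 (cell m 1 v 0)) (t := N v)
    (fun j => cell m 0 v j) (fun j hj => by
      rw [Finset.mem_coe, Finset.mem_Icc] at hj
      exact h.nb_mem v j hj.1 hj.2) (fun i hi j hj hij => by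
      rw [Finset.mem_coe, Finset.mem_Icc] at hi hj
      exact h.nb_inj v i j hi.1 hi.2 hj.1 hj.2 hij)
  simpa using this

lemma Rep.in_mem (h : Rep N m) (hN : IsNeighborhood n N) (v j : ℕ) (hj : 1 ≤ j)
    (hj' : j ≤ cell m 2 v 0) : cell m 2 v j ∈ N v := by
  obtain ⟨h1, h2, h3, -⟩ := h.in_ptr v j hj hj'
  have := h.nb_mem _ _ h1 h2
  rw [h3] at this
  exact hN.symm this

lemma Rep.indeg_le (h : Rep N m) (hN : IsNeighborhood n N) (v : ℕ) :
    cell m 2 v 0 ≤ (N v).card := by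
  have := Finset.card_le_card_of_injOn (s := Finset.Icc 1 (cell m 2 v 0)) (t := N v)
    (fun j => cell m 2 v j) (fun j hj => by
      rw [Finset.mem_coe, Finset.mem_Icc] at hj
      exact h.in_mem hN v j hj.1 hj.2) (fun i hi j hj hij => by
      rw [Finset.mem_coe, Finset.mem_Icc] at hi hj
      obtain ⟨a1, a2, a3, a4⟩ := h.in_ptr v i hi.1 hi.2
      obtain ⟨b1, b2, b3, b4⟩ := h.in_ptr v j hj.1 hj.2
      simp only at hij
      rw [hij] at a2 a3 a4
      have := h.nb_inj _ _ _ a1 a2 b1 b2 (a3.trans b3.symm)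
      exact a4.symm.trans ((congrArg _ this).trans b4))
  simpa using this

/-- The number of cells reserved for the vertex `v`. -/
def len (n : ℕ) (N : ℕ → Finset ℕ) (v : ℕ) : ℕ := if v < n then 4 * (N v).card + 4 else 0

lemma len_eq (hx : x < n) : len n N x = 4 * (N x).card + 4 := if_pos hx

/-- The limits while the graph has the sets `N v` of neighbors. -/
def Ok (n : ℕ) (N : ℕ → Finset ℕ) : RamState → Prop := Fits (4 * n + 7) (len n N)

/-- The registers that hold the update and the arguments of the procedures. -/
def SameArgs (s s' : RamState) : Prop :=
  s'.reg 0 = s.reg 0 ∧ s'.reg 1 = s.reg 1 ∧ s'.reg 2 = s.reg 2 ∧ s'.reg 13 = s.reg 13 ∧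
    s'.reg 14 = s.reg 14 ∧ s'.reg 15 = s.reg 15

/-- Add the arc from register `3` to register `4`. -/
def pushProgram : Program :=
  .seq (block [.const 5 0, .const 6 1, .const 7 2, .load 8 3 5, .load 9 3 6, .load 10 4 7,
    .add 9 9 6, .add 10 10 6, .store 9 3 6, .add 11 9 9, .add 11 11 11, .store 4 3 11])
  (.ite (.eq 8 5) (block [.store 10 4 7, .add 12 10 10, .add 12 12 12, .add 12 12 7,
    .store 3 4 12, .add 12 12 6, .store 9 4 12, .add 11 11 6, .store 10 3 11]) .skip)

/-- Remove the last arc from register `13`; its head is put into register `3`. -/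
def popProgram : Program :=
  .seq (block [.const 5 0, .const 6 1, .const 7 2, .load 8 13 6, .add 9 8 8, .add 9 9 9,
    .load 3 13 9, .add 10 9 6, .load 10 13 10])
  (.seq (.ite (.eq 10 5) .skip (block [.load 11 3 7, .add 12 11 11, .add 12 12 12, .add 12 12 7,
    .load 4 3 12, .add 16 12 6, .load 17 3 16, .add 18 10 10, .add 18 18 18, .add 18 18 7,
    .store 4 3 18, .add 18 18 6, .store 17 3 18, .add 19 17 17, .add 19 19 19, .add 19 19 6,
    .store 10 4 19, .store 5 3 12, .store 5 3 16, .sub 11 11 6, .store 11 3 7]))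
  (block [.store 5 13 9, .add 9 9 6, .store 5 13 9, .sub 8 8 6, .store 8 13 6]))

lemma four_mul (k : ℕ) : k + k + (k + k) = 4 * k := by ring

lemma pushProgram_spec (hN : IsNeighborhood n N) (hs : Ok n N s) (hx : s.reg 3 = x)
    (hy : s.reg 4 = y) (hm : s.mem = m) (hxA : x ∈ A) (hyA : y ∈ A) (h : Rep N m)
    (hxy : y ∈ N x) (hnew : ¬ Arc m x y) :
    Does A (Ok n N) pushProgram s 24 fun s' => Ok n N s' ∧ s'.mem = push m x y ∧
      Rep N (push m x y) ∧ SameArgs s s' := by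
  have hrep := h.push hxy hnew
  have hk := hrep.outdeg_le x
  have hf := hrep.indeg_le hN y
  have hcx := hN.card_le x
  have hcy := hN.card_le y
  have hne := hN.ne hxy
  have hlx : len n N x = _ := len_eq (hN.lt (hN.symm hxy))
  have hly : len n N y = _ := len_eq (hN.lt hxy)
  have hy0 := h.indeg_le hN y
  rw [cell_push_one] at hk
  rw [cell_push_two] at hf
  have hk : cell m 1 x 0 + 1 ≤ (N x).card := by grind
  have hf : cell m 0 x 0 = 0 → cell m 2 y 0 + 1 ≤ (N y).card := by grind
  have c0 : m x 0 = cell m 0 x 0 := rfl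
  have c1 : m x 1 = cell m 1 x 0 := rfl
  have c2 : m y 2 = cell m 2 y 0 := rfl
  unfold pushProgram
  refine Does.mono (T₁ := 13 + (10 + 1)) (Does.seq (Q₁ := fun s' => Ok n N s' ∧
    s'.mem = put (put m 1 x 0 (cell m 1 x 0 + 1)) 0 x (cell m 1 x 0 + 1) y ∧
    s'.reg 3 = x ∧ s'.reg 4 = y ∧ s'.reg 5 = 0 ∧ s'.reg 6 = 1 ∧ s'.reg 7 = 2 ∧
    s'.reg 8 = cell m 0 x 0 ∧ s'.reg 9 = cell m 1 x 0 + 1 ∧ s'.reg 10 = cell m 2 y 0 + 1 ∧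
    s'.reg 11 = 4 * (cell m 1 x 0 + 1) ∧ SameArgs s s')
    ((Does.block hs ?_).mono le_rfl ?_) ?_) (by norm_num) fun _ h => h
  · simp [SafeAll, Instr.Safe, Instr.run, RamState.setReg, hx, hy, hm, hxA, hyA, c0, c1, c2, hlx,
      four_mul]
    omega
  · rintro s' ⟨rfl, hfit⟩
    refine ⟨hfit, ?_⟩
    simp [runAll, Instr.run, RamState.setReg, hx, hy, hm, c0, c1, c2, four_mul, SameArgs, put,
      write]
  · rintro s' ⟨hs', hm', h3, h4, h5, h6, h7, h8, h9, h10, h11, hargs⟩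
    refine Does.ite (fun hb => ?_) (fun hb => ?_)
    · have hfree : cell m 0 x 0 = 0 := by
        rw [← h8, ← h5]; exact hb
      have hf := hf hfree
      refine (Does.block hs' ?_).mono le_rfl ?_
      · simp [SafeAll, Instr.Safe, Instr.run, RamState.setReg, h3, h4, h6, h7, h9, h10, h11, hm',
          hxA, hyA, four_mul, hlx, hly]
        omega
      · rintro s'' ⟨rfl, hfit⟩
        refine ⟨hfit, ?_, hrep, ?_⟩
        · simp [push, hfree, runAll, Instr.run, RamState.setReg, h3, h4, h6, h7, h9, h10, h11,
            hm', four_mul, put, write]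
        · simpa [runAll, Instr.run, RamState.setReg, SameArgs] using hargs
    · have hmatched : ¬ cell m 0 x 0 = 0 := by
        rw [← h8, ← h5]; exact hb
      refine (Does.skip ?_).mono (by norm_num) fun _ h => h
      exact ⟨hs', by rw [hm', push, if_neg hmatched], hrep, hargs⟩

/-- The vertices touched are the tail, the head `y`, and the tail of the moved entry in the list of
`y`. The latter is a neighbor of `y`, so the program reaches distance two. -/
lemma popProgram_spec (hN : IsNeighborhood n N) (hs : Ok n N s) (hx : s.reg 13 = x)
    (hm : s.mem = m) (h : Rep N m) (hpos : cell m 1 x 0 ≠ 0) (hxA : x ∈ A)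
    (hA : ∀ y ∈ N x, y ∈ A ∧ ∀ z ∈ N y, z ∈ A) :
    Does A (Ok n N) popProgram s 39 fun s' => Ok n N s' ∧ s'.mem = pop m x ∧
      s'.reg 3 = cell m 0 x (cell m 1 x 0) ∧ SameArgs s s' := by
  obtain ⟨k, hk⟩ : ∃ k, k = cell m 1 x 0 := ⟨_, rfl⟩
  obtain ⟨y, hy⟩ : ∃ y, y = cell m 0 x k := ⟨_, rfl⟩
  obtain ⟨p, hp⟩ : ∃ p, p = cell m 1 x k := ⟨_, rfl⟩
  obtain ⟨f, hf⟩ : ∃ f, f = cell m 2 y 0 := ⟨_, rfl⟩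
  obtain ⟨z, hz⟩ : ∃ z, z = cell m 2 y f := ⟨_, rfl⟩
  obtain ⟨q, hq⟩ : ∃ q, q = cell m 3 y f := ⟨_, rfl⟩
  rw [← hk] at hpos
  have hxy : y ∈ N x := hy ▸ h.nb_mem x k (by omega) hk.le
  have hkx := h.outdeg_le x
  have hfy := h.indeg_le hN y
  have hcx := hN.card_le x
  have hcy := hN.card_le y
  rw [← hk] at hkx
  rw [← hf] at hfy
  have hptr : p ≠ 0 → p ≤ f ∧ z ∈ N y ∧ q ≤ (N z).card := by
    intro hp0
    have g0 : cell m 0 x 0 = 0 := by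
      by_contra hne
      exact hp0 (hp.trans (h.ptr_zero x k (by omega) hk.le hne))
    obtain ⟨g1, g2, -, -⟩ := h.ptr x k (by omega) hk.le g0
    rw [← hy, ← hp, ← hf] at g2
    rw [← hp] at g1
    obtain ⟨-, g6, -, -⟩ := h.in_ptr y f (by omega) hf.le
    rw [← hz, ← hq] at g6
    exact ⟨g2, hz ▸ h.in_mem hN y f (by omega) hf.le, g6.trans (h.outdeg_le z)⟩
  have hpn : p ≤ n := by
    by_cases hp0 : p = 0
    · omega
    · have := hptr hp0
      omega
  have hyA := (hA y hxy).1
  have hlx : len n N x = _ := len_eq (hN.lt (hN.symm hxy))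
  have hly : len n N y = _ := len_eq (hN.lt hxy)
  have c1 : m x 1 = k := hk.symm
  have c2 : m x (4 * k) = y := hy.symm
  have c3 : m x (4 * k + 1) = p := hp.symm
  have c4 : m y 2 = f := hf.symm
  have c5 : m y (4 * f + 2) = z := hz.symm
  have c6 : m y (4 * f + 3) = q := hq.symm
  unfold popProgram
  refine Does.mono (T₁ := 10 + ((22 + 1) + 6)) (Does.seq (Q₁ := fun s' => Ok n N s' ∧
    s'.mem = m ∧ s'.reg 3 = y ∧ s'.reg 5 = 0 ∧ s'.reg 6 = 1 ∧ s'.reg 7 = 2 ∧ s'.reg 8 = k ∧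
    s'.reg 9 = 4 * k ∧ s'.reg 10 = p ∧ s'.reg 13 = x ∧ SameArgs s s')
    ((Does.block hs ?_).mono le_rfl ?_) ?_) (by norm_num) fun _ h => h
  · simp [SafeAll, Instr.Safe, Instr.run, RamState.setReg, hx, hm, hxA, c1, four_mul]
    omega
  · rintro s' ⟨rfl, hfit⟩
    refine ⟨hfit, ?_⟩
    simp [runAll, Instr.run, RamState.setReg, hx, hm, c1, c2, c3, four_mul, SameArgs]
  rintro s₁ ⟨hs₁, hm₁, h3, h5, h6, h7, h8, h9, h10, h13, hargs⟩
  refine Does.seq (Q₁ := fun s' => Ok n N s' ∧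
    s'.mem = (if p = 0 then m else put (put (put (put (put (put m 2 y p z) 3 y p q) 1 z q p)
      2 y f 0) 3 y f 0) 2 y 0 (f - 1)) ∧ s'.reg 3 = y ∧ s'.reg 5 = 0 ∧ s'.reg 6 = 1 ∧
    s'.reg 8 = k ∧ s'.reg 9 = 4 * k ∧ s'.reg 13 = x ∧ SameArgs s s')
    (Does.ite (fun hb => ?_) (fun hb => ?_)) ?_
  · have hp0 : p = 0 := by rw [← h10, ← h5]; exact hb
    refine (Does.skip ?_).mono (by norm_num) fun _ h => h
    exact ⟨hs₁, by rw [if_pos hp0, hm₁], h3, h5, h6, h8, h9, h13, hargs⟩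
  · have hp0 : p ≠ 0 := by rw [← h10, ← h5]; exact hb
    obtain ⟨hpf, hzy, hqz⟩ := hptr hp0
    have hzA := (hA y hxy).2 z hzy
    have hlz : len n N z = _ := len_eq (hN.lt hzy)
    have hcz := hN.card_le z
    refine (Does.block hs₁ ?_).mono le_rfl ?_
    · simp [SafeAll, Instr.Safe, Instr.run, RamState.setReg, h3, h5, h6, h7, h10, hm₁, c4, c5,
        c6, hyA, hzA, four_mul, hly, hlz]
      omega
    · rintro s' ⟨rfl, hfit⟩
      refine ⟨hfit, ?_⟩
      rw [if_neg hp0]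
      simp [runAll, Instr.run, RamState.setReg, h3, h5, h6, h7, h8, h9, h10, h13, hm₁, c4, c5, c6,
        four_mul, put, write]
      simpa [SameArgs] using hargs
  · rintro s₂ ⟨hs₂, hm₂, h3, h5, h6, h8, h9, h13, hargs⟩
    refine (Does.block hs₂ ?_).mono le_rfl ?_
    · simp [SafeAll, Instr.Safe, Instr.run, RamState.setReg, h5, h6, h8, h9, h13, hxA, hlx]
      omega
    · rintro s' ⟨rfl, hfit⟩
      refine ⟨hfit, ?_, ?_, ?_⟩
      · simp only [pop, ← hk, ← hy, ← hp, ← hf, ← hz, ← hq, ← hm₂]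
        simp [runAll, Instr.run, RamState.setReg, h5, h6, h8, h9, h13, put, write]
      · rw [← hk, ← hy]
        simp [runAll, Instr.run, RamState.setReg, h3]
      · simpa [runAll, Instr.run, RamState.setReg, SameArgs] using hargs

end Fragments

end DynMatching

namespace DynMatching

/-! ### The program that resets a vertex -/

section Procedures

variable {n : ℕ} {N : ℕ → Finset ℕ} {m : Memory} {w y z : ℕ} {A : Set ℕ} {s : RamState}

/-- No edge is oriented in both directions. -/
def Asymm (m : Memory) : Prop := ∀ a b, Arc m a b → ¬ Arc m b a

/-- The arcs of `m'` are those of `m` after all arcs from `w` have been reversed, except that the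
arc to `z`, if there is one, has been removed. -/
structure IsReset (N : ℕ → Finset ℕ) (w z : ℕ) (m m' : Memory) : Prop where
  rep : Rep N m'
  mate : ∀ v, cell m' 0 v 0 = cell m 0 v 0
  arc : ∀ a b, Arc m' a b ↔ (Arc m a b ∧ a ≠ w) ∨ (b = w ∧ Arc m w a ∧ a ≠ z)

lemma SameArgs.trans {s₁ s₂ s₃ : RamState} (h : SameArgs s₁ s₂) (h' : SameArgs s₂ s₃) :
    SameArgs s₁ s₃ := by
  obtain ⟨h0, h1, h2, h3, h4, h5⟩ := h
  obtain ⟨g0, g1, g2, g3, g4, g5⟩ := h'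
  exact ⟨g0.trans h0, g1.trans h1, g2.trans h2, g3.trans h3, g4.trans h4, g5.trans h5⟩

lemma SameArgs.refl (s : RamState) : SameArgs s s := ⟨rfl, rfl, rfl, rfl, rfl, rfl⟩

/-- Put the number of out-neighbors of register `13` into register `7`. -/
def outdegProgram : Program := block [.const 5 0, .const 6 1, .load 7 13 6]

/-- Reverse the last arc from register `13`, or remove it if its head is register `14`. -/
def reverseProgram : Program :=
  .seq popProgram (.seq (.ite (.eq 3 14) .skip (.seq (block [.const 5 0, .add 4 13 5]) pushProgram))
    outdegProgram)

/-- Reverse all arcs from register `13`, but remove the one to register `14`. -/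
def resetProgram : Program := .seq outdegProgram (.while (.lt 5 7) reverseProgram)

lemma outdegProgram_spec (hs : Ok n N s) (hw : s.reg 13 = w) (hwA : w ∈ A) :
    Does A (Ok n N) outdegProgram s 4 fun s' => Ok n N s' ∧ s'.mem = s.mem ∧ s'.reg 5 = 0 ∧
      s'.reg 7 = cell s.mem 1 w 0 ∧ SameArgs s s' := by
  have c1 : s.mem w 1 = cell s.mem 1 w 0 := rfl
  refine (Does.block hs ?_).mono le_rfl ?_
  · simp [SafeAll, Instr.Safe, Instr.run, RamState.setReg, hw, hwA]
  · rintro s' ⟨rfl, hfit⟩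
    refine ⟨hfit, ?_⟩
    simp [runAll, Instr.run, RamState.setReg, hw, c1, SameArgs]

lemma outdeg_pop (m : Memory) (w : ℕ) : cell (pop m w) 1 w 0 = cell m 1 w 0 - 1 := by
  rw [cell_pop_one rfl rfl rfl rfl rfl rfl]
  simp

/-- Asymmetry guarantees that the reversed arc is not yet present, as `pushProgram_spec` requires.
-/
lemma reverseProgram_spec (hN : IsNeighborhood n N) (hs : Ok n N s) (hw : s.reg 13 = w)
    (hz : s.reg 14 = z) (h : Rep N s.mem) (hasymm : Asymm s.mem)
    (hpos : cell s.mem 1 w 0 ≠ 0) (hwA : w ∈ A) (hA : ∀ y ∈ N w, y ∈ A ∧ ∀ z ∈ N y, z ∈ A) :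
    Does A (Ok n N) reverseProgram s 71 fun s' => Ok n N s' ∧ Rep N s'.mem ∧ Asymm s'.mem ∧
      (∀ v, cell s'.mem 0 v 0 = cell s.mem 0 v 0) ∧
      (∃ y ≠ w, Arc s.mem w y ∧ ∀ a b, Arc s'.mem a b ↔
        (Arc s.mem a b ∧ ¬ (a = w ∧ b = y)) ∨ (y ≠ z ∧ a = y ∧ b = w)) ∧
      cell s'.mem 1 w 0 + 1 = cell s.mem 1 w 0 ∧ s'.reg 5 = 0 ∧
      s'.reg 7 = cell s'.mem 1 w 0 ∧ SameArgs s s' := by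
  obtain ⟨y, hy⟩ : ∃ y, y = cell s.mem 0 w (cell s.mem 1 w 0) := ⟨_, rfl⟩
  have hyw : y ∈ N w := hy ▸ h.nb_mem w _ (by omega) le_rfl
  have harc : Arc s.mem w y := ⟨_, by omega, le_rfl, hy.symm⟩
  have hne := hN.ne hyw
  have h1 := h.pop hpos
  have hout := outdeg_pop s.mem w
  have harc1 : ∀ a b, Arc (pop s.mem w) a b ↔ Arc s.mem a b ∧ ¬ (a = w ∧ b = y) := fun a b => by
    rw [arc_pop h hpos, ← hy]
  have hmate : ∀ v, cell (pop s.mem w) 0 v 0 = cell s.mem 0 v 0 := fun v => by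
    rw [cell_pop_zero rfl]
    exact if_neg fun h => hpos h.2.symm
  refine Does.mono (T₁ := 39 + ((27 + 1) + 4)) (Does.seq
    (popProgram_spec hN hs hw rfl h hpos hwA hA) fun s₁ ⟨hs₁, hm₁, hr₁, ha₁⟩ => Does.seq
      (Q₁ := fun s' => Ok n N s' ∧ Rep N s'.mem ∧ Asymm s'.mem ∧
        (∀ v, cell s'.mem 0 v 0 = cell s.mem 0 v 0) ∧
        (∀ a b, Arc s'.mem a b ↔
          (Arc s.mem a b ∧ ¬ (a = w ∧ b = y)) ∨ (y ≠ z ∧ a = y ∧ b = w)) ∧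
        cell s'.mem 1 w 0 + 1 = cell s.mem 1 w 0 ∧ SameArgs s s')
      (Does.ite (fun hb => ?_) (fun hb => ?_)) ?_) (by norm_num) fun _ h => h
  · have hyz : y = z := by
      rw [hy, ← hr₁, ← hz, ← ha₁.2.2.2.2.1]; exact hb
    refine (Does.skip ?_).mono (by norm_num) fun _ h => h
    rw [hm₁]
    refine ⟨hs₁, h1, fun a b hab hba => ?_, hmate, fun a b => ?_, by omega, ha₁⟩
    · rw [harc1] at hab hba
      exact hasymm a b hab.1 hba.1
    · rw [harc1]
      tauto
  · have hyz : y ≠ z := by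
      rw [hy, ← hr₁, ← hz, ← ha₁.2.2.2.2.1]; exact hb
    refine Does.mono (T₁ := 3 + 24) (Does.seq (Q₁ := fun s' => Ok n N s' ∧ s'.mem = pop s.mem w ∧
      s'.reg 3 = y ∧ s'.reg 4 = w ∧ SameArgs s s') ((Does.block hs₁ ?_).mono le_rfl ?_)
      fun s₂ ⟨hs₂, hm₂, h3, h4, ha₂⟩ => (pushProgram_spec hN hs₂ h3 h4 hm₂ (hA y hyw).1 hwA h1
        (hN.symm hyw) fun h2 => ?_).mono le_rfl ?_) (by norm_num) fun _ h => h
    · have := hs₁.reg 13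
      simp [SafeAll, Instr.Safe, Instr.run, RamState.setReg]
      omega
    · rintro s' ⟨rfl, hfit⟩
      refine ⟨hfit, ?_⟩
      have := ha₁.2.2.2.1
      simp [runAll, Instr.run, RamState.setReg, hr₁, hm₁, hy, hw, this]
      simpa [SameArgs] using ha₁
    · rw [harc1] at h2
      exact hasymm _ _ harc h2.1
    · rintro s₃ ⟨hs₃, hm₃, hr, ha₃⟩
      rw [hm₃]
      refine ⟨hs₃, hr, fun a b hab hba => ?_, fun v => ?_, fun a b => ?_, ?_, ha₂.trans ha₃⟩
      · rw [arc_push, harc1] at hab hba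
        have g1 := hasymm a b
        have g2 := hasymm b a
        grind
      · rw [cell_push_zero, ← hmate]
        exact if_neg fun h => by omega
      · rw [arc_push, harc1]
        tauto
      · rw [cell_push_one]
        grind
  · rintro s₂ ⟨hs₂, h3, h4, h5, h6, h7, ha₂⟩
    refine (outdegProgram_spec hs₂ (ha₂.2.2.2.1.trans hw) hwA).mono le_rfl ?_
    rintro s₃ ⟨hs₃, hm₃, h8, h9, ha₃⟩
    rw [hm₃]
    exact ⟨hs₃, h3, h4, h5, ⟨y, hne.symm, harc, h6⟩, h7, h8, h9, ha₂.trans ha₃⟩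

/-- Every pass removes an arc from `w`, and the reversed arc is attached to another vertex, so the
outdegree of `w` counts the remaining passes. -/
lemma reset_loop (hN : IsNeighborhood n N) (hwA : w ∈ A)
    (hA : ∀ y ∈ N w, y ∈ A ∧ ∀ z ∈ N y, z ∈ A) (k : ℕ) : ∀ {s : RamState}, Ok n N s →
    s.reg 13 = w → s.reg 14 = z → Rep N s.mem → Asymm s.mem → cell s.mem 1 w 0 = k →
    s.reg 5 = 0 → s.reg 7 = k →
    Does A (Ok n N) (.while (.lt 5 7) reverseProgram) s (72 * k + 1) fun s' =>
      Ok n N s' ∧ IsReset N w z s.mem s'.mem ∧ Asymm s'.mem ∧ SameArgs s s' := by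
  induction k with
  | zero =>
    intro s hs hw hz h hasymm hk h5 h7
    refine Does.while_false (fun hb => ?_) ⟨hs, ⟨h, fun _ => rfl, fun a b => ?_⟩, hasymm,
      SameArgs.refl s⟩
    · change s.reg 5 < s.reg 7 at hb
      omega
    · have hno : ∀ b, ¬ Arc s.mem w b := by
        rintro b ⟨j, hj, hj', -⟩
        omega
      constructor
      · intro hab
        exact Or.inl ⟨hab, by rintro rfl; exact hno b hab⟩
      · rintro (hab | hab)
        · exact hab.1
        · exact absurd hab.2.1 (hno a)
  | succ k ih =>
    intro s hs hw hz h hasymm hk h5 h7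
    refine (Does.while_true (T₁ := 71) (T₂ := 72 * k + 1)
      (by change s.reg 5 < s.reg 7; omega)
      (reverseProgram_spec hN hs hw hz h hasymm (by omega) hwA hA) ?_).mono (by omega)
      fun _ h => h
    rintro s₁ ⟨hs₁, h1, h2, h3, ⟨y, hyw, hwy, h4⟩, h8, h9, h10, ha⟩
    refine (ih hs₁ (ha.2.2.2.1.trans hw) (ha.2.2.2.2.1.trans hz) h1 h2 (by omega) h9
      (by omega)).mono le_rfl ?_
    rintro s₂ ⟨hs₂, ⟨g1, g2, g3⟩, g4, ga⟩
    refine ⟨hs₂, ⟨g1, fun v => (g2 v).trans (h3 v), fun a b => ?_⟩, g4, ha.trans ga⟩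
    rw [g3, h4, h4]
    constructor
    · rintro (⟨(⟨g5, g6⟩ | ⟨g5, rfl, rfl⟩), g7⟩ | ⟨rfl, (⟨g5, g6⟩ | ⟨g5, g6, rfl⟩), g7⟩)
      · exact Or.inl ⟨g5, g7⟩
      · exact Or.inr ⟨rfl, hwy, g5⟩
      · exact Or.inr ⟨rfl, g5, g7⟩
      · exact absurd g6.symm hyw
    · rintro (⟨g5, g6⟩ | ⟨rfl, g5, g6⟩)
      · exact Or.inl ⟨Or.inl ⟨g5, fun g => g6 g.1⟩, g6⟩
      · by_cases hay : a = y
        · exact Or.inl ⟨Or.inr ⟨hay ▸ g6, hay, rfl⟩, hay ▸ hyw⟩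
        · exact Or.inr ⟨rfl, Or.inl ⟨g5, fun g => hay g.2⟩, g6⟩

lemma resetProgram_spec (hN : IsNeighborhood n N) (hs : Ok n N s) (hw : s.reg 13 = w)
    (hz : s.reg 14 = z) (h : Rep N s.mem) (hasymm : Asymm s.mem) (hwA : w ∈ A)
    (hA : ∀ y ∈ N w, y ∈ A ∧ ∀ z ∈ N y, z ∈ A) :
    Does A (Ok n N) resetProgram s (72 * cell s.mem 1 w 0 + 5) fun s' =>
      Ok n N s' ∧ IsReset N w z s.mem s'.mem ∧ Asymm s'.mem ∧ SameArgs s s' := by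
  refine (Does.seq (T₁ := 4) (T₂ := 72 * cell s.mem 1 w 0 + 1) (outdegProgram_spec hs hw hwA)
    ?_).mono (by omega) fun _ h => h
  rintro s₁ ⟨hs₁, hm, h5, h7, ha⟩
  refine (reset_loop hN hwA hA _ hs₁ (ha.2.2.2.1.trans hw) (ha.2.2.2.2.1.trans hz) (hm ▸ h)
    (hm ▸ hasymm) (by rw [hm]) h5 h7).mono le_rfl ?_
  rintro s₂ ⟨hs₂, h8, h9, ha₂⟩
  exact ⟨hs₂, hm ▸ h8, h9, ha.trans ha₂⟩

end Procedures

end DynMatching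

namespace DynMatching

/-! ### The program that looks for a partner -/

section RematchProgram

variable {n : ℕ} {N : ℕ → Finset ℕ} {m m' : Memory} {w y z : ℕ} {A : Set ℕ} {s : RamState}

lemma Rep.outdeg_eq_zero (h : ∀ b, ¬ Arc m w b) : cell m 1 w 0 = 0 := by
  by_contra hne
  exact h _ ⟨1, le_rfl, by omega, rfl⟩

lemma IsReset.no_arc (h : IsReset N w z m m') (hm : Asymm m) (b : ℕ) : ¬ Arc m' w b := by
  rw [h.arc]
  rintro (h1 | ⟨-, h1, -⟩)
  · exact h1.2 rfl
  · exact hm _ _ h1 h1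

lemma cell_putMate {c v j a : ℕ} (hc : 1 ≤ c) (hc' : c < 4) :
    cell (put m 0 y 0 a) c v j = cell m c v j := by
  rw [cell_put _ (by omega) hc']
  exact if_neg fun h => by omega

lemma cell_putMate_zero {v j a : ℕ} :
    cell (put m 0 y 0 a) 0 v j = if v = y ∧ j = 0 then a else cell m 0 v j := by
  rw [cell_put _ (by omega) (by omega)]
  exact if_congr (by tauto) rfl rfl

lemma cell_putMate_of_pos {v j a : ℕ} (hj : 1 ≤ j) :
    cell (put m 0 y 0 a) 0 v j = cell m 0 v j := by
  rw [cell_putMate_zero]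
  exact if_neg fun h => by omega

lemma arc_putMate {a b c : ℕ} : Arc (put m 0 y 0 c) a b ↔ Arc m a b := by
  unfold Arc
  refine exists_congr fun j => and_congr_right fun hj => ?_
  rw [cell_putMate le_rfl (by omega), cell_putMate_of_pos hj]

/-- A vertex without outgoing arcs occurs in no list of free in-neighbors, so its status may change
without informing anyone. For this reason vertices are reset before their partner cell is written.
-/
lemma Rep.putMate (h : Rep N m) (hy : cell m 1 y 0 = 0) (a : ℕ) : Rep N (put m 0 y 0 a) := by
  have e0 : ∀ {v j}, 1 ≤ j → cell (put m 0 y 0 a) 0 v j = cell m 0 v j := cell_putMate_of_pos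
  have e1 : ∀ v j, cell (put m 0 y 0 a) 1 v j = cell m 1 v j := fun v j =>
    cell_putMate (by omega) (by omega)
  have e2 : ∀ v j, cell (put m 0 y 0 a) 2 v j = cell m 2 v j := fun v j =>
    cell_putMate (by omega) (by omega)
  have e3 : ∀ v j, cell (put m 0 y 0 a) 3 v j = cell m 3 v j := fun v j =>
    cell_putMate (by omega) (by omega)
  have e4 : ∀ v, v ≠ y → cell (put m 0 y 0 a) 0 v 0 = cell m 0 v 0 := fun v hv => by
    rw [cell_putMate_zero]
    exact if_neg fun h => hv h.1
  refine ⟨?_, ?_, ?_, ?_, ?_, ?_, ?_, ?_⟩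
  · intro v j hj
    rw [e0 hj, e1]
    exact h.nb_mem v j hj
  · intro v i j hi hi' hj
    rw [e1] at hi'
    rw [e0 hi, e0 hj, e1]
    exact h.nb_inj v i j hi hi' hj
  · intro v j hj
    rw [e1] at hj
    rw [e0 (by omega), e1]
    exact h.out_zero v j hj
  · intro v j
    rw [e2, e2, e3]
    exact h.in_zero v j
  · intro v j hj hj' hv
    rw [e1] at hj'
    have hvy : v ≠ y := by rintro rfl; omega
    rw [e4 v hvy] at hv
    rw [e0 hj, e1, e2, e2, e3]
    exact h.ptr v j hj hj' hv
  · intro v j hj hj' hv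
    rw [e1] at hj'
    have hvy : v ≠ y := by rintro rfl; omega
    rw [e4 v hvy] at hv
    rw [e1]
    exact h.ptr_zero v j hj hj' hv
  · intro v j hj hj'
    rw [e2] at hj'
    have := h.in_ptr v j hj hj'
    rw [e1, e1, e2, e3, e0 this.1]
    exact this
  · intro v
    rw [e3]
    exact h.unused v

/-- The number of reversed arcs is known only after the first program has run; hence the time bound
and the postcondition depend on a `D` that is chosen then. -/
lemma Does.seq_exists {A : Set ℕ} {Ok : RamState → Prop} {p q : Program} {s : RamState} {T₁ : ℕ}
    {T T₂ : ℕ → ℕ} {Q₁ : RamState → Prop} {Q : ℕ → RamState → Prop} (h : Does A Ok p s T₁ Q₁)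
    (h' : ∀ s', Q₁ s' → ∃ D, Does A Ok q s' (T₂ D) (Q D)) (hT : ∀ D, T₁ + T₂ D ≤ T D) :
    ∃ D, Does A Ok (.seq p q) s (T D) (Q D) := by
  obtain ⟨t, ht, s', h1, h2⟩ := h
  obtain ⟨D, t', ht', s'', h3, h4⟩ := h' s' h2
  have := hT D
  exact ⟨D, t + t', by omega, s'', .seq _ _ _ _ _ _ _ h1 h3, h4⟩

/-- Look for a partner of the free vertex in register `15`. -/
def rematchProgram : Program :=
  .seq (block [.const 5 0, .add 13 15 5, .add 14 15 5]) (.seq resetProgram (.seq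
    (block [.const 5 0, .const 7 2, .load 10 15 7, .add 12 10 10, .add 12 12 12, .add 12 12 7])
    (.ite (.eq 10 5) .skip (.seq (block [.load 13 15 12]) (.seq resetProgram (.seq
      (block [.const 5 0, .const 6 1, .add 8 15 6, .store 8 13 5, .add 8 13 6, .store 8 15 5,
        .add 3 15 5, .add 4 13 5]) pushProgram))))))

/-- The registers that hold the update and the argument of `rematchProgram`. -/
def SameUpdate (s s' : RamState) : Prop :=
  s'.reg 0 = s.reg 0 ∧ s'.reg 1 = s.reg 1 ∧ s'.reg 2 = s.reg 2 ∧ s'.reg 15 = s.reg 15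

lemma SameUpdate.trans {s₁ s₂ s₃ : RamState} (h : SameUpdate s₁ s₂) (h' : SameUpdate s₂ s₃) :
    SameUpdate s₁ s₃ := by
  obtain ⟨h0, h1, h2, h3⟩ := h
  obtain ⟨g0, g1, g2, g3⟩ := h'
  exact ⟨g0.trans h0, g1.trans h1, g2.trans h2, g3.trans h3⟩

lemma SameArgs.sameUpdate {s s' : RamState} (h : SameArgs s s') : SameUpdate s s' :=
  ⟨h.1, h.2.1, h.2.2.1, h.2.2.2.2.2⟩

/-- The memory `m'` results from `m` by looking for a partner of `y`. The number `D` counts the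
arcs that have been reversed. -/
inductive IsRematched (N : ℕ → Finset ℕ) (y : ℕ) (m : Memory) : ℕ → Memory → Prop
  | fail (m' : Memory) : IsReset N y y m m' → (∀ x, Arc m' x y → cell m' 0 x 0 ≠ 0) →
      IsRematched N y m (cell m 1 y 0) m'
  | success (m₁ m' : Memory) (w : ℕ) : IsReset N y y m m₁ → Arc m₁ w y → cell m₁ 0 w 0 = 0 →
      Rep N m' →
      (∀ v, cell m' 0 v 0 = if v = y then w + 1 else if v = w then y + 1 else cell m 0 v 0) →
      (∀ a b, Arc m' a b ↔ (Arc m₁ a b ∧ a ≠ w) ∨ (b = w ∧ Arc m₁ w a)) →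
      IsRematched N y m (cell m 1 y 0 + cell m₁ 1 w 0) m'

/-- The reset of `w` drops the arc to `y` instead of reversing it, so that `y` and `w` both have no
outgoing arcs when their partner cells are written. Only then is the arc from `y` to `w` added. In
the reset of `y` the excluded head is `y` itself, so nothing is dropped. -/
lemma rematchProgram_spec (hN : IsNeighborhood n N) (hs : Ok n N s) (hy : s.reg 15 = y)
    (h : Rep N s.mem) (hasymm : Asymm s.mem) (hyA : y ∈ A) (hyn : y < n)
    (hA : ∀ w ∈ N y, w ∈ A ∧ ∀ x ∈ N w, x ∈ A ∧ ∀ z ∈ N x, z ∈ A) :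
    ∃ D, Does A (Ok n N) rematchProgram s (72 * D + 60) fun s' =>
      Ok n N s' ∧ IsRematched N y s.mem D s'.mem ∧ SameUpdate s s' := by
  obtain ⟨d, hd⟩ : ∃ d, d = cell s.mem 1 y 0 := ⟨_, rfl⟩
  suffices hsuff : ∃ D, Does A (Ok n N) rematchProgram s (72 * (d + D) + 60) fun s' =>
      Ok n N s' ∧ IsRematched N y s.mem (d + D) s'.mem ∧ SameUpdate s s' by
    obtain ⟨D, hD⟩ := hsuff
    exact ⟨_, hD⟩
  refine Does.seq_exists (T₁ := 4) (T₂ := fun D => 72 * (d + D) + 55)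
    (Q₁ := fun s' => Ok n N s' ∧ s'.mem = s.mem ∧ s'.reg 13 = y ∧ s'.reg 14 = y ∧
      SameUpdate s s') ((Does.block hs ?_).mono le_rfl ?_) ?_ (fun D => by omega)
  · have := hs.reg 15
    simp [SafeAll, Instr.Safe, Instr.run, RamState.setReg]
    omega
  · rintro s' ⟨rfl, hfit⟩
    refine ⟨hfit, ?_⟩
    simp [runAll, Instr.run, RamState.setReg, hy, SameUpdate]
  rintro s₁ ⟨hs₁, hm₁, h13, h14, ha₁⟩
  refine Does.seq_exists (T₂ := fun D => 72 * D + 50) (resetProgram_spec hN hs₁ h13 h14 (hm₁ ▸ h)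
    (hm₁ ▸ hasymm) hyA fun w hw => ⟨(hA w hw).1, fun x hx => ((hA w hw).2 x hx).1⟩) ?_
    (fun D => by rw [hm₁]; omega)
  rintro s₂ ⟨hs₂, hreset, hasymm₂, ha₂⟩
  rw [hm₁] at hreset
  have hy₂ : s₂.reg 15 = y := ha₂.2.2.2.2.2.trans (ha₁.2.2.2.trans hy)
  have h14 : s₂.reg 14 = y := ha₂.2.2.2.2.1.trans h14
  have ha₂ := ha₁.trans ha₂.sameUpdate
  obtain ⟨m₁, hm₂⟩ : ∃ m₁, m₁ = s₂.mem := ⟨_, rfl⟩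
  rw [← hm₂] at hreset hasymm₂
  obtain ⟨f, hf⟩ : ∃ f, f = cell m₁ 2 y 0 := ⟨_, rfl⟩
  have hfn := hreset.rep.indeg_le hN y
  have hcy := hN.card_le y
  have c1 : m₁ y 2 = f := hf.symm
  refine Does.seq_exists (T₁ := 7) (T₂ := fun D => 72 * D + 43)
    (Q₁ := fun s' => Ok n N s' ∧ s'.mem = m₁ ∧ s'.reg 5 = 0 ∧ s'.reg 10 = f ∧
      s'.reg 12 = 4 * f + 2 ∧ s'.reg 14 = y ∧ s'.reg 15 = y ∧ SameUpdate s s')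
    ((Does.block hs₂ ?_).mono le_rfl ?_) ?_ (fun D => by omega)
  · simp [SafeAll, Instr.Safe, Instr.run, RamState.setReg, hy₂, hyA, ← hm₂, c1]
    omega
  · rintro s' ⟨rfl, hfit⟩
    refine ⟨hfit, ?_⟩
    simp [runAll, Instr.run, RamState.setReg, hy₂, h14, ← hm₂, c1, four_mul]
    simpa [SameUpdate, hy₂] using ha₂
  rintro s₃ ⟨hs₃, hm₃, h5, h10, h12, h14, h15, ha₃⟩
  by_cases hf0 : f = 0
  · refine ⟨0, Does.mono (T₁ := 2) (Does.ite (fun hb => Does.skip ?_)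
      (fun hb => absurd (show s₃.reg 10 = s₃.reg 5 by omega) hb)) (by omega) fun _ h => h⟩
    rw [hd]
    refine ⟨hs₃, IsRematched.fail _ (hm₃ ▸ hreset) ?_, ha₃⟩
    rintro x ⟨j, hj, hj', rfl⟩ hx
    rw [hm₃] at hj' hx hf
    have := hreset.rep.ptr x j hj hj' hx
    omega
  · obtain ⟨w, hw⟩ : ∃ w, w = cell m₁ 2 y f := ⟨_, rfl⟩
    obtain ⟨g1, g2, g3, g4⟩ := hreset.rep.in_ptr y f (by omega) hf.le
    rw [← hw] at g2 g3 g4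
    have hwy : Arc m₁ w y := ⟨_, g1, g2, g3⟩
    have hwfree : cell m₁ 0 w 0 = 0 := by
      by_contra hne
      have := hreset.rep.ptr_zero w _ g1 g2 hne
      omega
    have hwN : w ∈ N y := hw ▸ hreset.rep.in_mem hN y f (by omega) hf.le
    have hne := hN.ne hwN
    have hwn := hN.lt hwN
    have hwA := (hA w hwN).1
    have c2 : m₁ y (4 * f + 2) = w := hw.symm
    refine ⟨cell m₁ 1 w 0, Does.mono (T₁ := (2 + ((72 * cell m₁ 1 w 0 + 5) +
      (9 + 24))) + 1) (Does.ite (fun hb => absurd (show s₃.reg 10 = s₃.reg 5 from hb) (by omega))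
      fun _ => Does.seq (Q₁ := fun s' => Ok n N s' ∧ s'.mem = m₁ ∧ s'.reg 13 = w ∧
      s'.reg 14 = y ∧ s'.reg 15 = y ∧ SameUpdate s s')
      ((Does.block hs₃ ?_).mono le_rfl ?_) ?_) (by omega) fun _ h => h⟩
    · simp [SafeAll, Instr.Safe, h15, hyA]
    · rintro s' ⟨rfl, hfit⟩
      refine ⟨hfit, ?_⟩
      simp [runAll, Instr.run, RamState.setReg, h14, h15, h12, hm₃, c2]
      simpa [SameUpdate, h15] using ha₃
    rintro s₄ ⟨hs₄, rfl, h13, h14, h15, ha₄⟩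
    refine Does.seq (resetProgram_spec hN hs₄ h13 h14 hreset.rep hasymm₂ hwA
      (hA w hwN).2) ?_
    rintro s₅ ⟨hs₅, hreset₅, hasymm₅, ha₅⟩
    have h13 := ha₅.2.2.2.1.trans h13
    have h15 := ha₅.2.2.2.2.2.trans h15
    have ha₅ := ha₄.trans ha₅.sameUpdate
    have hw0 : cell s₅.mem 1 w 0 = 0 := Rep.outdeg_eq_zero (hreset₅.no_arc hasymm₂)
    have hy_none : ∀ b, ¬ Arc s₅.mem y b := by
      intro b
      rw [hreset₅.arc]
      rintro (h1 | ⟨-, -, h1⟩)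
      · exact hreset.no_arc hasymm b h1.1
      · exact h1 rfl
    have hy0 : cell s₅.mem 1 y 0 = 0 := Rep.outdeg_eq_zero hy_none
    have hr := hreset₅.rep.putMate hw0 (y + 1)
    have hr' := hr.putMate (y := y) (by rw [cell_putMate (by omega) (by omega)]; exact hy0) (w + 1)
    have hlw : len n N w = _ := len_eq hwn
    have hly : len n N y = _ := len_eq hyn
    refine Does.seq (Q₁ := fun s' => Ok n N s' ∧
      s'.mem = put (put s₅.mem 0 w 0 (y + 1)) 0 y 0 (w + 1) ∧ s'.reg 3 = y ∧ s'.reg 4 = w ∧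
      SameUpdate s s') ((Does.block hs₅ ?_).mono le_rfl ?_) ?_
    · simp [SafeAll, Instr.Safe, Instr.run, RamState.setReg, h13, h15, hwA, hyA, hlw, hly]
      omega
    · rintro s' ⟨rfl, hfit⟩
      refine ⟨hfit, ?_⟩
      simp [runAll, Instr.run, RamState.setReg, h13, h15, put, write]
      simpa [SameUpdate, h15] using ha₅
    rintro s₆ ⟨hs₆, hm₆, h3, h4, ha₆⟩
    refine (pushProgram_spec hN hs₆ h3 h4 hm₆ hyA hwA hr' hwN ?_).mono le_rfl ?_
    · rw [arc_putMate, arc_putMate]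
      exact hy_none w
    rintro s₇ ⟨hs₇, hm₇, hr₇, ha₇⟩
    rw [hd]
    refine ⟨hs₇, IsRematched.success s₄.mem s₇.mem w hreset hwy hwfree (hm₇ ▸ hr₇)
      ?_ ?_, ha₆.trans ha₇.sameUpdate⟩
    · intro v
      rw [hm₇, cell_push_zero, if_neg (by omega), cell_putMate_zero, cell_putMate_zero,
        hreset₅.mate, hreset.mate]
      simp
    · intro a b
      rw [hm₇, arc_push, arc_putMate, arc_putMate, hreset₅.arc]
      constructor
      · rintro ((h1 | h1) | ⟨rfl, rfl⟩)
        · exact Or.inl h1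
        · exact Or.inr ⟨h1.1, h1.2.1⟩
        · exact Or.inr ⟨rfl, hwy⟩
      · rintro (h1 | ⟨rfl, h1⟩)
        · exact Or.inl (Or.inl h1)
        · by_cases hay : a = y
          · exact Or.inr ⟨hay, rfl⟩
          · exact Or.inl (Or.inr ⟨rfl, h1, hay⟩)

end RematchProgram

end DynMatching

namespace DynMatching

/-! ### From memories to orientations and matchings -/

section Lift

variable {n : ℕ} {N : ℕ → Finset ℕ} {m m' : Memory} {G : SimpleGraph (Fin n)}

open scoped Classical in
/-- The arcs between vertices of `Fin n`. -/
noncomputable def arcs (n : ℕ) (m : Memory) : Finset (Fin n × Fin n) :=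
  Finset.univ.filter fun a => Arc m a.1 a.2

lemma mem_arcs {x y : Fin n} : (x, y) ∈ arcs n m ↔ Arc m x y := by simp [arcs]

lemma Rep.outdeg_eq_card (h : Rep N m) (hN : IsNeighborhood n N) (w : Fin n) :
    cell m 1 w 0 = (Finset.univ.filter fun x => (w, x) ∈ arcs n m).card := by
  have h1 : (Finset.Icc 1 (cell m 1 w 0)).image (fun j => cell m 0 w j) =
      (Finset.univ.filter fun x => (w, x) ∈ arcs n m).image fun x : Fin n => (x : ℕ) := by
    ext y
    simp only [Finset.mem_image, Finset.mem_Icc, Finset.mem_filter, Finset.mem_univ, true_and,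
      mem_arcs]
    constructor
    · rintro ⟨j, ⟨hj, hj'⟩, rfl⟩
      exact ⟨⟨_, hN.lt (h.nb_mem _ _ hj hj')⟩, ⟨j, hj, hj', rfl⟩, rfl⟩
    · rintro ⟨x, ⟨j, hj, hj', hx⟩, rfl⟩
      exact ⟨j, ⟨hj, hj'⟩, hx⟩
  have h2 := congrArg Finset.card h1
  rw [Finset.card_image_of_injOn fun i hi j hj hij => by
      rw [Finset.mem_coe, Finset.mem_Icc] at hi hj
      exact h.nb_inj _ i j hi.1 hi.2 hj.1 hj.2 hij,
    Finset.card_image_of_injective _ Fin.val_injective] at h2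
  simpa using h2

lemma Arc.mem (h : Rep N m) {a b : ℕ} (hab : Arc m a b) : b ∈ N a := by
  obtain ⟨j, hj, hj', rfl⟩ := hab
  exact h.nb_mem _ _ hj hj'

lemma Rep.asymm (h : Rep N m) (hN : IsNeighborhood n N) (hO : IsOrientation G (arcs n m)) :
    Asymm m := by
  intro a b hab hba
  have ha := hN.lt (hba.mem h)
  have hb := hN.lt (hab.mem h)
  exact hO.asymm (v := ⟨a, ha⟩) (w := ⟨b, hb⟩) (mem_arcs.2 hab) (mem_arcs.2 hba)

lemma mateInMemory_eq_none {v : Fin n} : mateInMemory m v = none ↔ cell m 0 v 0 = 0 := by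
  change (if cell m 0 v 0 = 0 then none else some (cell m 0 v 0 - 1)) = none ↔ _
  split <;> simp_all

lemma mateInMemory_eq_some {v : Fin n} {k : ℕ} :
    mateInMemory m v = some k ↔ cell m 0 v 0 = k + 1 := by
  change (if cell m 0 v 0 = 0 then none else some (cell m 0 v 0 - 1)) = some k ↔ _
  split
  · simp_all
  · rw [Option.some_inj]
    omega

lemma mateInMemory_congr {v : Fin n} (h : cell m' 0 v 0 = cell m 0 v 0) :
    mateInMemory m' v = mateInMemory m v := by
  change (if cell m' 0 v 0 = 0 then none else some (cell m' 0 v 0 - 1)) =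
    if cell m 0 v 0 = 0 then none else some (cell m 0 v 0 - 1)
  rw [h]

lemma IsReset.arcs_eq {y : Fin n} (h : IsReset N y y m m') (hm : Asymm m) :
    arcs n m' = flipAll (arcs n m) y := by
  ext ⟨a, b⟩
  rw [mem_flipAll, mem_arcs, mem_arcs, mem_arcs, h.arc]
  simp only [← Fin.ext_iff, ne_eq]
  refine or_congr_right (and_congr_right fun _ => and_iff_left_of_imp ?_)
  rintro h1 rfl
  exact hm _ _ h1 h1

/-- The counterpart of `Runs.rematch`: in terms of orientations, an unsuccessful search is one reset
and a successful search is two. The last clause keeps the other endpoint of a deleted edge free. -/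
lemma IsRematched.lift {y : Fin n} {D : ℕ} (h : IsRematched N y m D m') (hN : IsNeighborhood n N)
    (hrep : Rep N m) (hO : IsOrientation G (arcs n m)) (hμ : IsMateTable G (mateInMemory m))
    {X : Set (Fin n)} (hX : MaximalOutside G (mateInMemory m) X) (hy : cell m 0 y 0 = 0) :
    (∃ k ≤ 2, Flips k D (arcs n m) (arcs n m')) ∧ Rep N m' ∧ IsOrientation G (arcs n m') ∧
      IsMateTable G (mateInMemory m') ∧ MaximalOutside G (mateInMemory m') (X \ {y}) ∧
      ∀ x ≠ y, ¬ G.Adj y x → mateInMemory m' x = mateInMemory m x := by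
  have hasymm := hrep.asymm hN hO
  have hO₁ := hO.flipAll y
  have hf := flips_flipAll (arcs n m) y
  rw [← hrep.outdeg_eq_card hN] at hf
  cases h with
  | fail _ h1 h2 =>
    have e := h1.arcs_eq hasymm
    have hmate : mateInMemory (n := n) m' = mateInMemory m := funext fun x =>
      mateInMemory_congr (h1.mate x)
    rw [e, hmate]
    refine ⟨⟨1, by omega, hf⟩, h1.rep, hO₁, hμ, ?_, fun _ _ _ => rfl⟩
    refine hX.of_no_free hO₁ (notMem_flipAll hO y) fun x hx hx' => ?_
    rw [← e, mem_arcs] at hx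
    refine h2 x hx ?_
    rw [h1.mate]
    exact mateInMemory_eq_none.1 hx'
  | success m₁ _ w h1 hwy hw hrep' hmate harc =>
    have e := h1.arcs_eq hasymm
    obtain ⟨w, rfl⟩ : ∃ w' : Fin n, (w' : ℕ) = w :=
      ⟨⟨w, hN.lt (hN.symm (hwy.mem h1.rep))⟩, rfl⟩
    have e' : arcs n m' = flipAll (flipAll (arcs n m) y) w := by
      rw [← e]
      ext ⟨a, b⟩
      rw [mem_flipAll, mem_arcs, mem_arcs, mem_arcs, harc]
      simp only [← Fin.ext_iff, ne_eq]
    have hadj : G.Adj y w := by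
      rw [← mem_arcs, e] at hwy
      exact (hO₁.adj hwy).symm
    have hfw := flips_flipAll (flipAll (arcs n m) y) w
    rw [← e, ← h1.rep.outdeg_eq_card hN, e, ← e'] at hfw
    rw [h1.mate] at hw
    have hmates : mateInMemory (n := n) m' = setMates (mateInMemory m) y w := by
      ext1 x
      unfold setMates
      by_cases hxw : x = w
      · subst hxw
        rw [Function.update_self, mateInMemory_eq_some, hmate,
          if_neg (fun h => hadj.ne (Fin.ext h).symm), if_pos rfl]
      · rw [Function.update_of_ne hxw]
        by_cases hxy : x = y
        · subst hxy
          rw [Function.update_self, mateInMemory_eq_some, hmate, if_pos rfl]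
        · rw [Function.update_of_ne hxy]
          refine mateInMemory_congr ?_
          rw [hmate, if_neg (fun h => hxy (Fin.ext h)), if_neg (fun h => hxw (Fin.ext h))]
    refine ⟨⟨2, le_rfl, hf.trans hfw⟩, hrep', ?_, ?_, ?_, ?_⟩
    · rw [e']
      exact hO₁.flipAll w
    · rw [hmates]
      exact hμ.setMates hadj (mateInMemory_eq_none.2 hy) (mateInMemory_eq_none.2 hw)
    · rw [hmates]
      exact hX.setMates y w
    · intro x hxy hx
      rw [hmates, setMates, Function.update_of_ne, Function.update_of_ne hxy]
      rintro rfl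
      exact hx hadj

open scoped Classical in
/-- The names of the neighbors of the vertex with the name `a`. -/
noncomputable def nbhd (H : SimpleGraph (Fin n)) (a : ℕ) : Finset ℕ :=
  if h : a < n then
    (Finset.univ.filter fun b => H.Adj ⟨a, h⟩ b).image fun b : Fin n => (b : ℕ)
  else ∅

lemma mem_nbhd {H : SimpleGraph (Fin n)} {a b : ℕ} :
    b ∈ nbhd H a ↔ ∃ x y : Fin n, (x : ℕ) = a ∧ (y : ℕ) = b ∧ H.Adj x y := by
  unfold nbhd
  split
  · rename_i ha
    simp only [Finset.mem_image, Finset.mem_filter, Finset.mem_univ, true_and]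
    constructor
    · rintro ⟨y, hy, rfl⟩
      exact ⟨_, y, rfl, rfl, hy⟩
    · rintro ⟨x, y, rfl, rfl, hxy⟩
      exact ⟨y, hxy, rfl⟩
  · rename_i ha
    simp only [Finset.notMem_empty, false_iff]
    rintro ⟨x, y, rfl, -⟩
    exact ha x.2

lemma isNeighborhood_nbhd (H : SimpleGraph (Fin n)) : IsNeighborhood n (nbhd H) where
  symm := by
    intro a b h
    rw [mem_nbhd] at h ⊢
    obtain ⟨x, y, hx, hy, hxy⟩ := h
    exact ⟨y, x, hy, hx, hxy.symm⟩
  lt := by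
    intro a b h
    obtain ⟨x, y, -, rfl, -⟩ := mem_nbhd.1 h
    exact y.2
  ne := by
    intro a b h
    obtain ⟨x, y, rfl, rfl, hxy⟩ := mem_nbhd.1 h
    exact fun h => hxy.ne (Fin.ext h)

lemma Rep.congr {N' : ℕ → Finset ℕ} (h : Rep N m) (hN : ∀ a b, Arc m a b → b ∈ N' a) :
    Rep N' m :=
  { h with nb_mem := fun v j hj hj' => hN v _ ⟨j, hj, hj', rfl⟩ }

/-- The neighborhoods enter `Rep` only through `nb_mem`, so they can be exchanged at the beginning
of each update. -/
lemma Rep.restrict {H : SimpleGraph (Fin n)} (h : Rep N m) (hN : IsNeighborhood n N)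
    (hO : IsOrientation G (arcs n m)) (hGH : G ≤ H) : Rep (nbhd H) m := by
  refine h.congr fun a b hab => mem_nbhd.2 ?_
  have ha := hN.lt (hN.symm (hab.mem h))
  have hb := hN.lt (hab.mem h)
  exact ⟨⟨a, ha⟩, ⟨b, hb⟩, rfl, rfl, hGH (hO.adj (mem_arcs.2 hab))⟩

/-- The limits need not be carried along from update to update. No list is longer than the degree,
cells beyond the lists vanish, and all entries are names or positions, so the invariants of the data
structure imply the limits. -/
lemma Rep.ok (h : Rep N m) (hN : IsNeighborhood n N) (hμ : IsMateTable G (mateInMemory m))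
    (hm : ∀ v, n ≤ v → m v 0 = 0) {r : ℕ → ℕ} (hr : ∀ x, r x ≤ 4 * n + 7) : Ok n N ⟨r, m⟩ := by
  have key : ∀ v j c, c < 4 → cell m c v j ≤ n ∧ (cell m c v j ≠ 0 → v < n ∧ j ≤ (N v).card) := by
    intro v j c hc
    have hcard := hN.card_le v
    have hlt : 0 < (N v).card → v < n := fun h0 => by
      obtain ⟨b, hb⟩ := Finset.card_pos.1 h0
      exact hN.lt (hN.symm hb)
    have hod := h.outdeg_le v
    have hid := h.indeg_le hN v
    by_cases hj : j = 0
    · subst hj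
      interval_cases c
      · by_cases hv : v < n
        · refine ⟨?_, fun _ => ⟨hv, by omega⟩⟩
          by_cases h0 : cell m 0 v 0 = 0
          · omega
          · obtain ⟨w, hw, -⟩ := hμ ⟨v, hv⟩ (cell m 0 v 0 - 1) (mateInMemory_eq_some.2 (by
              change cell m 0 v 0 = _
              omega))
            have := w.2
            omega
        · have : cell m 0 v 0 = 0 := hm v (by omega)
          omega
      · exact ⟨by omega, fun h0 => ⟨hlt (by omega), by omega⟩⟩
      · exact ⟨by omega, fun h0 => ⟨hlt (by omega), by omega⟩⟩
      · have := h.unused v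
        omega
    · have hout : j ≤ cell m 1 v 0 → cell m 0 v j < n ∧ cell m 1 v j ≤ n := by
        intro hj'
        have h1 := h.nb_mem v j (by omega) hj'
        refine ⟨hN.lt h1, ?_⟩
        by_cases h0 : cell m 0 v 0 = 0
        · have h2 := h.ptr v j (by omega) hj' h0
          have h3 := h.indeg_le hN (cell m 0 v j)
          have h4 := hN.card_le (cell m 0 v j)
          omega
        · rw [h.ptr_zero v j (by omega) hj' h0]
          omega
      have hin : j ≤ cell m 2 v 0 → cell m 2 v j < n ∧ cell m 3 v j ≤ n := by
        intro hj'
        refine ⟨hN.lt (h.in_mem hN v j (by omega) hj'), ?_⟩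
        have h2 := h.in_ptr v j (by omega) hj'
        have h3 := h.outdeg_le (cell m 2 v j)
        have h4 := hN.card_le (cell m 2 v j)
        omega
      have hout' := h.out_zero v j
      have hin' := h.in_zero v j
      have hc' : c = 0 ∨ c = 1 ∨ c = 2 ∨ c = 3 := by omega
      by_cases g1 : j ≤ cell m 1 v 0 <;> by_cases g2 : j ≤ cell m 2 v 0
      all_goals rcases hc' with rfl | rfl | rfl | rfl
      all_goals exact ⟨by omega, fun h0 => ⟨hlt (by omega), by omega⟩⟩
  have hcell : ∀ v i, m v i = cell m (i % 4) v (i / 4) := fun v i => by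
    rw [cell, Nat.div_add_mod]
  refine ⟨hr, fun v i => ?_, fun v i hvi => ?_⟩
  · have := (key v (i / 4) (i % 4) (by omega)).1
    change m v i ≤ _
    rw [hcell]
    omega
  · change m v i ≠ 0 at hvi
    rw [hcell] at hvi
    have := (key v (i / 4) (i % 4) (by omega)).2 hvi
    rw [len_eq this.1]
    omega

end Lift

end DynMatching

namespace DynMatching

/-! ### The programs for insertions and deletions -/

section UpdateProgram

variable {n : ℕ} {G : SimpleGraph (Fin n)} {N : ℕ → Finset ℕ} {A : Set ℕ} {s : RamState}

/-- Process the insertion of an edge. -/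
def insertProgram : Program :=
  .seq (block [.const 5 0, .add 3 1 5, .add 4 2 5]) (.seq pushProgram (.seq
    (block [.const 5 0, .load 7 1 5])
    (.ite (.eq 7 5) (.seq (block [.add 15 1 5]) rematchProgram) .skip)))

/-- Process the deletion of an edge. -/
def deleteProgram : Program :=
  .seq (block [.const 5 0, .add 13 1 5, .add 14 2 5]) (.seq resetProgram (.seq
    (block [.const 5 0, .add 13 2 5, .add 14 1 5]) (.seq resetProgram (.seq
    (block [.const 5 0, .const 6 1, .load 7 1 5, .add 8 2 6])
    (.ite (.eq 7 8) (.seq (block [.store 5 1 5, .store 5 2 5, .add 15 1 5]) (.seq rematchProgram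
      (.seq (block [.const 5 0, .add 15 2 5]) rematchProgram))) .skip)))))

/-- Process an update. -/
def updateProgram : Program :=
  .seq (block [.const 5 0]) (.ite (.eq 0 5) insertProgram deleteProgram)

/-- The memory `m` describes an orientation that results from `O₁` by reversing `D` arcs, and a
maximal matching of `G`. -/
structure Serves (N : ℕ → Finset ℕ) (G : SimpleGraph (Fin n)) (O₁ : Finset (Fin n × Fin n))
    (D : ℕ) (m : Memory) : Prop where
  flips : ∃ k ≤ 6, Flips k D O₁ (arcs n m)
  solution : IsSolution G (arcs n m) (mateInMemory m)
  rep : Rep N m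

/-- The vertices at distance at most `3` from `y` belong to `A`. -/
def Near (N : ℕ → Finset ℕ) (A : Set ℕ) (y : ℕ) : Prop :=
  y ∈ A ∧ ∀ w ∈ N y, w ∈ A ∧ ∀ x ∈ N w, x ∈ A ∧ ∀ z ∈ N x, z ∈ A

lemma insertProgram_spec {u v : Fin n} (hN : IsNeighborhood n N) (huv : (v : ℕ) ∈ N u)
    (hadj : ¬ G.Adj u v) (hs : Ok n N s) (h1 : s.reg 1 = u) (h2 : s.reg 2 = v)
    (h : Rep N s.mem) (hsol : IsSolution G (arcs n s.mem) (mateInMemory s.mem))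
    (hu : Near N A u) (hv : Near N A v) :
    ∃ D, Does A (Ok n N) insertProgram s (72 * D + 300) fun s' => Ok n N s' ∧
      Serves N (Update.apply G ⟨.insert, u, v⟩) (insert (u, v) (arcs n s.mem)) D s'.mem := by
  have hne : u ≠ v := fun e => hN.ne huv (congrArg Fin.val e)
  have hu4 := hs.reg 1
  have hv4 := hs.reg 2
  refine Does.seq_exists (T₁ := 4) (T₂ := fun D => 72 * D + 290)
    (Q₁ := fun s' => Ok n N s' ∧ s'.mem = s.mem ∧ s'.reg 1 = u ∧ s'.reg 3 = u ∧ s'.reg 4 = v)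
    ((Does.block hs ?_).mono le_rfl ?_) ?_ (fun D => by omega)
  · simp [SafeAll, Instr.Safe, Instr.run, RamState.setReg]
    omega
  · rintro s' ⟨rfl, hfit⟩
    refine ⟨hfit, ?_⟩
    simp [runAll, Instr.run, RamState.setReg, h1, h2]
  rintro s₁ ⟨hs₁, hm₁, r1, r3, r4⟩
  have hnew : ¬ Arc s.mem u v := fun h => hadj (hsol.orientation.adj (mem_arcs.2 h))
  refine Does.seq_exists (T₂ := fun D => 72 * D + 260)
    (pushProgram_spec hN hs₁ r3 r4 hm₁ hu.1 hv.1 h huv hnew) ?_ (fun D => by omega)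
  rintro s₂ ⟨hs₂, hm₂, hrep, ha₂⟩
  have r1 := ha₂.2.1.trans r1
  have harcs : arcs n s₂.mem = insert (u, v) (arcs n s.mem) := by
    ext ⟨a, b⟩
    rw [mem_arcs, hm₂, arc_push, Finset.mem_insert, mem_arcs, Prod.mk.injEq, Fin.ext_iff,
      Fin.ext_iff]
    tauto
  have hmate : mateInMemory (n := n) s₂.mem = mateInMemory s.mem := funext fun x =>
    mateInMemory_congr (by
      rw [hm₂, cell_push_zero]
      exact if_neg fun h => by omega)
  rw [← hm₂] at hrep
  have hO := hsol.orientation.insert hne hadj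
  have hμ := hsol.mates.mono (H := Update.apply G ⟨.insert, u, v⟩) fun x y hxy =>
    (Update.apply_insert_adj hne).2 (Or.inl hxy)
  rw [← harcs] at hO ⊢
  rw [← hmate] at hμ
  have hX := hsol.maximal.insert hne
  rw [← hmate] at hX
  refine Does.seq_exists (T₁ := 3) (T₂ := fun D => 72 * D + 250)
    (Q₁ := fun s' => Ok n N s' ∧ s'.mem = s₂.mem ∧ s'.reg 1 = u ∧ s'.reg 5 = 0 ∧
      s'.reg 7 = cell s₂.mem 0 u 0)
    ((Does.block hs₂ ?_).mono le_rfl ?_) ?_ (fun D => by omega)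
  · simp [SafeAll, Instr.Safe, Instr.run, RamState.setReg, r1, hu.1]
  · rintro s' ⟨rfl, hfit⟩
    refine ⟨hfit, ?_⟩
    simp [runAll, Instr.run, RamState.setReg, r1, cell]
  rintro s₃ ⟨hs₃, hm₃, r1, r5, r7⟩
  by_cases hfree : cell s₂.mem 0 u 0 = 0
  · suffices hsuff : ∃ D, Does A (Ok n N) (.seq (block [.add 15 1 5]) rematchProgram) s₃
        (72 * D + 200) fun s' => Ok n N s' ∧ IsRematched N u s₂.mem D s'.mem by
      obtain ⟨D, hD⟩ := hsuff
      refine ⟨D, (Does.ite (b := .eq 7 5) (fun _ => hD.mono (T₂ := 72 * D + 249) (by omega) ?_)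
        fun hb => absurd (show s₃.reg 7 = s₃.reg 5 by omega) hb).mono (by omega) fun _ h => h⟩
      rintro s' ⟨hs', hre⟩
      obtain ⟨⟨k, hk, hf⟩, g1, g2, g3, g4, -⟩ := hre.lift hN hrep hO hμ hX hfree
      exact ⟨hs', ⟨k, by omega, hf⟩, ⟨g2, g3, by simpa using g4⟩, g1⟩
    refine Does.seq_exists (T₁ := 2) (T₂ := fun D => 72 * D + 60)
      (Q₁ := fun s' => Ok n N s' ∧ s'.mem = s₂.mem ∧ s'.reg 15 = u)
      ((Does.block hs₃ ?_).mono le_rfl ?_) ?_ (fun D => by omega)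
    · simp [SafeAll, Instr.Safe, r1, r5]
      omega
    · rintro s' ⟨rfl, hfit⟩
      refine ⟨hfit, ?_⟩
      simp [runAll, Instr.run, RamState.setReg, r1, r5, hm₃]
    rintro s₄ ⟨hs₄, hm₄, r15⟩
    obtain ⟨D, hD⟩ := rematchProgram_spec hN hs₄ r15 (hm₄ ▸ hrep) (hm₄ ▸ hrep.asymm hN hO) hu.1
      u.2 hu.2
    rw [hm₄] at hD
    exact ⟨D, hD.mono le_rfl fun _ h => ⟨h.1, h.2.1⟩⟩
  · refine ⟨0, (Does.ite (b := .eq 7 5) (T := 1) (fun hb => absurd (show s₃.reg 7 = s₃.reg 5 from hb) (by omega))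
      fun _ => Does.skip ⟨hs₃, ?_⟩).mono (by omega) fun _ h => h⟩
    rw [hm₃]
    refine ⟨⟨0, by omega, Flips.refl _⟩, ⟨hO, hμ, ?_⟩, hrep⟩
    rw [hmate]
    refine hsol.maximal.insert_of_matched hne ?_
    rw [← hmate, ne_eq, mateInMemory_eq_none]
    exact hfree

/-- Dropping the edge in the course of the resets has the same effect as erasing it first and
resetting both endpoints afterwards, which is the form the potential argument needs. -/
lemma reset_reset {u v : Fin n} {m m₁ m₂ : Memory} (huv : u ≠ v) (hm : Asymm m)
    (h₁ : IsReset N u v m m₁) (h₂ : IsReset N v u m₁ m₂) :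
    arcs n m₂ = flipAll (flipAll (eraseEdge (arcs n m) u v) u) v := by
  have hirr : ∀ a, ¬ Arc m a a := fun a ha => hm a a ha ha
  ext ⟨a, b⟩
  rw [mem_flipAll, mem_flipAll, mem_flipAll, mem_eraseEdge, mem_eraseEdge, mem_eraseEdge,
    mem_eraseEdge, mem_arcs, mem_arcs, mem_arcs, mem_arcs, mem_arcs, h₂.arc, h₁.arc, h₁.arc]
  simp only [← Fin.ext_iff]
  have h3 := hirr u
  have h4 := hirr v
  grind

lemma IsReset.mateInMemory_eq {m m' : Memory} {w z : ℕ} (h : IsReset N w z m m') :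
    mateInMemory (n := n) m' = mateInMemory m := funext fun x => mateInMemory_congr (h.mate x)

lemma IsReset.outdeg_le {u v : Fin n} {m m₁ : Memory} (hN : IsNeighborhood n N) (hm : Asymm m)
    (h₁ : IsReset N u v m m₁) : cell m₁ 1 v 0 ≤
      (Finset.univ.filter fun x => (v, x) ∈ flipAll (eraseEdge (arcs n m) u v) u).card + 1 := by
  rw [h₁.rep.outdeg_eq_card hN]
  refine (Finset.card_le_card fun x hx => ?_).trans (Finset.card_insert_le u _)
  rw [Finset.mem_filter, mem_arcs, h₁.arc] at hx
  rw [Finset.mem_insert, Finset.mem_filter, mem_flipAll, mem_eraseEdge, mem_arcs]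
  simp only [Finset.mem_univ, true_and, ← Fin.ext_iff, ne_eq] at hx ⊢
  have := hm u v
  have := hm v v
  grind

lemma Rep.outdeg_le_eraseEdge {m : Memory} (h : Rep N m) (hN : IsNeighborhood n N)
    (u v : Fin n) : cell m 1 u 0 ≤
      (Finset.univ.filter fun x => (u, x) ∈ eraseEdge (arcs n m) u v).card + 1 := by
  rw [h.outdeg_eq_card hN]
  refine (Finset.card_le_card fun x hx => ?_).trans (Finset.card_insert_le v _)
  rw [Finset.mem_filter] at hx
  rw [Finset.mem_insert, Finset.mem_filter, mem_eraseEdge]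
  have := mem_arcs.1 hx.2
  by_cases hxv : x = v
  · exact Or.inl hxv
  · refine Or.inr ⟨Finset.mem_univ _, hx.2, ?_⟩
    rintro (h1 | ⟨rfl, rfl⟩)
    · exact hxv h1.2
    · exact hN.ne (this.mem h) rfl

/-- Both endpoints have been reset, so their partner cells can be cleared by `Rep.putMate`. Since
`v` is not adjacent to `u`, it is still free after the search of `u`. -/
lemma separate_and_rematch {u v : Fin n} (hN : IsNeighborhood n N) (huv : u ≠ v)
    (hnadj : ¬ G.Adj u v)
    (hs : Ok n N s) (h1 : s.reg 1 = u) (h2 : s.reg 2 = v) (h5 : s.reg 5 = 0) (h : Rep N s.mem)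
    (hO : IsOrientation G (arcs n s.mem)) {m' : Memory}
    (hm' : m' = put (put s.mem 0 u 0 0) 0 v 0 0)
    (hμ : IsMateTable G (mateInMemory m')) (hX : MaximalOutside G (mateInMemory m') {u, v})
    (hu0 : cell s.mem 1 u 0 = 0) (hv0 : cell s.mem 1 v 0 = 0)
    (hu : Near N A u) (hv : Near N A v) :
    ∃ D, Does A (Ok n N) (.seq (block [.store 5 1 5, .store 5 2 5, .add 15 1 5])
      (.seq rematchProgram (.seq (block [.const 5 0, .add 15 2 5]) rematchProgram))) s
      (72 * D + 130) fun s' => Ok n N s' ∧ (∃ k ≤ 4, Flips k D (arcs n s.mem) (arcs n s'.mem)) ∧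
        IsSolution G (arcs n s'.mem) (mateInMemory s'.mem) ∧ Rep N s'.mem := by
  have harcs : arcs n m' = arcs n s.mem := by
    ext ⟨a, b⟩
    rw [mem_arcs, mem_arcs, hm', arc_putMate, arc_putMate]
  have hrep : Rep N m' := hm' ▸ (h.putMate hu0 0).putMate
    (by rw [cell_putMate (by omega) (by omega)]; exact hv0) 0
  have hu4 := hs.reg 1
  have hv4 := hs.reg 2
  rw [← harcs] at hO ⊢
  have hfu : cell m' 0 u 0 = 0 := by
    rw [hm', cell_putMate_zero, cell_putMate_zero]
    simp
  have hfv : cell m' 0 v 0 = 0 := by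
    rw [hm', cell_putMate_zero]
    simp
  refine Does.seq_exists (T₁ := 4) (T₂ := fun D => 72 * D + 123)
    (Q₁ := fun s' => Ok n N s' ∧ s'.mem = m' ∧ s'.reg 2 = v ∧ s'.reg 15 = u)
    ((Does.block hs ?_).mono le_rfl ?_) ?_ (fun D => by omega)
  · simp [SafeAll, Instr.Safe, Instr.run, h1, h2, h5, hu.1, hv.1]
    omega
  · rintro s' ⟨rfl, hfit⟩
    refine ⟨hfit, ?_⟩
    simp [runAll, Instr.run, RamState.setReg, h1, h2, h5, hm', put, write]
  rintro s₁ ⟨hs₁, hm₁, r2, r15⟩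
  obtain ⟨D₁, hD₁⟩ := rematchProgram_spec hN hs₁ r15 (hm₁ ▸ hrep) (hm₁ ▸ hrep.asymm hN hO) hu.1
    u.2 hu.2
  rw [hm₁] at hD₁
  suffices hsuff : ∃ D₂, Does A (Ok n N) (.seq rematchProgram
      (.seq (block [.const 5 0, .add 15 2 5]) rematchProgram)) s₁ (72 * (D₁ + D₂) + 123)
      fun s' => Ok n N s' ∧ (∃ k ≤ 4, Flips k (D₁ + D₂) (arcs n m') (arcs n s'.mem)) ∧
        IsSolution G (arcs n s'.mem) (mateInMemory s'.mem) ∧ Rep N s'.mem by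
    obtain ⟨D₂, hD₂⟩ := hsuff
    exact ⟨_, hD₂⟩
  refine Does.seq_exists (T₂ := fun D => 72 * D + 63) hD₁ ?_ (fun D => by omega)
  rintro s₂ ⟨hs₂, hre, ha₂⟩
  obtain ⟨⟨k, hk, hf⟩, g1, g2, g3, g4, g5⟩ := hre.lift hN hrep hO hμ hX hfu
  have r2 := ha₂.2.2.1.trans r2
  have hfv₂ : cell s₂.mem 0 v 0 = 0 := by
    rw [← mateInMemory_eq_none, g5 v huv.symm hnadj, mateInMemory_eq_none]
    exact hfv
  refine Does.seq_exists (T₁ := 3) (T₂ := fun D => 72 * D + 60)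
    (Q₁ := fun s' => Ok n N s' ∧ s'.mem = s₂.mem ∧ s'.reg 15 = v)
    ((Does.block hs₂ ?_).mono le_rfl ?_) ?_ (fun D => by omega)
  · have := hs₂.reg 2
    simp [SafeAll, Instr.Safe, Instr.run, RamState.setReg]
    omega
  · rintro s' ⟨rfl, hfit⟩
    refine ⟨hfit, ?_⟩
    simp [runAll, Instr.run, RamState.setReg, r2]
  rintro s₃ ⟨hs₃, hm₃, r15⟩
  obtain ⟨D₂, hD₂⟩ := rematchProgram_spec hN hs₃ r15 (hm₃ ▸ g1) (hm₃ ▸ g1.asymm hN g2) hv.1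
    v.2 hv.2
  rw [hm₃] at hD₂
  refine ⟨D₂, hD₂.mono le_rfl ?_⟩
  rintro s₄ ⟨hs₄, hre₂, -⟩
  obtain ⟨⟨k₂, hk₂, hf₂⟩, e1, e2, e3, e4, -⟩ := hre₂.lift hN g1 g2 g3 g4 hfv₂
  have hX : (({u, v} : Set (Fin n)) \ {u}) \ {v} = ∅ := by
    ext x
    simp only [Set.mem_sdiff, Set.mem_insert_iff, Set.mem_singleton_iff, Set.mem_empty_iff_false,
      iff_false]
    tauto
  rw [hX] at e4
  exact ⟨hs₄, ⟨k + k₂, by omega, hf.trans hf₂⟩, ⟨e2, e3, e4⟩, e1⟩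

/-- The position of the edge in the arrays is not known, so both endpoints are reset, whether or not
the edge is matched. The scan costs no more than the reversed arcs plus one, which the potential
pays for. Two resets here and at most four in the searches make six. -/
lemma deleteProgram_spec {u v : Fin n} (hN : IsNeighborhood n N) (huv : (v : ℕ) ∈ N u)
    (hs : Ok n N s) (h1 : s.reg 1 = u) (h2 : s.reg 2 = v)
    (h : Rep N s.mem) (hsol : IsSolution G (arcs n s.mem) (mateInMemory s.mem))
    (hu : Near N A u) (hv : Near N A v) :
    ∃ D, Does A (Ok n N) deleteProgram s (72 * D + 400) fun s' => Ok n N s' ∧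
      Serves N (Update.apply G ⟨.delete, u, v⟩) (eraseEdge (arcs n s.mem) u v) D s'.mem := by
  have hne : u ≠ v := fun e => hN.ne huv (congrArg Fin.val e)
  have hu4 := hs.reg 1
  have hv4 := hs.reg 2
  have hun := u.2
  have hvn := v.2
  have hasymm := h.asymm hN hsol.orientation
  set E := eraseEdge (arcs n s.mem) u v with hE
  obtain ⟨a, ha⟩ : ∃ a, a = (Finset.univ.filter fun x => (u, x) ∈ E).card := ⟨_, rfl⟩
  obtain ⟨b, hb⟩ : ∃ b, b = (Finset.univ.filter fun x => (v, x) ∈ flipAll E u).card := ⟨_, rfl⟩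
  have hod := h.outdeg_le_eraseEdge hN u v
  rw [← hE, ← ha] at hod
  suffices hsuff : ∃ D, Does A (Ok n N) deleteProgram s (72 * (a + b + D) + 400) fun s' =>
      Ok n N s' ∧ Serves N (Update.apply G ⟨.delete, u, v⟩) E (a + b + D) s'.mem by
    obtain ⟨D, hD⟩ := hsuff
    exact ⟨_, hD⟩
  refine Does.seq_exists (T₁ := 4) (T₂ := fun D => 72 * (a + b + D) + 390)
    (Q₁ := fun s' => Ok n N s' ∧ s'.mem = s.mem ∧ s'.reg 1 = u ∧ s'.reg 2 = v ∧ s'.reg 13 = u ∧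
      s'.reg 14 = v) ((Does.block hs ?_).mono le_rfl ?_) ?_ (fun D => by omega)
  · simp [SafeAll, Instr.Safe, Instr.run, RamState.setReg]
    omega
  · rintro s' ⟨rfl, hfit⟩
    refine ⟨hfit, ?_⟩
    simp [runAll, Instr.run, RamState.setReg, h1, h2]
  rintro s₁ ⟨hs₁, hm₁, r1, r2, r13, r14⟩
  have hR₁ := resetProgram_spec hN hs₁ r13 r14 (hm₁ ▸ h) (hm₁ ▸ hasymm) hu.1
    fun w hw => ⟨(hu.2 w hw).1, fun x hx => ((hu.2 w hw).2 x hx).1⟩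
  rw [hm₁] at hR₁
  refine Does.seq_exists (T₂ := fun D => 72 * (b + D) + 310) hR₁ ?_ (fun D => by omega)
  rintro s₂ ⟨hs₂, hreset₂, hasymm₂, ha₂⟩
  have r1 := ha₂.2.1.trans r1
  have r2 := ha₂.2.2.1.trans r2
  have hod₂ := hreset₂.outdeg_le hN hasymm
  rw [← hE, ← hb] at hod₂
  refine Does.seq_exists (T₁ := 4) (T₂ := fun D => 72 * (b + D) + 300)
    (Q₁ := fun s' => Ok n N s' ∧ s'.mem = s₂.mem ∧ s'.reg 1 = u ∧ s'.reg 2 = v ∧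
      s'.reg 13 = v ∧ s'.reg 14 = u) ((Does.block hs₂ ?_).mono le_rfl ?_) ?_ (fun D => by omega)
  · simp [SafeAll, Instr.Safe, Instr.run, RamState.setReg, r1, r2]
    omega
  · rintro s' ⟨rfl, hfit⟩
    refine ⟨hfit, ?_⟩
    simp [runAll, Instr.run, RamState.setReg, r1, r2]
  rintro s₃ ⟨hs₃, hm₃, r1, r2, r13, r14⟩
  have hR₃ := resetProgram_spec hN hs₃ r13 r14 (hm₃ ▸ hreset₂.rep) (hm₃ ▸ hasymm₂) hv.1
    fun w hw => ⟨(hv.2 w hw).1, fun x hx => ((hv.2 w hw).2 x hx).1⟩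
  rw [hm₃] at hR₃
  refine Does.seq_exists (T₂ := fun D => 72 * D + 200) hR₃ ?_ (fun D => by omega)
  rintro s₄ ⟨hs₄, hreset₄, hasymm₄, ha₄⟩
  have r1 := ha₄.2.1.trans r1
  have r2 := ha₄.2.2.1.trans r2
  have harcs := reset_reset hne hasymm hreset₂ hreset₄
  rw [← hE] at harcs
  have hflips : Flips 2 (a + b) E (arcs n s₄.mem) := by
    rw [harcs, ha, hb]
    exact (flips_flipAll E u).trans (flips_flipAll _ v)
  have hO : IsOrientation (Update.apply G ⟨.delete, u, v⟩) (arcs n s₄.mem) := by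
    rw [harcs]
    exact ((hsol.orientation.eraseEdge u v).flipAll u).flipAll v
  have hmate : mateInMemory (n := n) s₄.mem = mateInMemory s.mem :=
    hreset₄.mateInMemory_eq.trans hreset₂.mateInMemory_eq
  have hv0 : cell s₄.mem 1 v 0 = 0 := Rep.outdeg_eq_zero (hreset₄.no_arc hasymm₂)
  have hu0 : cell s₄.mem 1 u 0 = 0 := by
    refine Rep.outdeg_eq_zero fun c => ?_
    rw [hreset₄.arc]
    rintro (h1 | ⟨-, -, h1⟩)
    · exact hreset₂.no_arc hasymm c h1.1
    · exact h1 rfl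
  refine Does.seq_exists (T₁ := 5) (T₂ := fun D => 72 * D + 190)
    (Q₁ := fun s' => Ok n N s' ∧ s'.mem = s₄.mem ∧ s'.reg 1 = u ∧ s'.reg 2 = v ∧
      s'.reg 5 = 0 ∧ s'.reg 7 = cell s₄.mem 0 u 0 ∧ s'.reg 8 = v + 1)
    ((Does.block hs₄ ?_).mono le_rfl ?_) ?_ (fun D => by omega)
  · simp [SafeAll, Instr.Safe, Instr.run, RamState.setReg, r1, r2, hu.1]
    omega
  · rintro s' ⟨rfl, hfit⟩
    refine ⟨hfit, ?_⟩
    simp [runAll, Instr.run, RamState.setReg, r1, r2, cell]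
  rintro s₅ ⟨hs₅, hm₅, r1, r2, r5, r7, r8⟩
  by_cases hm : mateInMemory s.mem u = some (v : ℕ)
  · have htest : s₅.reg 7 = s₅.reg 8 := by
      rw [r7, r8, ← mateInMemory_eq_some, hmate]
      exact hm
    have hclear : mateInMemory (n := n) (put (put s₅.mem 0 u 0 0) 0 v 0 0) =
        clearMates (mateInMemory s.mem) u v := by
      ext1 x
      unfold clearMates
      split
      · rename_i hx
        rw [mateInMemory_eq_none, cell_putMate_zero, cell_putMate_zero]
        rcases hx with rfl | rfl <;> simp
      · rename_i hx
        push Not at hx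
        rw [← hmate, ← hm₅]
        refine mateInMemory_congr ?_
        rw [cell_putMate_zero, cell_putMate_zero, if_neg (fun h => hx.2 (Fin.ext h.1)),
          if_neg (fun h => hx.1 (Fin.ext h.1))]
    obtain ⟨D, hD⟩ := separate_and_rematch (G := Update.apply G ⟨.delete, u, v⟩) hN hne
      (by rw [Update.apply_delete_adj]; simp) hs₅ r1 r2 r5 (hm₅ ▸ hreset₄.rep) (hm₅ ▸ hO) rfl
      (hclear ▸ hsol.mates.clearMates hm) (hclear ▸ hsol.maximal.clearMates u v) (hm₅ ▸ hu0)
      (hm₅ ▸ hv0) hu hv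
    refine ⟨D, (Does.ite (b := .eq 7 8) (fun _ => hD.mono le_rfl ?_)
      fun hb => absurd htest hb).mono (by omega) fun _ h => h⟩
    rintro s₆ ⟨hs₆, ⟨k, hk, hf⟩, hsol₆, hrep₆⟩
    rw [hm₅] at hf
    exact ⟨hs₆, ⟨2 + k, by omega, hflips.trans hf⟩, hsol₆, hrep₆⟩
  · have htest : ¬ s₅.reg 7 = s₅.reg 8 := by
      rw [r7, r8, ← mateInMemory_eq_some, hmate]
      exact hm
    refine ⟨0, (Does.ite (b := .eq 7 8) (T := 1) (fun hb => absurd hb htest)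
      fun _ => Does.skip ⟨hs₅, ?_⟩).mono (by omega) fun _ h => h⟩
    rw [hm₅]
    refine ⟨⟨2, by omega, hflips⟩, ⟨hO, ?_, ?_⟩, hreset₄.rep⟩
    · rw [hmate]
      exact hsol.mates.delete hm
    · rw [hmate]
      exact hsol.maximal.delete u v

end UpdateProgram

end DynMatching

namespace DynMatching

/-! ### Locality, space and total time of the program -/

section CentralizedMain

variable {n α : ℕ} {σ : List (Update n)} {G : SimpleGraph (Fin n)}

/-- The graph `G` together with the edge `uv`. -/
abbrev withEdge (G : SimpleGraph (Fin n)) (u v : Fin n) : SimpleGraph (Fin n) :=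
  G ⊔ SimpleGraph.edge u v

/-- The edge `uv` may be missing from `G`, but a step along it ends in `u` or `v` and thus never
leads further away. Three steps are needed: to the partner, to the head of an arc, and to the tail
of a moved entry. -/
lemma near_ball (G : SimpleGraph (Fin n)) (u v : Fin n) {y : Fin n} (hy : y = u ∨ y = v) :
    Near (nbhd (withEdge G u v)) (ball G u v 3) y := by
  set P : ℕ → Fin n → Prop := fun k z => G.edist u z ≤ k ∨ G.edist v z ≤ k with hP
  have hmem : ∀ k ≤ 3, ∀ z, P k z → (z : ℕ) ∈ ball G u v 3 := by
    intro k hk z hz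
    have hk' : (k : ℕ∞) ≤ (3 : ℕ) := by exact_mod_cast hk
    exact ⟨z, rfl, hz.imp (fun h => h.trans hk') (fun h => h.trans hk')⟩
  have hstep : ∀ k a b, P k a → (withEdge G u v).Adj a b → P (k + 1) b := by
    intro k a b ha hab
    rcases hab with hab | hab
    · have h1 : G.edist a b ≤ 1 := (SimpleGraph.edist_eq_one_iff_adj.2 hab).le
      refine ha.imp (fun h => ?_) (fun h => ?_)
      all_goals
        refine (SimpleGraph.edist_triangle (v := a)).trans ?_
        push_cast
        exact add_le_add h h1
    · rw [SimpleGraph.edge_adj] at hab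
      rcases hab.1 with ⟨-, rfl⟩ | ⟨-, rfl⟩
      · exact Or.inr (by simp)
      · exact Or.inl (by simp)
  have h0 : P 0 y := by
    rcases hy with rfl | rfl
    · exact Or.inl (by simp)
    · exact Or.inr (by simp)
  refine ⟨hmem 0 (by omega) y h0, fun w hw => ?_⟩
  obtain ⟨y', w, hy', rfl, hyw⟩ := mem_nbhd.1 hw
  obtain rfl := Fin.ext hy'
  have h1 := hstep 0 _ _ h0 hyw
  refine ⟨hmem 1 (by omega) w h1, fun x hx => ?_⟩
  obtain ⟨w', x, hw', rfl, hwx⟩ := mem_nbhd.1 hx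
  obtain rfl := Fin.ext hw'
  have h2 := hstep 1 _ _ h1 hwx
  refine ⟨hmem 2 (by omega) x h2, fun z hz => ?_⟩
  obtain ⟨x', z, hx', rfl, hxz⟩ := mem_nbhd.1 hz
  obtain rfl := Fin.ext hx'
  exact hmem 3 le_rfl z (hstep 2 _ _ h2 hxz)

/-- The sum of degrees gives `4 * n + 8 * (|E| + 1)`, where the extra edge is `uv`; the vertex `u`
shows that `n` is positive. -/
lemma sum_len_le (G : SimpleGraph (Fin n)) (u v : Fin n) :
    ∑ x ∈ Finset.range n, len n (nbhd (withEdge G u v)) x ≤ 12 * (n + G.edgeSet.ncard) := by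
  classical
  set H := withEdge G u v with hH
  have h1 : ∀ x : Fin n, len n (nbhd H) x = 4 * H.degree x + 4 := by
    intro x
    rw [len_eq x.2, nbhd, dif_pos x.2, Finset.card_image_of_injective _ Fin.val_injective,
      ← SimpleGraph.card_neighborFinset_eq_degree]
    congr 3
    ext b
    simp
  have h2 : ∀ inst : Fintype H.edgeSet,
      (@SimpleGraph.edgeFinset _ H inst).card ≤ G.edgeSet.ncard + 1 := by
    intro inst
    rw [← Set.ncard_coe_finset, SimpleGraph.coe_edgeFinset]
    refine (Set.ncard_le_ncard (t := insert s(u, v) G.edgeSet) ?_).trans (Set.ncard_insert_le _ _)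
    exact Update.edgeSet_apply_insert G u v
  have h3 := u.2
  have h4 : ∑ x, H.degree x ≤ 2 * (G.edgeSet.ncard + 1) := by
    rw [H.sum_degrees_eq_twice_card_edges]
    exact Nat.mul_le_mul_left 2 (h2 _)
  rw [Finset.sum_range fun x => len n (nbhd H) x, Finset.sum_congr rfl fun x _ => h1 x,
    Finset.sum_add_distrib, ← Finset.mul_sum]
  simp only [Finset.sum_const, Finset.card_univ, Fintype.card_fin, smul_eq_mul]
  omega

lemma Ok.withinLimits {u v : Fin n} {s : RamState}
    (h : Ok n (nbhd (withEdge G u v)) s) :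
    WithinLimits 4 n (12 * (n + G.edgeSet.ncard)) s := by
  have hn := u.2
  have hword : ∀ x, x ≤ 4 * n + 7 → IsWord 4 n x := by
    intro x hx
    have h1 : n < 2 ^ Nat.size n := Nat.lt_size_self n
    have h2 : 0 < Nat.size n := Nat.size_pos.2 (by omega)
    rw [IsWord, Nat.size_le]
    have h3 : 8 * 2 ^ Nat.size n ≤ 2 ^ (4 * Nat.size n) := by
      rw [show 8 = 2 ^ 3 by norm_num, ← pow_add]
      exact Nat.pow_le_pow_right (by norm_num) (by omega)
    omega
  refine ⟨fun x => hword _ (h.reg x), fun v i => hword _ (h.mem v i), len n _, fun v i hvi => ?_,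
    sum_len_le G u v⟩
  have h1 := h.support v i hvi
  refine ⟨?_, h1⟩
  by_contra hv
  rw [len, if_neg hv] at h1
  omega

/-- The graph with the edge `uv` contains the graphs before and after the update, so a single family
of neighborhoods serves throughout the update. -/
lemma le_withEdge_apply {e : Update n} (he : e.Valid G) :
    G ≤ withEdge (e.apply G) e.u e.v ∧ e.apply G ≤ withEdge (e.apply G) e.u e.v ∧
      (withEdge (e.apply G) e.u e.v).Adj e.u e.v := by
  have hne := he.ne
  refine ⟨?_, le_sup_left, Or.inr (by simp [SimpleGraph.edge_adj, hne])⟩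
  rcases e with ⟨_ | _, u, v⟩
  · exact fun x y hxy => Or.inl ((Update.apply_insert_adj hne).2 (Or.inl hxy))
  · intro x y hxy
    by_cases hxy' : (x = u ∧ y = v) ∨ (x = v ∧ y = u)
    · exact Or.inr (by rw [SimpleGraph.edge_adj]; exact ⟨hxy', hxy.ne⟩)
    · exact Or.inl (Update.apply_delete_adj.2 ⟨hxy, hxy'⟩)

/-- The condition on the memory between two updates. -/
structure IsStored (G : SimpleGraph (Fin n)) (m : Memory) : Prop where
  rep : ∃ N, IsNeighborhood n N ∧ Rep N m
  solution : IsSolution G (arcs n m) (mateInMemory m)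
  support : ∀ v, n ≤ v → m v 0 = 0

lemma updateProgram_spec {e : Update n} (he : e.Valid G) {m : Memory} (hm : IsStored G m) :
    ∃ O₁ D m' t s', (O₁ \ arcs n m).card ≤ 1 ∧ (∀ a ∈ O₁, (e.apply G).Adj a.1 a.2) ∧
      (∃ k ≤ 6, Flips k D O₁ (arcs n m')) ∧ IsStored (e.apply G) m' ∧ t ≤ 72 * D + 403 ∧
      s'.mem = m' ∧ Exec (ball (e.apply G) e.u e.v 3)
        (WithinLimits 4 n (12 * (n + (e.apply G).edgeSet.ncard))) updateProgram
        (inputState e m) t s' := by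
  obtain ⟨⟨N, hN, hrep⟩, hsol, hsupp⟩ := hm
  obtain ⟨hle, -, huv⟩ := le_withEdge_apply he
  have hN' := isNeighborhood_nbhd (withEdge (e.apply G) e.u e.v)
  have hrep' := hrep.restrict hN hsol.orientation hle
  have hs : Ok n (nbhd (withEdge (e.apply G) e.u e.v)) (inputState e m) := by
    refine hrep'.ok hN' hsol.mates hsupp fun x => ?_
    have hu := e.u.2
    have hv := e.v.2
    match x with
    | 0 =>
      simp only
      split <;> omega
    | 1 =>
      simp only
      omega
    | 2 =>
      simp only
      omega
    | (x + 3) => simp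
  have huvN : (e.v : ℕ) ∈ nbhd (withEdge (e.apply G) e.u e.v) e.u :=
    mem_nbhd.2 ⟨e.u, e.v, rfl, rfl, huv⟩
  have hnu := near_ball (e.apply G) e.u e.v (Or.inl rfl)
  have hnv := near_ball (e.apply G) e.u e.v (Or.inr rfl)
  suffices hsuff : ∃ O₁, (O₁ \ arcs n m).card ≤ 1 ∧ (∀ a ∈ O₁, (e.apply G).Adj a.1 a.2) ∧
      ∃ D, Does (ball (e.apply G) e.u e.v 3) (Ok n (nbhd (withEdge (e.apply G) e.u e.v)))
        updateProgram (inputState e m) (72 * D + 403) fun s' =>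
          Ok n (nbhd (withEdge (e.apply G) e.u e.v)) s' ∧
          Serves (nbhd (withEdge (e.apply G) e.u e.v)) (e.apply G) O₁ D s'.mem by
    obtain ⟨O₁, h1, h2, D, t, ht, s', h3, h4, h5⟩ := hsuff
    refine ⟨O₁, D, s'.mem, t, s', h1, h2, h5.flips, ⟨⟨_, hN', h5.rep⟩, h5.solution, ?_⟩, ht, rfl,
      h3.mono fun _ => Ok.withinLimits⟩
    intro v hv
    by_contra hne
    have := h4.support v 0 hne
    rw [len, if_neg (by omega)] at this
    omega
  have hne := he.ne
  rcases e with ⟨_ | _, u, v⟩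
  · refine ⟨insert (u, v) (arcs n m), card_insert_sdiff_le _ _, fun a ha =>
      (hsol.orientation.insert hne he.2).adj ha, ?_⟩
    refine Does.seq_exists (T₁ := 2) (T₂ := fun D => 72 * D + 301)
      (Q₁ := fun s' => s' = (inputState ⟨.insert, u, v⟩ m).setReg 5 0 ∧ _)
      (Does.block hs (by simp [SafeAll, Instr.Safe])) ?_ (fun D => by omega)
    rintro s₁ ⟨rfl, hs₁⟩
    obtain ⟨D, hD⟩ := insertProgram_spec hN' huvN he.2 hs₁ rfl rfl hrep' hsol hnu hnv
    exact ⟨D, Does.ite (fun _ => hD) fun hb => absurd rfl hb⟩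
  · refine ⟨eraseEdge (arcs n m) u v, card_eraseEdge_sdiff_le _ _ _, fun a ha =>
      (hsol.orientation.eraseEdge u v).adj ha, ?_⟩
    refine Does.seq_exists (T₁ := 2) (T₂ := fun D => 72 * D + 401)
      (Q₁ := fun s' => s' = (inputState ⟨.delete, u, v⟩ m).setReg 5 0 ∧ _)
      (Does.block hs (by simp [SafeAll, Instr.Safe])) ?_ (fun D => by omega)
    rintro s₁ ⟨rfl, hs₁⟩
    obtain ⟨D, hD⟩ := deleteProgram_spec hN' huvN hs₁ rfl rfl hrep' hsol hnu hnv
    exact ⟨D, Does.ite (fun hb => absurd (show (1 : ℕ) = 0 from hb) one_ne_zero) fun _ => hD⟩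

lemma isStored_zero : IsStored (⊥ : SimpleGraph (Fin n)) (fun _ _ => 0) := by
  have harc : ∀ a b, ¬ Arc (fun _ _ => 0) a b := by
    rintro a b ⟨j, hj, hj', -⟩
    simp only [cell] at hj'
    omega
  refine ⟨⟨fun _ => ∅, ⟨by simp, by simp, by simp⟩, ?_⟩, ⟨⟨?_, ?_, ?_⟩, ?_, ?_⟩, fun _ _ => rfl⟩
  · constructor <;> simp only [cell] <;> intros <;> first | rfl | omega | simp
  · intro v w h
    exact absurd (mem_arcs.1 h) (harc _ _)
  · intro v w h
    exact absurd h (by simp)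
  · intro v w h
    exact absurd (mem_arcs.1 h) (harc _ _)
  · intro v k hv
    rw [mateInMemory_eq_some] at hv
    simp [cell] at hv
  · intro v w h
    exact absurd h (by simp)

lemma updateProgram_correct (h : ArboricityPreserving α σ) :
    ∃ (mem : ℕ → Memory) (time : ℕ → ℕ),
      mem 0 = (fun _ _ => 0) ∧
      (∀ i (hi : i < σ.length), ∃ s' : RamState, s'.mem = mem (i + 1) ∧
        Exec (ball (graphAt σ (i + 1)) (σ[i]).u (σ[i]).v 3)
          (WithinLimits 4 n (12000 * (n + (graphAt σ (i + 1)).edgeSet.ncard)))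
          updateProgram (inputState σ[i] (mem i)) (time i) s') ∧
      (∀ i ≤ σ.length, DescribesMaximalMatching (graphAt σ i) (mateInMemory (mem i))) ∧
      (∑ i ∈ Finset.range σ.length, (time i : ℝ)) ≤
        (12000 : ℕ) * (α + Real.sqrt (α * Real.log n)) * σ.length := by
  -- The successor is made a total function of the memory, so that the sequence of memories can be
  -- defined by recursion before it is known to be valid.
  have hstep : ∀ i (m : Memory), ∃ m' : Memory, ∃ O₁ D t, IsStored (graphAt σ i) m →
      ∀ hi : i < σ.length, (O₁ \ arcs n m).card ≤ 1 ∧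
      (∀ a ∈ O₁, (graphAt σ (i + 1)).Adj a.1 a.2) ∧ (∃ k ≤ 6, Flips k D O₁ (arcs n m')) ∧
      IsStored (graphAt σ (i + 1)) m' ∧ t ≤ 72 * D + 403 ∧ ∃ s' : RamState, s'.mem = m' ∧
        Exec (ball (graphAt σ (i + 1)) (σ[i]).u (σ[i]).v 3)
          (WithinLimits 4 n (12 * (n + (graphAt σ (i + 1)).edgeSet.ncard)))
          updateProgram (inputState σ[i] m) t s' := by
    intro i m
    by_cases hm : IsStored (graphAt σ i) m ∧ i < σ.length
    · obtain ⟨O₁, D, m', t, s', h1, h2, h3, h4, h5, h6, h7⟩ :=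
        updateProgram_spec (h i hm.2).1 hm.1
      rw [← graphAt_succ σ hm.2] at h2 h4 h7
      exact ⟨m', O₁, D, t, fun _ _ => ⟨h1, h2, h3, h4, h5, s', h6, h7⟩⟩
    · exact ⟨m, ∅, 0, 0, fun h1 h2 => absurd ⟨h1, h2⟩ hm⟩
  choose next O₁ D t hnext using hstep
  set mem : ℕ → Memory := fun i => Nat.rec (fun _ _ => 0) next i with hmem
  have hsucc : ∀ i, mem (i + 1) = next i (mem i) := fun _ => rfl
  have hstored : ∀ i ≤ σ.length, IsStored (graphAt σ i) (mem i) := by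
    intro i
    induction i with
    | zero =>
      intro _
      rw [graphAt_zero]
      exact isStored_zero
    | succ i ih => exact fun hi => (hnext i (mem i) (ih (by omega)) hi).2.2.2.1
  have hall := fun i (hi : i < σ.length) => hnext i (mem i) (hstored i hi.le) hi
  refine ⟨mem, fun i => t i (mem i), rfl, fun i hi => ?_, fun i hi => ?_, ?_⟩
  · obtain ⟨-, -, -, -, -, s', h1, h2⟩ := hall i hi
    refine ⟨s', h1, h2.mono fun s hs => ⟨hs.1, hs.2.1, ?_⟩⟩
    obtain ⟨len, h3, h4⟩ := hs.2.2
    exact ⟨len, h3, h4.trans (Nat.mul_le_mul_right _ (by norm_num))⟩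
  · exact (hstored i hi).solution.maximal.describes (hstored i hi).solution.mates
  · have hsum := h.sum_flips_le (fun i => arcs n (mem i)) (fun i => D i (mem i))
      (Finset.eq_empty_of_forall_notMem fun a ha => by
        have := isStored_zero.solution.orientation.adj (v := a.1) (w := a.2) ha
        simp at this)
      fun i hi => by
        obtain ⟨h1, h2, ⟨k, hk, h3⟩, -⟩ := hall i hi
        exact ⟨O₁ i (mem i), k, h1, h2, hk, h3⟩
    have hlen := h.length_le
    calc ∑ i ∈ Finset.range σ.length, (t i (mem i) : ℝ)
        ≤ ∑ i ∈ Finset.range σ.length, (72 * (D i (mem i) : ℝ) + 403) := by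
          refine Finset.sum_le_sum fun i hi => ?_
          have := (hall i (Finset.mem_range.1 hi)).2.2.2.2.1
          exact_mod_cast this
      _ = 72 * ∑ i ∈ Finset.range σ.length, (D i (mem i) : ℝ) + 403 * σ.length := by
          rw [Finset.sum_add_distrib, ← Finset.mul_sum]
          simp [mul_comm]
      -- `72 * 152 + 403 = 11347`.
      _ ≤ (12000 : ℕ) * (α + Real.sqrt (α * Real.log n)) * σ.length := by
          push_cast
          have h1 : (0 : ℝ) ≤ σ.length := Nat.cast_nonneg _
          nlinarith

end CentralizedMain

end DynMatching

/-! ### The theorem -/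

open DynMatching
theorem mainTheorem6 :
    -- a local centralized algorithm
    (∃ (P : Program) (C r K : ℕ), ∀ (n α : ℕ) (σ : List (Update n)), ArboricityPreserving α σ →
      ∃ (mem : ℕ → Memory) (time : ℕ → ℕ),
        mem 0 = (fun _ _ => 0) ∧
        (∀ i (hi : i < σ.length), ∃ s' : RamState, s'.mem = mem (i + 1) ∧
          Exec (ball (graphAt σ (i + 1)) (σ[i]).u (σ[i]).v r)
            (WithinLimits K n (C * (n + (graphAt σ (i + 1)).edgeSet.ncard)))
            P (inputState σ[i] (mem i)) (time i) s') ∧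
        (∀ i ≤ σ.length, DescribesMaximalMatching (graphAt σ i) (mateInMemory (mem i))) ∧
        (∑ i ∈ Finset.range σ.length, (time i : ℝ)) ≤
          C * (α + Real.sqrt (α * Real.log n)) * σ.length) ∧
    -- a distributed algorithm
    (∃ (P : Protocol) (C R K : ℕ), ∀ (n α : ℕ) (σ : List (Update n)), ArboricityPreserving α σ →
      (∀ i (hi : i < σ.length), (P.config R σ i hi R).Finished ∧
        ∀ k ≤ R, ∀ w x a, (P.config R σ i hi k).inbox w x = some a → IsWord K n a) ∧
      (∀ i ≤ σ.length, DescribesMaximalMatching (graphAt σ i)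
        (fun v => P.mate (P.statesAfter R σ i v))) ∧
      (∑ i : Fin σ.length, ∑ k ∈ Finset.range R,
          ((P.config R σ i i.isLt (k + 1)).messageCount : ℝ)) ≤
        C * (α + Real.sqrt (α * Real.log n)) * σ.length) := by

  exact ⟨⟨updateProgram, 12000, 3, 4, fun _ _ _ h => updateProgram_correct h⟩,
    matchingProtocol, 306, 12, 4, fun _ _ _ h => matchingProtocol_correct h⟩
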